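/- Let $N>1$ be an integer and let $p_1\le\dots\le p_N$ be real numbers with $2<p_i<\bar p^*$ for all $i$, where $\bar p=N\big(\sum_{i=1}^N 1/p_i\big)^{-1}<N$ and $\bar p^*=N\bar p/(N-\bar p)$. For $\rho,M>0$ and $(y,s)\in\mathbb R^N\times\mathbb R$ put $$(y,s)+\mathcal Q^-_\rho(M)=\prod_{i=1}^N\Big\{|x_i-y_i|<M^{\frac{p_i-2}{p_i}}\rho^{\frac{\bar p}{p_i}}\Big\}\times(s-\rho^{\bar p},s],\qquad (y,s)+\mathcal Q_\rho(M)=\prod_{i=1}^N\Big\{|x_i-y_i|<M^{\frac{p_i-2}{p_i}}\rho^{\frac{\bar p}{p_i}}\Big\}\times(s-\rho^{\bar p},s+\rho^{\bar p}].$$ For a bounded open set $\Omega\subset\mathbb R^N$ and $T>0$ put $\Omega_T=\Omega\times(-T,T)$. A local weak super-solution (resp. sub-solution) of $$\partial_t u=\sum_{i=1}^N\partial_i\big(|\partial_i u|^{p_i-2}\partial_i u\big)\quad\text{in }\Omega_T$$ is a function $u\in C^0_{loc}(-T,T;L^2_{loc}(\Omega))\cap L^1_{loc}(-T,T;W^{1,1}_{loc}(\Omega))$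 with weak spatial derivatives $\partial_i u\in L^{p_i}_{loc}(-T,T;L^{p_i}_{loc}(\Omega))$ such that, for all compact $K\subset\Omega$ and all $-T<t_1<t_2<T$, $$\int_K u\varphi\,dx\Big|_{t_1}^{t_2}+\int_{t_1}^{t_2}\!\!\int_K\Big(-u\,\partial_t\varphi+\sum_{i=1}^N|\partial_i u|^{p_i-2}\partial_i u\,\partial_i\varphi\Big)dx\,dt\ \ge 0\quad(\text{resp. }\le 0)$$ for every nonnegative $\varphi\in C^\infty(\mathbb R^N\times\mathbb R)$ with $\varphi(x,t)=0$ for all $x\notin K$ and all $t$. Let $\theta,\omega>0$, $\xi\in(0,1]$ and $a\in(0,1)$. Then there are $\nu^-,\nu^+\in(0,1)$, depending only on $N,p_1,\dots,p_N,\theta,\omega,\xi,a$, such that for every bounded open $\Omega\subset\mathbb R^N$, every $T>0$, every $(y,s)\in\Omega_T$ and every $\rho>0$ with $(y,s)+\mathcal Q_{2\rho}(\theta)\subset\subset\Omega_T$ the following hold. (i) Let $u$ be a local weak super-solution in $\Omega_T$, locally bounded from below, and let $\mu^-\in\mathbb R$ satisfy $\mu^-\le\operatorname{ess\,inf}_{(y,s)+\mathcal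 Q_{2\rho}(\theta)}u$. If $$\big|[u\le\mu^-+\xi\omega]\cap[(y,s)+\mathcal Q^-_{2\rho}(\theta)]\big|\le\nu^-\,|\mathcal Q^-_{2\rho}(\theta)|,$$ then $u\ge\mu^-+a\xi\omega$ a.e. in $(y,s)+\mathcal Q^-_\rho(\theta)$. (ii) Let $u$ be a local weak sub-solution in $\Omega_T$, locally bounded from above, and let $\mu^+\in\mathbb R$ satisfy $\mu^+\ge\operatorname{ess\,sup}_{(y,s)+\mathcal Q_{2\rho}(\theta)}u$. If $$\big|[u\ge\mu^+-\xi\omega]\cap[(y,s)+\mathcal Q^-_{2\rho}(\theta)]\big|\le\nu^+\,|\mathcal Q^-_{2\rho}(\theta)|,$$ then $u\le\mu^+-a\xi\omega$ a.e. in $(y,s)+\mathcal Q^-_\rho(\theta)$. -/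

import Mathlib

open MeasureTheory Set Filter Topology

namespace AnisoParabolic

noncomputable section

open scoped ContDiff

/-- The harmonic mean `N (∑ 1 / pᵢ)⁻¹` of the exponents. -/
def pBar {N : ℕ} (p : Fin N → ℝ) : ℝ := (N : ℝ) * (∑ i, 1 / p i)⁻¹

/-- The Sobolev exponent of the harmonic mean, meaningful when `pBar p < N`. -/
def pBarStar {N : ℕ} (p : Fin N → ℝ) : ℝ := (N : ℝ) * pBar p / ((N : ℝ) - pBar p)

/-- Standing assumptions on the dimension and the exponents. -/
structure Admissible {N : ℕ} (p : Fin N → ℝ) : Prop where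
  one_lt_dim : 1 < N
  mono : Monotone p
  two_lt : ∀ i, 2 < p i
  pBar_lt : pBar p < (N : ℝ)
  lt_pBarStar : ∀ i, p i < pBarStar p

/-- The space-time cylinder `Ω × (-T, T)`. -/
def spaceTime {N : ℕ} (Ω : Set (Fin N → ℝ)) (T : ℝ) : Set ((Fin N → ℝ) × ℝ) :=
  Ω ×ˢ Ioo (-T) T

/-- The intrinsic cube `y + K_ρ(M)`. -/
def cube {N : ℕ} (p : Fin N → ℝ) (ρ M : ℝ) (y : Fin N → ℝ) : Set (Fin N → ℝ) :=
  {x | ∀ i, |x i - y i| < M ^ ((p i - 2) / p i) * ρ ^ (pBar p / p i)}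

/-- The backward intrinsic cylinder `(y, s) + Q⁻_ρ(M)`. -/
def backCylinder {N : ℕ} (p : Fin N → ℝ) (ρ M : ℝ) (y : Fin N → ℝ) (s : ℝ) :
    Set ((Fin N → ℝ) × ℝ) :=
  cube p ρ M y ×ˢ Ioc (s - ρ ^ pBar p) s

/-- The full intrinsic cylinder `(y, s) + Q_ρ(M)`. -/
def fullCylinder {N : ℕ} (p : Fin N → ℝ) (ρ M : ℝ) (y : Fin N → ℝ) (s : ℝ) :
    Set ((Fin N → ℝ) × ℝ) :=
  cube p ρ M y ×ˢ Ioc (s - ρ ^ pBar p) (s + ρ ^ pBar p)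

/-- `A ⊂⊂ B`. -/
def CompactlyIn {X : Type*} [TopologicalSpace X] (A B : Set X) : Prop :=
  IsCompact (closure A) ∧ closure A ⊆ B

/-- `w` is the `i`-th weak partial derivative of `v` in `Ω`. -/
structure IsWeakPartial {N : ℕ} (Ω : Set (Fin N → ℝ)) (i : Fin N)
    (v w : (Fin N → ℝ) → ℝ) : Prop where
  locInt : LocallyIntegrableOn v Ω
  locInt_deriv : LocallyIntegrableOn w Ω
  byParts : ∀ φ : (Fin N → ℝ) → ℝ, ContDiff ℝ ∞ φ → HasCompactSupport φ → tsupport φ ⊆ Ω →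
    ∫ x in Ω, v x * fderiv ℝ φ x (Pi.single i 1) = -∫ x in Ω, w x * φ x

/-- `u ∈ C⁰_loc(-T, T; L²_loc(Ω)) ∩ L^𝐩_loc(-T, T; W^{1,𝐩}_loc(Ω))`, with weak spatial gradient
`g = (∂₁u, …, ∂_N u)`; `u` is the representative that is continuous in time. -/
structure InSolutionSpace {N : ℕ} (p : Fin N → ℝ) (Ω : Set (Fin N → ℝ)) (T : ℝ)
    (u : (Fin N → ℝ) × ℝ → ℝ) (g : Fin N → (Fin N → ℝ) × ℝ → ℝ) : Prop where
  slice_memL2 : ∀ K : Set (Fin N → ℝ), IsCompact K → K ⊆ Ω → ∀ t ∈ Ioo (-T) T,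
    MemLp (fun x => u (x, t)) 2 (volume.restrict K)
  continuous_L2 : ∀ K : Set (Fin N → ℝ), IsCompact K → K ⊆ Ω → ∀ t ∈ Ioo (-T) T,
    Tendsto (fun r => eLpNorm (fun x => u (x, r) - u (x, t)) 2 (volume.restrict K))
      (𝓝 t) (𝓝 0)
  locInt : ∀ K : Set (Fin N → ℝ), IsCompact K → K ⊆ Ω → ∀ t₁ t₂ : ℝ, -T < t₁ → t₂ < T →
    IntegrableOn u (K ×ˢ Icc t₁ t₂)
  weakPartial : ∀ i, ∀ᵐ t ∂(volume.restrict (Ioo (-T) T)),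
    IsWeakPartial Ω i (fun x => u (x, t)) (fun x => g i (x, t))
  grad_memLp : ∀ i, ∀ K : Set (Fin N → ℝ), IsCompact K → K ⊆ Ω → ∀ t₁ t₂ : ℝ,
    -T < t₁ → t₂ < T →
    MemLp (g i) (ENNReal.ofReal (p i)) (volume.restrict (K ×ˢ Icc t₁ t₂))

/-- The left-hand side
`∫_K u φ dx |_{t₁}^{t₂} + ∫_{t₁}^{t₂} ∫_K (-u ∂ₜφ + ∑ᵢ |∂ᵢu|^{pᵢ-2} ∂ᵢu ∂ᵢφ) dx dt`
of the weak formulation, `g` being the weak spatial gradient of `u`. -/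
def weakForm {N : ℕ} (p : Fin N → ℝ) (u : (Fin N → ℝ) × ℝ → ℝ)
    (g : Fin N → (Fin N → ℝ) × ℝ → ℝ) (K : Set (Fin N → ℝ)) (t₁ t₂ : ℝ)
    (φ : (Fin N → ℝ) × ℝ → ℝ) : ℝ :=
  ((∫ x in K, u (x, t₂) * φ (x, t₂)) - ∫ x in K, u (x, t₁) * φ (x, t₁)) +
    ∫ z in K ×ˢ Icc t₁ t₂,
      (-(u z * fderiv ℝ φ z (0, 1)) +
        ∑ i, |g i z| ^ (p i - 2) * g i z * fderiv ℝ φ z (Pi.single i 1, 0))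

/-- Nonnegative smooth test functions whose spatial support stays in the compact set `K`. -/
structure IsTest {N : ℕ} (K : Set (Fin N → ℝ)) (φ : (Fin N → ℝ) × ℝ → ℝ) : Prop where
  smooth : ContDiff ℝ ∞ φ
  nonneg : ∀ z, 0 ≤ φ z
  supp : ∀ x t, x ∉ K → φ (x, t) = 0

/-- Local weak super-solutions of `∂ₜu = ∑ᵢ ∂ᵢ(|∂ᵢu|^{pᵢ-2} ∂ᵢu)` in `Ω × (-T, T)`. -/
def IsSuperSolution {N : ℕ} (p : Fin N → ℝ) (Ω : Set (Fin N → ℝ)) (T : ℝ)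
    (u : (Fin N → ℝ) × ℝ → ℝ) : Prop :=
  ∃ g : Fin N → (Fin N → ℝ) × ℝ → ℝ, InSolutionSpace p Ω T u g ∧
    ∀ K : Set (Fin N → ℝ), IsCompact K → K ⊆ Ω → ∀ t₁ t₂ : ℝ, -T < t₁ → t₁ < t₂ → t₂ < T →
      ∀ φ : (Fin N → ℝ) × ℝ → ℝ, IsTest K φ → 0 ≤ weakForm p u g K t₁ t₂ φ

/-- Local weak sub-solutions of `∂ₜu = ∑ᵢ ∂ᵢ(|∂ᵢu|^{pᵢ-2} ∂ᵢu)` in `Ω × (-T, T)`. -/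
def IsSubSolution {N : ℕ} (p : Fin N → ℝ) (Ω : Set (Fin N → ℝ)) (T : ℝ)
    (u : (Fin N → ℝ) × ℝ → ℝ) : Prop :=
  ∃ g : Fin N → (Fin N → ℝ) × ℝ → ℝ, InSolutionSpace p Ω T u g ∧
    ∀ K : Set (Fin N → ℝ), IsCompact K → K ⊆ Ω → ∀ t₁ t₂ : ℝ, -T < t₁ → t₁ < t₂ → t₂ < T →
      ∀ φ : (Fin N → ℝ) × ℝ → ℝ, IsTest K φ → weakForm p u g K t₁ t₂ φ ≤ 0

/-- Essentially bounded from below on every compact subset of `Ω × (-T, T)`. -/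
def LocBddBelow {N : ℕ} (Ω : Set (Fin N → ℝ)) (T : ℝ) (u : (Fin N → ℝ) × ℝ → ℝ) : Prop :=
  ∀ C : Set ((Fin N → ℝ) × ℝ), IsCompact C → C ⊆ spaceTime Ω T →
    ∃ m : ℝ, ∀ᵐ z ∂(volume.restrict C), m ≤ u z

/-- Essentially bounded from above on every compact subset of `Ω × (-T, T)`. -/
def LocBddAbove {N : ℕ} (Ω : Set (Fin N → ℝ)) (T : ℝ) (u : (Fin N → ℝ) × ℝ → ℝ) : Prop :=
  ∀ C : Set ((Fin N → ℝ) × ℝ), IsCompact C → C ⊆ spaceTime Ω T →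
    ∃ m : ℝ, ∀ᵐ z ∂(volume.restrict C), u z ≤ m

end

end AnisoParabolic

/-! This is De Giorgi's iteration in intrinsic geometry. With v = (k - u)₊, an energy inequality
bounds v on a smaller cylinder by the measure of [u < k] on a larger one. A parabolic Sobolev
embedding turns this into a gain of integrability, and Chebyshev's inequality then yields |[u < k -
d] ∩ Q'| ≤ C |[u < k] ∩ Q|^{1 + 1/N}. Along levels decreasing to μ⁻ + aξω and shrinking cylinders,
such a superlinear recursion tends to zero once its first term is small, and this smallness is the
hypothesis on ν⁻.

The equation is tested with v²η instead of the usual vη. For smooth u this function is already C¹,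
so no chain rule for weak derivatives of truncations is needed. The time term yields v³/3 and the
diffusion term yields 2vη ∑ |∂ᵢu|^{pᵢ}. The function v³η is then bounded in L^∞ in time with values
in L¹, and its spatial gradient is in L¹, because v²|∂ᵢu| is controlled by v|∂ᵢu|^{pᵢ} plus a
constant. The L¹ Gagliardo–Nirenberg–Sobolev inequality therefore suffices (`weighted_gns`,
`parabolic_embedding`).

The computation is made rigorous by mollifying in space-time. The differential inequality is linear
in the pair (u, flux), so the mollified u and the mollified flux satisfy it classically
(`sum_fderiv_mollify_flux_le`, `classical_energy`). The products pass to the limit because the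
mollified flux and gradient converge strongly in dual Lebesgue spaces, while the truncations stay
bounded by the lower bound on u (`MollifiedSuper.exists_approximation`,
`MollifiedSuper.parabolic_estimate`).

The intrinsic scaling enters only through Wᵢ^{pᵢ} = θ^{pᵢ-2} R, where the Wᵢ are the half-widths and
R is the time length. All terms of the energy inequality then carry the same factor 1/R, and the
volume R ∏ Wᵢ normalises the recursion, so the constants do not depend on ρ
(`MollifiedSuper.one_step`, `exists_deGiorgi_bound`). The flux is odd, so sub-solutions reduce to
super-solutions by a change of sign. -/

namespace AnisoParabolic

open scoped ENNReal NNReal Convolution ContDiff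

/-! ### Mollification on a finite-dimensional space -/

section Mollification

variable {E : Type*} [NormedAddCommGroup E] [NormedSpace ℝ E] [FiniteDimensional ℝ E]
  [MeasurableSpace E] [BorelSpace E]

/-- Translations act continuously on `L^p`. -/
theorem tendsto_eLpNorm_translate_sub {μ : Measure E} [μ.IsAddHaarMeasure] {p : ℝ≥0∞} (hp1 : 1 ≤ p)
    (hp : p ≠ ⊤) {f : E → ℝ} (hf : MemLp f p μ) :
    Tendsto (fun h => eLpNorm (fun x => f (x - h) - f x) p μ) (𝓝 0) (𝓝 0) := by
  have : Fact (1 ≤ p) := ⟨hp1⟩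
  let g : E → C(E, E) := fun h => ⟨fun x => x - h, by fun_prop⟩
  have hg : Continuous g := by
    refine ContinuousMap.continuous_of_continuous_uncurry _ ?_
    change Continuous fun q : E × E => q.2 - q.1
    fun_prop
  have hgm : ∀ h, MeasurePreserving (g h) μ μ := fun h => measurePreserving_sub_right μ h
  have h1 : Tendsto (fun h => Lp.compMeasurePreserving (g h) (hgm h) hf.toLp) (𝓝 0)
      (𝓝 (Lp.compMeasurePreserving (g 0) (hgm 0) hf.toLp)) :=
    (tendsto_const_nhds).compMeasurePreservingLp (hg.tendsto 0) hgm (hgm 0) hp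
  have h2 := (tendsto_iff_edist_tendsto_0).1 h1
  refine h2.congr fun h => ?_
  rw [Lp.edist_def]
  refine eLpNorm_congr_ae ?_
  have h0 : (Lp.compMeasurePreserving (g 0) (hgm 0) hf.toLp : E → ℝ) =ᵐ[μ] f := by
    refine (Lp.coeFn_compMeasurePreserving _ (hgm 0)).trans ?_
    refine ((hgm 0).quasiMeasurePreserving.ae_eq_comp hf.coeFn_toLp).trans ?_
    filter_upwards with x
    simp [g]
  have h3 : (Lp.compMeasurePreserving (g h) (hgm h) hf.toLp : E → ℝ) =ᵐ[μ] fun x => f (x - h) := by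
    refine (Lp.coeFn_compMeasurePreserving _ (hgm h)).trans ?_
    refine ((hgm h).quasiMeasurePreserving.ae_eq_comp hf.coeFn_toLp).trans ?_
    filter_upwards with x
    simp [g]
  filter_upwards [h0, h3] with x hx0 hx3
  rw [Pi.sub_apply, hx0, hx3]

/-- The mollification of `f` by the normalised bump function `φ`. -/
noncomputable def mollify (μ : Measure E) (φ : ContDiffBump (0 : E)) (f : E → ℝ) : E → ℝ :=
  f ⋆[ContinuousLinearMap.mul ℝ ℝ, μ] φ.normed μ

theorem mollify_apply (μ : Measure E) (φ : ContDiffBump (0 : E)) (f : E → ℝ) (x : E) :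
    mollify μ φ f x = ∫ t, f t * φ.normed μ (x - t) ∂μ := by
  simp [mollify, convolution_def]

theorem mollify_apply' (μ : Measure E) [μ.IsAddHaarMeasure] (φ : ContDiffBump (0 : E))
    (f : E → ℝ) (x : E) :
    mollify μ φ f x = ∫ h, φ.normed μ h * f (x - h) ∂μ := by
  rw [mollify_apply, ← integral_sub_left_eq_self _ μ x]
  refine integral_congr_ae (.of_forall fun t => ?_)
  simp [mul_comm]

theorem mollify_eq_lsmul (μ : Measure E) [μ.IsAddHaarMeasure] (φ : ContDiffBump (0 : E))
    (f : E → ℝ) (x : E) :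
    mollify μ φ f x = (φ.normed μ ⋆[ContinuousLinearMap.lsmul ℝ ℝ, μ] f) x := by
  rw [mollify_apply', convolution_def]
  simp

theorem mollify_congr {μ : Measure E} [μ.IsAddHaarMeasure] (φ : ContDiffBump (0 : E))
    {f g : E → ℝ} (h : f =ᵐ[μ] g) : mollify μ φ f = mollify μ φ g := by
  funext x
  rw [mollify_apply, mollify_apply]
  refine integral_congr_ae ?_
  filter_upwards [h] with t ht
  rw [ht]

theorem contDiff_mollify {μ : Measure E} [μ.IsAddHaarMeasure] (φ : ContDiffBump (0 : E))
    {f : E → ℝ} (hf : LocallyIntegrable f μ) : ContDiff ℝ ∞ (mollify μ φ f) :=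
  φ.hasCompactSupport_normed.contDiff_convolution_right _ hf (φ.contDiff_normed (n := ⊤))

theorem fderiv_mollify {μ : Measure E} [μ.IsAddHaarMeasure] (φ : ContDiffBump (0 : E))
    {f : E → ℝ} (hf : LocallyIntegrable f μ) (x v : E) :
    fderiv ℝ (mollify μ φ f) x v = ∫ t, f t * fderiv ℝ (φ.normed μ) (x - t) v ∂μ := by
  have hc : ContDiff ℝ 1 (φ.normed μ) := (φ.contDiff_normed (n := 1))
  have h := φ.hasCompactSupport_normed.hasFDerivAt_convolution_right
    (ContinuousLinearMap.mul ℝ ℝ) hf hc x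
  rw [mollify, h.fderiv, convolution_precompR_apply _ hf (φ.hasCompactSupport_normed.fderiv ℝ)
    (hc.continuous_fderiv one_ne_zero)]
  simp [convolution_def]

/-- The mollified value is an average with a nonnegative kernel of mass one that vanishes outside
the ball, so a lower bound almost everywhere on that ball is enough. -/
theorem le_mollify {μ : Measure E} [μ.IsAddHaarMeasure] (φ : ContDiffBump (0 : E))
    {f : E → ℝ} (hf : LocallyIntegrable f μ) {c : ℝ} {x : E}
    (h : ∀ᵐ z ∂μ.restrict (Metric.closedBall x φ.rOut), c ≤ f z) : c ≤ mollify μ φ f x := by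
  have hone : ∫ t, φ.normed μ (x - t) ∂μ = 1 := by
    rw [integral_sub_left_eq_self (fun t => φ.normed μ t) μ x]
    exact φ.integral_normed (μ := μ)
  have hi : Integrable (fun t => φ.normed μ (x - t)) μ :=
    φ.integrable_normed.comp_sub_left x
  have hi2 : Integrable (fun t => f t * φ.normed μ (x - t)) μ := by
    have := (φ.hasCompactSupport_normed (μ := μ)).convolutionExists_right (ContinuousLinearMap.mul ℝ ℝ) hf
      (φ.continuous_normed (μ := μ)) x
    simpa [ConvolutionExistsAt] using this
  rw [mollify_apply]
  calc c = ∫ t, c * φ.normed μ (x - t) ∂μ := by rw [integral_const_mul, hone, mul_one]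
    _ ≤ _ := by
      refine integral_mono_ae (hi.const_mul c) hi2 ?_
      filter_upwards [(ae_restrict_iff' Metric.isClosed_closedBall.measurableSet).1 h] with t ht
      by_cases htx : t ∈ Metric.closedBall x φ.rOut
      · exact mul_le_mul_of_nonneg_right (ht htx) (φ.nonneg_normed _)
      · have : φ.normed μ (x - t) = 0 := by
          by_contra h0
          have : x - t ∈ Function.support (φ.normed μ) := h0
          rw [φ.support_normed_eq] at this
          apply htx
          rw [mem_ball_zero_iff] at this
          rw [Metric.mem_closedBall, dist_comm, dist_eq_norm]
          exact this.le
        simp [this]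

/-- The difference between the mollification and f at x is the average of f(x - h) - f(x) over the
probability measure with density the kernel. Jensen's inequality moves the power p inside this
average, and Tonelli's theorem reduces the claim to the translation bound for each fixed h. -/
theorem eLpNorm_mollify_sub_le {μ : Measure E} [μ.IsAddHaarMeasure] (φ : ContDiffBump (0 : E))
    {p : ℝ} (hp1 : 1 ≤ p) {f : E → ℝ} (hfm : StronglyMeasurable f) (hf : LocallyIntegrable f μ)
    {ε : ℝ≥0∞} (hε : ∀ h : E, ‖h‖ < φ.rOut →
      eLpNorm (fun x => f (x - h) - f x) (ENNReal.ofReal p) μ ≤ ε) :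
    eLpNorm (fun x => mollify μ φ f x - f x) (ENNReal.ofReal p) μ ≤ ε := by
  have hp0 : 0 < p := by linarith
  have hpe0 : ENNReal.ofReal p ≠ 0 := by simpa using hp0
  have hpt : (ENNReal.ofReal p).toReal = p := ENNReal.toReal_ofReal hp0.le
  set ν : Measure E := μ.withDensity fun h => ENNReal.ofReal (φ.normed μ h) with hν
  have hφm : Measurable fun h => ENNReal.ofReal (φ.normed μ h) :=
    (φ.continuous_normed.measurable).ennreal_ofReal
  have : IsProbabilityMeasure ν := by
    constructor
    rw [hν, withDensity_apply _ MeasurableSet.univ, Measure.restrict_univ,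
      ← ofReal_integral_eq_lintegral_ofReal φ.integrable_normed
        (.of_forall fun x => φ.nonneg_normed x), φ.integral_normed (μ := μ), ENNReal.ofReal_one]
  have hmeas : Measurable (Function.uncurry fun (x h : E) => ‖f (x - h) - f x‖ₑ ^ p) := by
    have h1 : Measurable fun q : E × E => f (q.1 - q.2) :=
      hfm.measurable.comp (measurable_fst.sub measurable_snd)
    have h2 : Measurable fun q : E × E => f q.1 := hfm.measurable.comp measurable_fst
    exact ((h1.sub h2).enorm.pow_const p)
  have hpt_le : ∀ x, ‖mollify μ φ f x - f x‖ₑ ^ p ≤ ∫⁻ h, ‖f (x - h) - f x‖ₑ ^ p ∂ν := by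
    intro x
    have hi2 : Integrable (fun h => φ.normed μ h * f (x - h)) μ := by
      have h1 := (φ.hasCompactSupport_normed (μ := μ)).convolutionExists_right
        (ContinuousLinearMap.mul ℝ ℝ) hf (φ.continuous_normed (μ := μ)) x
      have h2 : Integrable (fun t => f t * φ.normed μ (x - t)) μ := by
        simpa [ConvolutionExistsAt] using h1
      refine (h2.comp_sub_left x).congr (.of_forall fun t => ?_)
      simp [mul_comm]
    have e1 : mollify μ φ f x - f x = ∫ h, φ.normed μ h * (f (x - h) - f x) ∂μ := by
      rw [mollify_apply']
      have : f x = ∫ h, φ.normed μ h * f x ∂μ := by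
        rw [integral_mul_const, φ.integral_normed, one_mul]
      conv_lhs => rw [this]
      rw [← integral_sub hi2 (φ.integrable_normed.mul_const _)]
      refine integral_congr_ae (.of_forall fun h => ?_)
      simp only
      ring
    have e2 : ‖mollify μ φ f x - f x‖ₑ ≤ ∫⁻ h, ‖f (x - h) - f x‖ₑ ∂ν := by
      rw [e1, hν, lintegral_withDensity_eq_lintegral_mul₀ hφm.aemeasurable]
      · refine (enorm_integral_le_lintegral_enorm _).trans (lintegral_mono fun h => ?_)
        simp only [Pi.mul_apply]
        rw [enorm_mul, Real.enorm_eq_ofReal (φ.nonneg_normed h)]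
      · exact (((hfm.measurable.comp (measurable_const.sub measurable_id)).sub
          measurable_const).enorm).aemeasurable
    have hsm : AEStronglyMeasurable (fun h => f (x - h) - f x) ν :=
      ((hfm.measurable.comp (measurable_const.sub measurable_id)).sub
          measurable_const).aestronglyMeasurable
    have e3 := eLpNorm'_le_eLpNorm'_of_exponent_le (q := p) one_pos hp1 ν hsm
    simp only [eLpNorm'_eq_lintegral_enorm, ENNReal.rpow_one, one_div, inv_one] at e3
    calc _ ≤ (∫⁻ h, ‖f (x - h) - f x‖ₑ ∂ν) ^ p := by gcongr
      _ ≤ ((∫⁻ h, ‖f (x - h) - f x‖ₑ ^ p ∂ν) ^ p⁻¹) ^ p := by gcongr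
      _ = _ := ENNReal.rpow_inv_rpow hp0.ne' _
  have key : ∫⁻ x, ‖mollify μ φ f x - f x‖ₑ ^ p ∂μ ≤ ε ^ p := by
    calc _ ≤ ∫⁻ x, ∫⁻ h, ‖f (x - h) - f x‖ₑ ^ p ∂ν ∂μ := lintegral_mono hpt_le
      _ = ∫⁻ h, ∫⁻ x, ‖f (x - h) - f x‖ₑ ^ p ∂μ ∂ν :=
        lintegral_lintegral_swap hmeas.aemeasurable
      _ ≤ ∫⁻ _h, ε ^ p ∂ν := by
        refine lintegral_mono_ae ?_
        -- The measure ν is concentrated where the kernel is nonzero, that is, on the shifts for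
        -- which the translation bound is assumed.
        have hae : ∀ᵐ h ∂ν, ENNReal.ofReal (φ.normed μ h) ≠ 0 := by
          rw [hν, ae_withDensity_iff hφm]
          exact .of_forall fun h hh => hh
        filter_upwards [hae] with h hh
        have hs : h ∈ Function.support (φ.normed μ) := by
          intro h0
          simp [h0] at hh
        rw [φ.support_normed_eq, mem_ball_zero_iff] at hs
        have := hε h hs
        rw [eLpNorm_eq_lintegral_rpow_enorm_toReal hpe0 ENNReal.ofReal_ne_top, hpt] at this
        calc _ = ((∫⁻ x, ‖f (x - h) - f x‖ₑ ^ p ∂μ) ^ (1 / p)) ^ p := by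
              rw [one_div, ENNReal.rpow_inv_rpow hp0.ne']
          _ ≤ _ := by gcongr
      _ = ε ^ p := by simp
  rw [eLpNorm_eq_lintegral_rpow_enorm_toReal hpe0 ENNReal.ofReal_ne_top, hpt]
  calc _ ≤ (ε ^ p) ^ (1 / p) := by gcongr
    _ = ε := by rw [one_div, ENNReal.rpow_rpow_inv hp0.ne']

/-- Mollifications converge in `L^p`, `1 ≤ p < ∞`. -/
theorem tendsto_eLpNorm_mollify_sub {μ : Measure E} [μ.IsAddHaarMeasure]
    {φ : ℕ → ContDiffBump (0 : E)} (hφ : Tendsto (fun n => (φ n).rOut) atTop (𝓝 0))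
    {p : ℝ} (hp1 : 1 ≤ p) {f : E → ℝ} (hf : MemLp f (ENNReal.ofReal p) μ) :
    Tendsto (fun n => eLpNorm (fun x => mollify μ (φ n) f x - f x) (ENNReal.ofReal p) μ)
      atTop (𝓝 0) := by
  have h1 : (1 : ℝ≥0∞) ≤ ENNReal.ofReal p := by simpa using hp1
  set g := hf.1.mk f with hg
  have hfg : f =ᵐ[μ] g := hf.1.ae_eq_mk
  have hgL : MemLp g (ENNReal.ofReal p) μ := (memLp_congr_ae hfg).1 hf
  have hcongr : ∀ n, eLpNorm (fun x => mollify μ (φ n) f x - f x) (ENNReal.ofReal p) μ =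
      eLpNorm (fun x => mollify μ (φ n) g x - g x) (ENNReal.ofReal p) μ := by
    intro n
    rw [mollify_congr (φ n) hfg]
    refine eLpNorm_congr_ae ?_
    filter_upwards [hfg] with x hx
    rw [hx]
  simp only [hcongr]
  have ht := tendsto_eLpNorm_translate_sub (μ := μ) h1 ENNReal.ofReal_ne_top hgL
  rw [ENNReal.tendsto_nhds_zero] at ht ⊢
  intro ε hε
  obtain ⟨δ, hδ, hball⟩ := Metric.eventually_nhds_iff.1 (ht ε hε)
  filter_upwards [hφ.eventually_lt_const hδ] with n hn
  refine eLpNorm_mollify_sub_le (φ n) hp1 hf.1.stronglyMeasurable_mk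
    (hgL.locallyIntegrable h1) fun h hh => hball ?_
  rw [dist_zero_right]
  exact hh.trans hn

/-- The bounded ratio of outer to inner radii makes the kernels comparable with averages over balls,
so Lebesgue differentiation applies along the whole sequence. -/
theorem ae_tendsto_mollify {μ : Measure E} [μ.IsAddHaarMeasure]
    {φ : ℕ → ContDiffBump (0 : E)} (hφ : Tendsto (fun n => (φ n).rOut) atTop (𝓝 0))
    {K : ℝ} (hK : ∀ n, (φ n).rOut ≤ K * (φ n).rIn) {f : E → ℝ} (hf : LocallyIntegrable f μ) :
    ∀ᵐ x ∂μ, Tendsto (fun n => mollify μ (φ n) f x) atTop (𝓝 (f x)) := by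
  simp only [mollify_eq_lsmul]
  exact ContDiffBump.ae_convolution_tendsto_right_of_locallyIntegrable hφ (.of_forall hK) hf

/-- A sequence of bump functions with shrinking supports. -/
noncomputable def bumpSeq (E : Type*) [NormedAddCommGroup E] (n : ℕ) : ContDiffBump (0 : E) where
  rIn := 1 / (n + 1) / 2
  rOut := 1 / (n + 1)
  rIn_pos := by positivity
  rIn_lt_rOut := half_lt_self (by positivity)

theorem tendsto_bumpSeq : Tendsto (fun n => (bumpSeq E n).rOut) atTop (𝓝 0) :=
  tendsto_one_div_add_atTop_nhds_zero_nat

theorem bumpSeq_rOut_le (n : ℕ) : (bumpSeq E n).rOut ≤ 2 * (bumpSeq E n).rIn := by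
  change (1 / ((n : ℝ) + 1)) ≤ 2 * (1 / (n + 1) / 2)
  linarith

end Mollification

/-! ### Convergence in L¹ of products -/

section L1Limits

variable {α : Type*} [MeasurableSpace α] {μ : Measure α}

/-- Convergence in `L¹` of a sequence of integrable functions. -/
structure TendstoL1 (μ : Measure α) (F : ℕ → α → ℝ) (f : α → ℝ) : Prop where
  integrable : ∀ n, Integrable (F n) μ
  integrable_lim : Integrable f μ
  tendsto : Tendsto (fun n => eLpNorm (fun x => F n x - f x) 1 μ) atTop (𝓝 0)

theorem TendstoL1.add {F G : ℕ → α → ℝ} {f g : α → ℝ} (hF : TendstoL1 μ F f)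
    (hG : TendstoL1 μ G g) :
    TendstoL1 μ (fun n x => F n x + G n x) (fun x => f x + g x) := by
  refine ⟨fun n => (hF.1 n).add (hG.1 n), hF.2.add hG.2, ?_⟩
  have h := hF.3.add hG.3
  rw [add_zero] at h
  refine tendsto_of_tendsto_of_tendsto_of_le_of_le tendsto_const_nhds h
    (fun _ => zero_le) fun n => ?_
  have : (fun x => F n x + G n x - (f x + g x)) =
      (fun x => F n x - f x) + fun x => G n x - g x := by
    funext x
    simp only [Pi.add_apply]
    ring
  simp only [this]
  exact eLpNorm_add_le ((hF.1 n).sub hF.2).1 ((hG.1 n).sub hG.2).1 le_rfl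

theorem TendstoL1.neg {F : ℕ → α → ℝ} {f : α → ℝ} (hF : TendstoL1 μ F f) :
    TendstoL1 μ (fun n x => -F n x) (fun x => -f x) := by
  refine ⟨fun n => (hF.1 n).neg, hF.2.neg, hF.3.congr fun n => ?_⟩
  rw [← eLpNorm_neg]
  congr 1
  funext x
  simp only [Pi.neg_apply]
  ring

theorem TendstoL1.sub {F G : ℕ → α → ℝ} {f g : α → ℝ} (hF : TendstoL1 μ F f)
    (hG : TendstoL1 μ G g) :
    TendstoL1 μ (fun n x => F n x - G n x) (fun x => f x - g x) := by
  simpa only [sub_eq_add_neg] using hF.add hG.neg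

theorem TendstoL1.const_mul {F : ℕ → α → ℝ} {f : α → ℝ} (hF : TendstoL1 μ F f) (c : ℝ) :
    TendstoL1 μ (fun n x => c * F n x) (fun x => c * f x) := by
  refine ⟨fun n => (hF.1 n).const_mul c, hF.2.const_mul c, ?_⟩
  have h := ENNReal.Tendsto.const_mul (a := ‖c‖ₑ) hF.3 (Or.inr enorm_ne_top)
  rw [mul_zero] at h
  refine h.congr fun n => ?_
  rw [← eLpNorm_const_smul]
  congr 1
  funext x
  simp only [Pi.smul_apply, smul_eq_mul]
  ring

theorem TendstoL1.abs {F : ℕ → α → ℝ} {f : α → ℝ} (hF : TendstoL1 μ F f) :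
    TendstoL1 μ (fun n x => |F n x|) (fun x => |f x|) := by
  refine ⟨fun n => (hF.1 n).abs, hF.2.abs, ?_⟩
  refine tendsto_of_tendsto_of_tendsto_of_le_of_le tendsto_const_nhds hF.3
    (fun _ => zero_le) fun n => eLpNorm_mono fun x => ?_
  simpa [Real.norm_eq_abs] using abs_abs_sub_abs_le (F n x) (f x)

theorem TendstoL1.sum {ι : Type*} (s : Finset ι) {F : ι → ℕ → α → ℝ} {f : ι → α → ℝ}
    (h : ∀ i ∈ s, TendstoL1 μ (F i) (f i)) :
    TendstoL1 μ (fun n x => ∑ i ∈ s, F i n x) (fun x => ∑ i ∈ s, f i x) := by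
  classical
  induction s using Finset.induction_on with
  | empty =>
    refine ⟨fun n => by simp, by simp, ?_⟩
    simp
  | insert a s ha ih =>
    simp only [Finset.sum_insert ha]
    exact (h a (Finset.mem_insert_self _ _)).add (ih fun i hi => h i (Finset.mem_insert_of_mem hi))

/-- Multiplication of an `L¹`-convergent sequence by a bounded, a.e. convergent one. -/
theorem TendstoL1.bdd_mul {F : ℕ → α → ℝ} {f : α → ℝ} (hF : TendstoL1 μ F f)
    {c : ℕ → α → ℝ} {c₀ : α → ℝ} (hc : ∀ n, AEStronglyMeasurable (c n) μ) {M : ℝ}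
    (hM : ∀ n, ∀ᵐ x ∂μ, |c n x| ≤ M) (hlim : ∀ᵐ x ∂μ, Tendsto (fun n => c n x) atTop (𝓝 (c₀ x))) :
    TendstoL1 μ (fun n x => c n x * F n x) (fun x => c₀ x * f x) := by
  have hc₀ : AEStronglyMeasurable c₀ μ := aestronglyMeasurable_of_tendsto_ae atTop hc hlim
  have hM₀ : ∀ᵐ x ∂μ, |c₀ x| ≤ M := by
    filter_upwards [hlim, ae_all_iff.2 hM] with x hx hb
    exact le_of_tendsto hx.abs (.of_forall hb)
  refine ⟨fun n => (hF.1 n).bdd_mul (hc n) (by simpa [Real.norm_eq_abs] using hM n),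
    hF.2.bdd_mul hc₀ (by simpa [Real.norm_eq_abs] using hM₀), ?_⟩
  have h1 : Tendsto (fun n => ENNReal.ofReal M * eLpNorm (fun x => F n x - f x) 1 μ) atTop
      (𝓝 0) := by
    have := ENNReal.Tendsto.const_mul (a := ENNReal.ofReal M) hF.3 (Or.inr ENNReal.ofReal_ne_top)
    rwa [mul_zero] at this
  -- The coefficients converge only pointwise, so this part of the error is handled by dominated
  -- convergence with majorant 2M|f|.
  have h2 : Tendsto (fun n => eLpNorm (fun x => (c n x - c₀ x) * f x) 1 μ) atTop (𝓝 0) := by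
    simp only [eLpNorm_one_eq_lintegral_enorm]
    have hz : (0 : ℝ≥0∞) = ∫⁻ x, 0 ∂μ := by simp
    rw [hz]
    refine tendsto_lintegral_of_dominated_convergence' (fun x => ‖(2 * M) * f x‖ₑ) (fun n => ?_)
      (fun n => ?_) ?_ ?_
    · exact (((hc n).sub hc₀).mul hF.2.1).enorm
    · filter_upwards [hM n, hM₀] with x hx hx0
      rw [enorm_mul, enorm_mul]
      gcongr
      rw [Real.enorm_eq_ofReal_abs, Real.enorm_eq_ofReal_abs]
      refine ENNReal.ofReal_le_ofReal ?_
      calc |c n x - c₀ x| ≤ |c n x| + |c₀ x| := abs_sub _ _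
        _ ≤ 2 * M := by linarith
        _ ≤ _ := le_abs_self _
    · exact (hF.2.const_mul (2 * M)).2.ne
    · filter_upwards [hlim] with x hx
      have : Tendsto (fun n => (c n x - c₀ x) * f x) atTop (𝓝 0) := by
        have := ((hx.sub_const (c₀ x)).mul_const (f x))
        simpa using this
      simpa using this.enorm
  have h := h1.add h2
  rw [add_zero] at h
  refine tendsto_of_tendsto_of_tendsto_of_le_of_le tendsto_const_nhds h
    (fun _ => zero_le) fun n => ?_
  have e : (fun x => c n x * F n x - c₀ x * f x) =
      (fun x => c n x * (F n x - f x)) + fun x => (c n x - c₀ x) * f x := by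
    funext x
    simp only [Pi.add_apply]
    ring
  simp only [e]
  refine (eLpNorm_add_le ((hc n).mul ((hF.1 n).sub hF.2).1) (((hc n).sub hc₀).mul hF.2.1)
    le_rfl).trans ?_
  refine add_le_add ?_ le_rfl
  refine eLpNorm_le_mul_eLpNorm_of_ae_le_mul ?_ 1
  filter_upwards [hM n] with x hx
  change ‖c n x * (F n x - f x)‖ ≤ M * ‖F n x - f x‖
  rw [norm_mul]
  gcongr
  exact hx

/-- The product of sequences that converge in `L^p` and `L^q` converges in `L¹`. -/
theorem tendstoL1_mul {p q : ℝ≥0∞} [ENNReal.HolderConjugate p q] {F G : ℕ → α → ℝ} {f g : α → ℝ}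
    (hF : ∀ n, MemLp (F n) p μ) (hf : MemLp f p μ) (hG : ∀ n, MemLp (G n) q μ) (hg : MemLp g q μ)
    (hFf : Tendsto (fun n => eLpNorm (fun x => F n x - f x) p μ) atTop (𝓝 0))
    (hGg : Tendsto (fun n => eLpNorm (fun x => G n x - g x) q μ) atTop (𝓝 0)) :
    TendstoL1 μ (fun n x => F n x * G n x) (fun x => f x * g x) := by
  have : ENNReal.HolderConjugate q p := ENNReal.HolderConjugate.symm
  refine ⟨fun n => (hF n).integrable_mul (hG n), hf.integrable_mul hg, ?_⟩
  have hb : ∀ {u v : α → ℝ}, MemLp u p μ → MemLp v q μ →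
      eLpNorm (fun x => u x * v x) 1 μ ≤ eLpNorm u p μ * eLpNorm v q μ := by
    intro u v hu hv
    exact (eLpNorm_smul_le_mul_eLpNorm (p := p) (q := q) (r := 1) hv.1 hu.1 :)
  have h1 : Tendsto (fun n => eLpNorm (fun x => F n x - f x) p μ *
      eLpNorm (fun x => G n x - g x) q μ + eLpNorm (fun x => F n x - f x) p μ * eLpNorm g q μ +
      eLpNorm f p μ * eLpNorm (fun x => G n x - g x) q μ) atTop (𝓝 0) := by
    have a1 := ENNReal.Tendsto.mul hFf (Or.inr ENNReal.zero_ne_top) hGg (Or.inr ENNReal.zero_ne_top)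
    have a2 := ENNReal.Tendsto.mul_const (b := eLpNorm g q μ) hFf (Or.inr hg.2.ne)
    have a3 := ENNReal.Tendsto.const_mul (a := eLpNorm f p μ) hGg (Or.inr hf.2.ne)
    simpa using (a1.add a2).add a3
  refine tendsto_of_tendsto_of_tendsto_of_le_of_le tendsto_const_nhds h1
    (fun _ => zero_le) fun n => ?_
  have e : (fun x => F n x * G n x - f x * g x) =
      ((fun x => (F n x - f x) * (G n x - g x)) + (fun x => (F n x - f x) * g x)) +
        fun x => f x * (G n x - g x) := by
    funext x
    simp only [Pi.add_apply]
    ring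
  have hFn : MemLp (fun x => F n x - f x) p μ := (hF n).sub hf
  have hGn : MemLp (fun x => G n x - g x) q μ := (hG n).sub hg
  simp only [e]
  refine (eLpNorm_add_le ((hFn.1.mul hGn.1).add (hFn.1.mul hg.1)) (hf.1.mul hGn.1) le_rfl).trans ?_
  refine add_le_add ((eLpNorm_add_le (hFn.1.mul hGn.1) (hFn.1.mul hg.1) le_rfl).trans
    (add_le_add (hb hFn hGn) (hb hFn hg))) (hb hf hGn)

/-- The error term does not depend on the set. This uniformity is what later bounds all time slices
simultaneously. -/
theorem TendstoL1.setIntegral_le {F : ℕ → α → ℝ} {f : α → ℝ} (hF : TendstoL1 μ F f) (n : ℕ)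
    (s : Set α) :
    ∫ x in s, F n x ∂μ ≤ (∫ x in s, f x ∂μ) + (eLpNorm (fun x => F n x - f x) 1 μ).toReal := by
  have hi : Integrable (fun x => F n x - f x) μ := (hF.1 n).sub hF.2
  have h1 : ∫ x in s, F n x ∂μ - ∫ x in s, f x ∂μ = ∫ x in s, (F n x - f x) ∂μ :=
    (integral_sub (hF.1 n).integrableOn hF.2.integrableOn).symm
  have h2 : ∫ x in s, (F n x - f x) ∂μ ≤ ∫ x, |F n x - f x| ∂μ :=
    (integral_mono hi.integrableOn hi.integrableOn.abs fun x => le_abs_self _).trans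
      (setIntegral_le_integral hi.abs (.of_forall fun x => abs_nonneg _))
  have h3 : ∫ x, |F n x - f x| ∂μ = (eLpNorm (fun x => F n x - f x) 1 μ).toReal := by
    rw [eLpNorm_one_eq_lintegral_enorm, ← integral_norm_eq_lintegral_enorm hi.1]
    rfl
  linarith

theorem TendstoL1.tendsto_setIntegral {F : ℕ → α → ℝ} {f : α → ℝ} (hF : TendstoL1 μ F f)
    (s : Set α) : Tendsto (fun n => ∫ x in s, F n x ∂μ) atTop (𝓝 (∫ x in s, f x ∂μ)) :=
  tendsto_setIntegral_of_L1' f hF.2.1 (.of_forall hF.1) hF.3 s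

theorem TendstoL1.tendsto_toReal {F : ℕ → α → ℝ} {f : α → ℝ} (hF : TendstoL1 μ F f) :
    Tendsto (fun n => (eLpNorm (fun x => F n x - f x) 1 μ).toReal) atTop (𝓝 0) := by
  have := (ENNReal.tendsto_toReal ENNReal.zero_ne_top).comp hF.3
  rwa [ENNReal.toReal_zero] at this

end L1Limits

end AnisoParabolic

namespace AnisoParabolic

open scoped ENNReal NNReal ContDiff

/-! ### Weighted Sobolev inequality and parabolic embedding -/

section Sobolev

theorem lintegral_comp_diagonal {ι : Type*} [Fintype ι] [DecidableEq ι] {W : ι → ℝ}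
    (hW : ∀ i, 0 < W i) {h : (ι → ℝ) → ℝ≥0∞} (hh : Measurable h) :
    ENNReal.ofReal (∏ i, W i) * ∫⁻ x : ι → ℝ, h (fun i => W i * x i) = ∫⁻ x : ι → ℝ, h x := by
  have hdet : (Matrix.diagonal W).det = ∏ i, W i := Matrix.det_diagonal
  have hpos : 0 < ∏ i, W i := Finset.prod_pos fun i _ => hW i
  have hm : Measurable (Matrix.toLin' (Matrix.diagonal W)) :=
    (LinearMap.continuous_on_pi _).measurable
  conv_rhs => rw [← Real.smul_map_diagonal_volume_pi (D := W) (by rw [hdet]; exact hpos.ne')]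
  rw [lintegral_smul_measure, lintegral_map hh hm, hdet, abs_of_pos hpos, smul_eq_mul]
  congr 2
  funext x
  congr 1
  funext i
  simp [Matrix.mulVec_diagonal]

/-- The domain carries the sup norm, whose dual norm is the ℓ¹ norm of the coefficients. -/
theorem norm_le_sum_apply_single {ι : Type*} [Fintype ι] [DecidableEq ι] (L : (ι → ℝ) →L[ℝ] ℝ) :
    ‖L‖ ≤ ∑ i, |L (Pi.single i 1)| := by
  refine L.opNorm_le_bound (Finset.sum_nonneg fun i _ => abs_nonneg _) fun y => ?_
  have h : L y = ∑ i, y i * L (Pi.single i 1) := by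
    have := LinearMap.pi_apply_eq_sum_univ (L : (ι → ℝ) →ₗ[ℝ] ℝ) y
    simp only [ContinuousLinearMap.coe_coe, smul_eq_mul] at this
    rw [this]
    refine Finset.sum_congr rfl fun i _ => ?_
    congr 2
    funext j
    simp [Pi.single_apply, eq_comm]
  rw [h, Real.norm_eq_abs, Finset.sum_mul]
  refine (Finset.abs_sum_le_sum_abs _ _).trans (Finset.sum_le_sum fun i _ => ?_)
  rw [abs_mul, mul_comm]
  gcongr
  exact norm_le_pi_norm y i

/-- An anisotropically weighted Gagliardo–Nirenberg–Sobolev inequality. -/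
theorem weighted_gns {N : ℕ} (hN : 1 < N) {W : Fin N → ℝ} (hW : ∀ i, 0 < W i)
    {u : (Fin N → ℝ) → ℝ} (hu : ContDiff ℝ 1 u) (hsupp : HasCompactSupport u) :
    ENNReal.ofReal (∏ i, W i) ^ (1 / ((N : ℝ) - 1)) *
        ∫⁻ x, ‖u x‖ₑ ^ ((N : ℝ) / ((N : ℝ) - 1)) ≤
      (∫⁻ x, ENNReal.ofReal (∑ i, W i * |fderiv ℝ u x (Pi.single i 1)|)) ^
        ((N : ℝ) / ((N : ℝ) - 1)) := by
  have hN1 : (1 : ℝ) < N := by exact_mod_cast hN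
  have hN0 : (0 : ℝ) < (N : ℝ) - 1 := by linarith
  set q : ℝ := (N : ℝ) / ((N : ℝ) - 1) with hq
  have hq0 : 0 ≤ q := by positivity
  have hconj : Real.HolderConjugate (Fintype.card (Fin N)) q := by
    rw [Fintype.card_fin]
    exact Real.HolderConjugate.conjExponent hN1
  -- The weights come from applying the unweighted inequality to u ∘ D with D = diag(Wᵢ). The chain
  -- rule multiplies the i-th partial derivative by Wᵢ, and the change of variables produces powers
  -- of ∏ Wᵢ.
  set D : (Fin N → ℝ) →L[ℝ] (Fin N → ℝ) :=
    ContinuousLinearMap.pi fun i => W i • ContinuousLinearMap.proj i with hD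
  have hDx : ∀ x, D x = fun i => W i * x i := fun x => by
    funext i
    simp [hD]
  have hpos : 0 < ∏ i, W i := Finset.prod_pos fun i _ => hW i
  set v : (Fin N → ℝ) → ℝ := fun x => u (D x) with hv
  have hvc : ContDiff ℝ 1 v := hu.comp D.contDiff
  have hvs : HasCompactSupport v := by
    let e : (Fin N → ℝ) ≃ₜ (Fin N → ℝ) :=
      Homeomorph.piCongrRight fun i => Homeomorph.mulLeft₀ (W i) (hW i).ne'
    have he : v = u ∘ e := by
      funext x
      simp only [hv, hDx, Function.comp_apply]
      rfl
    rw [he]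
    exact hsupp.comp_homeomorph e
  have hgns := lintegral_pow_le_pow_lintegral_fderiv_aux hconj hvc hvs
  set S : (Fin N → ℝ) → ℝ≥0∞ :=
    fun x => ENNReal.ofReal (∑ i, W i * |fderiv ℝ u x (Pi.single i 1)|) with hS
  have hSm : Measurable S := by
    have hc := hu.continuous_fderiv one_ne_zero
    have : Continuous fun x => ∑ i, W i * |fderiv ℝ u x (Pi.single i 1)| := by fun_prop
    exact this.measurable.ennreal_ofReal
  have hbound : ∀ x, ‖fderiv ℝ v x‖ₑ ≤ S (fun i => W i * x i) := by
    intro x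
    have hfd : fderiv ℝ v x = (fderiv ℝ u (D x)).comp D := by
      have h1 : DifferentiableAt ℝ u (D x) := hu.differentiable one_ne_zero _
      have := fderiv_comp x h1 D.differentiableAt
      rw [D.fderiv] at this
      exact this
    rw [← ofReal_norm_eq_enorm, hS]
    refine ENNReal.ofReal_le_ofReal ((norm_le_sum_apply_single _).trans (le_of_eq ?_))
    refine Finset.sum_congr rfl fun i _ => ?_
    have hDs : D (Pi.single i 1) = W i • Pi.single i 1 := by
      rw [hDx]
      funext j
      by_cases hj : j = i
      · subst hj; simp
      · simp [hj]
    rw [hfd, ContinuousLinearMap.comp_apply, hDs, map_smul, smul_eq_mul, abs_mul,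
      abs_of_pos (hW i), hDx]
  have e1 : ENNReal.ofReal (∏ i, W i) * ∫⁻ x, ‖v x‖ₑ ^ q = ∫⁻ x, ‖u x‖ₑ ^ q := by
    rw [← lintegral_comp_diagonal hW (h := fun x => ‖u x‖ₑ ^ q)
      (hu.continuous.measurable.enorm.pow_const _)]
    simp only [hv, hDx]
  have e2 := lintegral_comp_diagonal hW hSm
  have hP0 : ENNReal.ofReal (∏ i, W i) ≠ 0 := by simpa using hpos
  rw [← e1, ← e2, ENNReal.mul_rpow_of_nonneg _ _ hq0, ← mul_assoc]
  -- Since 1/(N - 1) + 1 = N/(N - 1) = q, the Jacobians on the two sides balance.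
  have e3 : ENNReal.ofReal (∏ i, W i) ^ (1 / ((N : ℝ) - 1)) * ENNReal.ofReal (∏ i, W i) =
      ENNReal.ofReal (∏ i, W i) ^ q := by
    conv_lhs => enter [2]; rw [← ENNReal.rpow_one (ENNReal.ofReal (∏ i, W i))]
    rw [← ENNReal.rpow_add _ _ hP0 ENNReal.ofReal_ne_top]
    congr 1
    rw [hq]
    field_simp
    ring
  rw [e3]
  gcongr
  refine hgns.trans ?_
  gcongr with x
  exact hbound x

theorem hasCompactSupport_slice {X : Type*} [TopologicalSpace X] [T2Space X] {u : X × ℝ → ℝ}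
    (hu : HasCompactSupport u) (t : ℝ) : HasCompactSupport fun x => u (x, t) := by
  refine HasCompactSupport.intro (hu.isCompact.image continuous_fst) fun x hx => ?_
  by_contra h
  exact hx ⟨(x, t), subset_tsupport _ h, rfl⟩

theorem fderiv_slice_apply {N : ℕ} {u : (Fin N → ℝ) × ℝ → ℝ} {x : Fin N → ℝ} {t : ℝ}
    (hu : DifferentiableAt ℝ u (x, t)) (v : Fin N → ℝ) :
    fderiv ℝ (fun x => u (x, t)) x v = fderiv ℝ u (x, t) (v, 0) := by
  have h : HasFDerivAt (fun x : Fin N → ℝ => (x, t))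
      (ContinuousLinearMap.inl ℝ (Fin N → ℝ) ℝ) x := hasFDerivAt_prodMk_left x t
  have h2 : HasFDerivAt (fun x => u (x, t)) ((fderiv ℝ u (x, t)).comp
    (ContinuousLinearMap.inl ℝ (Fin N → ℝ) ℝ)) x := hu.hasFDerivAt.comp x h
  rw [h2.fderiv]
  simp

/-- The parabolic embedding of `L^∞(L¹) ∩ L¹(W^{1,1})` into `L^{1 + 1/N}`. -/
theorem parabolic_embedding {N : ℕ} (hN : 1 < N) {W : Fin N → ℝ} (hW : ∀ i, 0 < W i)
    {u : (Fin N → ℝ) × ℝ → ℝ} (hu : ContDiff ℝ 1 u) (hsupp : HasCompactSupport u)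
    {I : Set ℝ} (hI : MeasurableSet I) {M : ℝ≥0∞} (hM : ∀ t ∈ I, ∫⁻ x, ‖u (x, t)‖ₑ ≤ M) :
    ENNReal.ofReal (∏ i, W i) ^ (1 / (N : ℝ)) *
        ∫⁻ z in univ ×ˢ I, ‖u z‖ₑ ^ (1 + 1 / (N : ℝ)) ≤
      M ^ (1 / (N : ℝ)) *
        ∫⁻ z in univ ×ˢ I, ENNReal.ofReal (∑ i, W i * |fderiv ℝ u z (Pi.single i 1, 0)|) := by
  have hN1 : (1 : ℝ) < N := by exact_mod_cast hN
  have hN0 : (0 : ℝ) < (N : ℝ) - 1 := by linarith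
  have hNpos : (0 : ℝ) < N := by linarith
  set q : ℝ := (N : ℝ) / ((N : ℝ) - 1) with hq
  have hq0 : 0 < q := by positivity
  have hconj : q.HolderConjugate N := (Real.HolderConjugate.conjExponent hN1).symm
  have hcf := hu.continuous_fderiv one_ne_zero
  have hm1 : Measurable fun z => ‖u z‖ₑ ^ (1 + 1 / (N : ℝ)) :=
    hu.continuous.measurable.enorm.pow_const _
  have hm2 : Measurable fun z =>
      ENNReal.ofReal (∑ i, W i * |fderiv ℝ u z (Pi.single i 1, 0)|) := by
    have : Continuous fun z => ∑ i, W i * |fderiv ℝ u z (Pi.single i 1, 0)| := by fun_prop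
    exact this.measurable.ennreal_ofReal
  have hvol : (volume : Measure ((Fin N → ℝ) × ℝ)).restrict (univ ×ˢ I) =
      (volume : Measure (Fin N → ℝ)).prod (volume.restrict I) := by
    rw [Measure.volume_eq_prod, ← Measure.prod_restrict, Measure.restrict_univ]
  rw [hvol, lintegral_prod_symm' _ hm1, lintegral_prod_symm' _ hm2,
    ← lintegral_const_mul _ hm1.lintegral_prod_left', ← lintegral_const_mul _ hm2.lintegral_prod_left']
  refine setLIntegral_mono' hI fun t ht => ?_
  set Y := ∫⁻ x, ENNReal.ofReal (∑ i, W i * |fderiv ℝ u (x, t) (Pi.single i 1, 0)|) with hY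
  have hslice : ContDiff ℝ 1 fun x => u (x, t) := by fun_prop
  have hg := weighted_gns hN hW hslice (hasCompactSupport_slice hsupp t)
  simp only [fderiv_slice_apply (hu.differentiable one_ne_zero _)] at hg
  have hmu : Measurable fun x => ‖u (x, t)‖ₑ := hslice.continuous.measurable.enorm
  -- Hölder's inequality with the conjugate exponents q and N for |u| · |u|^{1/N}. The second factor
  -- is bounded by the slice bound M, and the first is estimated by the Sobolev inequality on the
  -- slice.
  have hH : ∫⁻ x, ‖u (x, t)‖ₑ ^ (1 + 1 / (N : ℝ)) ≤
      (∫⁻ x, ‖u (x, t)‖ₑ ^ q) ^ (1 / q) * (∫⁻ x, ‖u (x, t)‖ₑ) ^ (1 / (N : ℝ)) := by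
    have := ENNReal.lintegral_mul_le_Lp_mul_Lq volume hconj hmu.aemeasurable
      (hmu.pow_const (1 / (N : ℝ))).aemeasurable
    have e1 : ∀ x, (‖u (x, t)‖ₑ ^ (1 / (N : ℝ))) ^ (N : ℝ) = ‖u (x, t)‖ₑ := fun x => by
      rw [one_div, ENNReal.rpow_inv_rpow hNpos.ne']
    simp only [e1] at this
    refine le_trans (le_of_eq (lintegral_congr fun x => ?_)) this
    rw [ENNReal.rpow_add_of_nonneg _ _ zero_le_one (by positivity), ENNReal.rpow_one]
    rfl
  have hg2 : ENNReal.ofReal (∏ i, W i) ^ (1 / (N : ℝ)) *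
      (∫⁻ x, ‖u (x, t)‖ₑ ^ q) ^ (1 / q) ≤ Y := by
    have := ENNReal.rpow_le_rpow hg (z := 1 / q) (by positivity)
    rw [ENNReal.mul_rpow_of_nonneg _ _ (by positivity), ← ENNReal.rpow_mul, ← ENNReal.rpow_mul,
      mul_one_div_cancel hq0.ne', ENNReal.rpow_one] at this
    refine le_trans (le_of_eq ?_) this
    congr 2
    rw [hq]
    field_simp
  calc _ ≤ ENNReal.ofReal (∏ i, W i) ^ (1 / (N : ℝ)) * ((∫⁻ x, ‖u (x, t)‖ₑ ^ q) ^ (1 / q) *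
        (∫⁻ x, ‖u (x, t)‖ₑ) ^ (1 / (N : ℝ))) := by gcongr
    _ = (∫⁻ x, ‖u (x, t)‖ₑ) ^ (1 / (N : ℝ)) * (ENNReal.ofReal (∏ i, W i) ^ (1 / (N : ℝ)) *
        (∫⁻ x, ‖u (x, t)‖ₑ ^ q) ^ (1 / q)) := by ring
    _ ≤ M ^ (1 / (N : ℝ)) * Y := by
      gcongr
      exact hM t ht

end Sobolev

end AnisoParabolic

namespace AnisoParabolic

open scoped ENNReal NNReal ContDiff

/-! ### Smooth powers of truncations -/

section Truncation

/-- An exponent of at least two removes the kink: at s = k the function is bounded by the power n +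
2 of the distance to k, hence is of smaller order than that distance. The cases n = 0 and n = 1
serve for the test function and for its primitive. -/
theorem hasDerivAt_max_sub_pow (k s : ℝ) (n : ℕ) :
    HasDerivAt (fun s => max (k - s) 0 ^ (n + 2)) (-((n + 2 : ℝ) * max (k - s) 0 ^ (n + 1))) s := by
  rcases lt_trichotomy s k with h | h | h
  · have h1 : HasDerivAt (fun s => (k - s) ^ (n + 2)) (-((n + 2 : ℝ) * (k - s) ^ (n + 1))) s := by
      have := ((hasDerivAt_id' s).const_sub k).fun_pow (n + 2)
      simpa using this
    rw [max_eq_left (by linarith : (0 : ℝ) ≤ k - s)]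
    refine h1.congr_of_eventuallyEq ?_
    filter_upwards [Iio_mem_nhds h] with t ht
    rw [max_eq_left (by linarith [mem_Iio.1 ht] : (0 : ℝ) ≤ k - t)]
  · subst h
    have hz : -((n + 2 : ℝ) * max (s - s) 0 ^ (n + 1)) = 0 := by simp
    rw [hz, hasDerivAt_iff_isLittleO]
    simp only [sub_self, max_self, smul_zero, sub_zero]
    rw [zero_pow (by positivity)]
    simp only [sub_zero]
    refine Asymptotics.IsBigO.trans_isLittleO (g := fun t => ‖t - s‖ ^ (n + 2)) ?_ ?_
    · refine Asymptotics.IsBigO.of_bound 1 (.of_forall fun t => ?_)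
      rw [one_mul, norm_pow, norm_pow, norm_norm]
      gcongr
      rw [Real.norm_eq_abs, Real.norm_eq_abs, abs_of_nonneg (le_max_right _ _), abs_sub_comm]
      exact max_le (le_abs_self _) (abs_nonneg _)
    · exact Asymptotics.isLittleO_pow_sub_sub s (m := n + 2) (by omega)
  · rw [max_eq_right (by linarith : k - s ≤ 0)]
    rw [zero_pow (by positivity), mul_zero, neg_zero]
    refine (hasDerivAt_const s (0 : ℝ)).congr_of_eventuallyEq ?_
    filter_upwards [Ioi_mem_nhds h] with t ht
    rw [max_eq_right (by linarith [mem_Ioi.1 ht] : k - t ≤ 0), zero_pow (by positivity)]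

theorem contDiff_max_sub_pow (k : ℝ) (n : ℕ) :
    ContDiff ℝ 1 (fun s => max (k - s) 0 ^ (n + 2)) := by
  rw [contDiff_one_iff_deriv]
  refine ⟨fun s => (hasDerivAt_max_sub_pow k s n).differentiableAt, ?_⟩
  have : deriv (fun s => max (k - s) 0 ^ (n + 2)) =
      fun s => -((n + 2 : ℝ) * max (k - s) 0 ^ (n + 1)) := by
    funext s
    exact (hasDerivAt_max_sub_pow k s n).deriv
  rw [this]
  fun_prop

theorem fderiv_max_sub_pow_mul {E : Type*} [NormedAddCommGroup E] [NormedSpace ℝ E] (k : ℝ) (n : ℕ)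
    {f η : E → ℝ} {z : E} (hf : DifferentiableAt ℝ f z) (hη : DifferentiableAt ℝ η z) (e : E) :
    fderiv ℝ (fun z => max (k - f z) 0 ^ (n + 2) * η z) z e =
      max (k - f z) 0 ^ (n + 2) * fderiv ℝ η z e -
        (n + 2) * max (k - f z) 0 ^ (n + 1) * fderiv ℝ f z e * η z := by
  have h1 : HasFDerivAt (fun z => max (k - f z) 0 ^ (n + 2))
      ((-((n + 2 : ℝ) * max (k - f z) 0 ^ (n + 1))) • fderiv ℝ f z) z :=
    (hasDerivAt_max_sub_pow k (f z) n).comp_hasFDerivAt z hf.hasFDerivAt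
  have h2 : HasFDerivAt (fun z => max (k - f z) 0 ^ (n + 2) * η z) _ z := h1.mul hη.hasFDerivAt
  rw [h2.fderiv]
  simp only [ContinuousLinearMap.add_apply, ContinuousLinearMap.smul_apply, smul_eq_mul]
  ring

end Truncation

/-! ### Energy inequality for smooth supersolutions -/

section Energy

variable {N : ℕ}

theorem volume_restrict_univ_prod (I : Set ℝ) :
    (volume : Measure ((Fin N → ℝ) × ℝ)).restrict (univ ×ˢ I) =
      (volume : Measure (Fin N → ℝ)).prod (volume.restrict I) := by
  rw [Measure.volume_eq_prod, ← Measure.prod_restrict, Measure.restrict_univ]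

/-- Only spatial derivatives occur, so the integration by parts takes place on each time slice, and
restricting time to I creates no boundary term. -/
theorem integral_strip_fderiv_space {φ a : (Fin N → ℝ) × ℝ → ℝ} (hφ : ContDiff ℝ 1 φ)
    (hφs : HasCompactSupport φ) (ha : ContDiff ℝ 1 a) (v : Fin N → ℝ) (I : Set ℝ) :
    ∫ z in univ ×ˢ I, φ z * fderiv ℝ a z (v, 0) = -∫ z in univ ×ˢ I, a z * fderiv ℝ φ z (v, 0) := by
  have hφf := hφ.continuous_fderiv one_ne_zero
  have haf := ha.continuous_fderiv one_ne_zero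
  have hφc := hφ.continuous
  have hac := ha.continuous
  have hφfs : HasCompactSupport fun z => fderiv ℝ φ z (v, 0) := hφs.fderiv_apply ℝ (v, 0)
  have i1 : Integrable fun z => φ z * fderiv ℝ a z (v, 0) :=
    (by fun_prop : Continuous fun z => φ z * fderiv ℝ a z (v, 0)).integrable_of_hasCompactSupport
      hφs.mul_right
  have i2 : Integrable fun z => a z * fderiv ℝ φ z (v, 0) :=
    (by fun_prop : Continuous fun z => a z * fderiv ℝ φ z (v, 0)).integrable_of_hasCompactSupport
      hφfs.mul_left
  have j1 := i1.integrableOn (s := univ ×ˢ I)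
  have j2 := i2.integrableOn (s := univ ×ˢ I)
  rw [IntegrableOn, volume_restrict_univ_prod] at j1 j2
  rw [volume_restrict_univ_prod, integral_prod_symm _ j1, integral_prod_symm _ j2, ← integral_neg]
  congr 1
  funext t
  have d1 : ContDiff ℝ 1 fun x => φ (x, t) := by fun_prop
  have d2 : ContDiff ℝ 1 fun x => a (x, t) := by fun_prop
  have d1f := d1.continuous_fderiv one_ne_zero
  have d2f := d2.continuous_fderiv one_ne_zero
  have s1 := hasCompactSupport_slice hφs t
  have key := integral_mul_fderiv_eq_neg_fderiv_mul_of_integrable (μ := (volume : Measure (Fin N → ℝ)))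
    (f := fun x => φ (x, t)) (g := fun x => a (x, t)) (v := v) ?_ ?_ ?_
    (fun x _ => d1.differentiable one_ne_zero x) (fun x _ => d2.differentiable one_ne_zero x)
  · simp only [fderiv_slice_apply (hφ.differentiable one_ne_zero _),
      fderiv_slice_apply (ha.differentiable one_ne_zero _)] at key
    rw [key]
    congr 1
    congr 1
    funext x
    ring
  · exact (by fun_prop : Continuous fun x => fderiv ℝ (fun x => φ (x, t)) x v *
      a (x, t)).integrable_of_hasCompactSupport (s1.fderiv_apply ℝ v).mul_right
  · exact (by fun_prop : Continuous fun x => φ (x, t) * fderiv ℝ (fun x => a (x, t)) x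
      v).integrable_of_hasCompactSupport s1.mul_right
  · exact (by fun_prop : Continuous fun x => φ (x, t) *
      a (x, t)).integrable_of_hasCompactSupport s1.mul_right

theorem integral_slice_eq_integral_strip {w : (Fin N → ℝ) × ℝ → ℝ} (hw : ContDiff ℝ 1 w)
    (hws : HasCompactSupport w) (t : ℝ) :
    ∫ x, w (x, t) = ∫ z in univ ×ˢ Iic t, fderiv ℝ w z (0, 1) := by
  have hwf := hw.continuous_fderiv one_ne_zero
  have hwc := hw.continuous
  have hcomp : HasCompactSupport fun z => fderiv ℝ w z (0, 1) := hws.fderiv_apply ℝ (0, 1)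
  have i1 : Integrable fun z => fderiv ℝ w z (0, 1) :=
    (by fun_prop : Continuous fun z => fderiv ℝ w z (0, 1)).integrable_of_hasCompactSupport hcomp
  have j1 := i1.integrableOn (s := univ ×ˢ Iic t)
  rw [IntegrableOn, volume_restrict_univ_prod] at j1
  rw [volume_restrict_univ_prod, integral_prod _ j1]
  congr 1
  funext x
  have hd : ∀ τ, HasDerivAt (fun τ => w (x, τ)) (fderiv ℝ w (x, τ) (0, 1)) τ := by
    intro τ
    have h1 : HasDerivAt (fun τ : ℝ => (x, τ)) ((0 : Fin N → ℝ), (1 : ℝ)) τ :=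
      (hasDerivAt_const τ x).prodMk (hasDerivAt_id τ)
    exact (hw.differentiable one_ne_zero (x, τ)).hasFDerivAt.comp_hasDerivAt τ h1
  have hs : HasCompactSupport fun τ => w (x, τ) := by
    refine HasCompactSupport.intro (hws.isCompact.image continuous_snd) fun τ hτ => ?_
    by_contra h
    exact hτ ⟨(x, τ), subset_tsupport _ h, rfl⟩
  have hs' : HasCompactSupport fun τ => fderiv ℝ w (x, τ) (0, 1) := by
    refine HasCompactSupport.intro (hcomp.isCompact.image continuous_snd) fun τ hτ => ?_
    by_contra h
    exact hτ ⟨(x, τ), subset_tsupport _ h, rfl⟩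
  have hi : Integrable fun τ => fderiv ℝ w (x, τ) (0, 1) :=
    (by fun_prop : Continuous fun τ => fderiv ℝ w (x, τ) (0, 1)).integrable_of_hasCompactSupport hs'
  have hlim : Tendsto (fun τ => w (x, τ)) atBot (𝓝 0) :=
    (hs.is_zero_at_infty).mono_left atBot_le_cocompact
  rw [integral_Iic_of_hasDerivAt_of_tendsto' (fun τ _ => hd τ) hi.integrableOn hlim, sub_zero]

/-- The integrand on the right-hand side of the localised energy inequality for `max (k - f) 0`,
where `a` is the flux, `b` the gradient and `η` the cutoff. -/
noncomputable def energyDensity (k : ℝ) (η f : (Fin N → ℝ) × ℝ → ℝ)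
    (a b : Fin N → (Fin N → ℝ) × ℝ → ℝ) (z : (Fin N → ℝ) × ℝ) : ℝ :=
  max (k - f z) 0 ^ 3 / 3 * fderiv ℝ η z (0, 1) +
    ∑ i, (max (k - f z) 0 ^ 2 * fderiv ℝ η z (Pi.single i 1, 0) * a i z -
      2 * max (k - f z) 0 * η z * (a i z * b i z))

/-- Localised energy inequality for classical supersolutions of `∂ₜ f ≥ ∑ ∂ᵢ aᵢ`. -/
theorem classical_energy {k : ℝ} {η f : (Fin N → ℝ) × ℝ → ℝ} {a : Fin N → (Fin N → ℝ) × ℝ → ℝ}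
    (hη : ContDiff ℝ 1 η) (hηs : HasCompactSupport η) (hη0 : ∀ z, 0 ≤ η z) (hf : ContDiff ℝ 1 f)
    (ha : ∀ i, ContDiff ℝ 1 (a i))
    (hsuper : ∀ z ∈ tsupport η, ∑ i, fderiv ℝ (a i) z (Pi.single i 1, 0) ≤ fderiv ℝ f z (0, 1))
    (t : ℝ) :
    ∫ x, max (k - f (x, t)) 0 ^ 3 / 3 * η (x, t) ≤
      ∫ z in univ ×ˢ Iic t,
        energyDensity k η f a (fun i z => fderiv ℝ f z (Pi.single i 1, 0)) z := by
  -- The test function is φ = v²η. Its product with ∂ₜf equals v³/3 ∂ₜη minus ∂ₜ(w/3), so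
  -- integrating in time gives the slice integral of w/3.
  set w : (Fin N → ℝ) × ℝ → ℝ := fun z => max (k - f z) 0 ^ 3 * η z with hw
  set φ : (Fin N → ℝ) × ℝ → ℝ := fun z => max (k - f z) 0 ^ 2 * η z with hφ
  have hwc : ContDiff ℝ 1 w := ((contDiff_max_sub_pow k 1).comp hf).mul hη
  have hφc : ContDiff ℝ 1 φ := ((contDiff_max_sub_pow k 0).comp hf).mul hη
  have hws : HasCompactSupport w := hηs.mul_left
  have hφs : HasCompactSupport φ := hηs.mul_left
  have hηd := hη.differentiable one_ne_zero
  have hfd := hf.differentiable one_ne_zero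
  have hηf := hη.continuous_fderiv one_ne_zero
  have hff := hf.continuous_fderiv one_ne_zero
  have hηc := hη.continuous
  have hfc := hf.continuous
  have haf := fun i => (ha i).continuous_fderiv one_ne_zero
  have hac := fun i => (ha i).continuous
  have hwd : ∀ z e, fderiv ℝ w z e = max (k - f z) 0 ^ 3 * fderiv ℝ η z e -
      3 * max (k - f z) 0 ^ 2 * fderiv ℝ f z e * η z := by
    intro z e
    have := fderiv_max_sub_pow_mul k 1 (hfd z) (hηd z) e
    norm_num at this
    exact this
  have hφd : ∀ z e, fderiv ℝ φ z e = max (k - f z) 0 ^ 2 * fderiv ℝ η z e -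
      2 * max (k - f z) 0 * fderiv ℝ f z e * η z := by
    intro z e
    have := fderiv_max_sub_pow_mul k 0 (hfd z) (hηd z) e
    norm_num at this
    exact this
  set S : Set ((Fin N → ℝ) × ℝ) := univ ×ˢ Iic t
  have hηfs : HasCompactSupport fun z => fderiv ℝ η z (0, 1) := hηs.fderiv_apply ℝ (0, 1)
  have hηfi : ∀ i, HasCompactSupport fun z => fderiv ℝ φ z (Pi.single i 1, 0) :=
    fun i => hφs.fderiv_apply ℝ _
  have hφff := hφc.continuous_fderiv one_ne_zero
  have hwff := hwc.continuous_fderiv one_ne_zero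
  have i1 : Integrable fun z => max (k - f z) 0 ^ 3 / 3 * fderiv ℝ η z (0, 1) :=
    (by fun_prop : Continuous fun z =>
      max (k - f z) 0 ^ 3 / 3 * fderiv ℝ η z (0, 1)).integrable_of_hasCompactSupport hηfs.mul_left
  have i2 : ∀ i, Integrable fun z => φ z * fderiv ℝ (a i) z (Pi.single i 1, 0) := fun i =>
    (by have := haf i; have := hφc.continuous; fun_prop : Continuous fun z =>
      φ z * fderiv ℝ (a i) z (Pi.single i 1, 0)).integrable_of_hasCompactSupport hφs.mul_right
  have i3 : ∀ i, Integrable fun z => a i z * fderiv ℝ φ z (Pi.single i 1, 0) := fun i =>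
    (by have := hac i; fun_prop : Continuous fun z =>
      a i z * fderiv ℝ φ z (Pi.single i 1, 0)).integrable_of_hasCompactSupport (hηfi i).mul_left
  have i4 : Integrable fun z => fderiv ℝ w z (0, 1) :=
    (by fun_prop : Continuous fun z =>
      fderiv ℝ w z (0, 1)).integrable_of_hasCompactSupport (hws.fderiv_apply ℝ _)
  calc ∫ x, max (k - f (x, t)) 0 ^ 3 / 3 * η (x, t) = 1 / 3 * ∫ x, w (x, t) := by
        rw [← integral_const_mul]
        congr 1
        funext x
        simp only [hw]
        ring
    _ = ∫ z in S, 1 / 3 * fderiv ℝ w z (0, 1) := by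
        rw [integral_slice_eq_integral_strip hwc hws, integral_const_mul]
    -- The differential inequality is multiplied by φ ≥ 0. It is available only on the support of η,
    -- and elsewhere both integrands agree.
    _ ≤ ∫ z in S, (max (k - f z) 0 ^ 3 / 3 * fderiv ℝ η z (0, 1) -
          ∑ i, φ z * fderiv ℝ (a i) z (Pi.single i 1, 0)) := by
        refine integral_mono (i4.const_mul _).integrableOn
          (i1.sub (integrable_finsetSum _ fun i _ => i2 i)).integrableOn fun z => ?_
        simp only
        rw [hwd, ← Finset.mul_sum]
        by_cases hz : z ∈ tsupport η
        · have h1 := hsuper z hz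
          have h2 : 0 ≤ φ z := mul_nonneg (by positivity) (hη0 z)
          have h3 := mul_le_mul_of_nonneg_left h1 h2
          simp only [hφ] at h3 ⊢
          linarith
        · have h0 : η z = 0 := image_eq_zero_of_notMem_tsupport hz
          simp only [hφ, h0]
          apply le_of_eq
          ring
    _ = (∫ z in S, max (k - f z) 0 ^ 3 / 3 * fderiv ℝ η z (0, 1)) +
          ∑ i, ∫ z in S, a i z * fderiv ℝ φ z (Pi.single i 1, 0) := by
        rw [integral_sub i1.integrableOn (integrable_finsetSum _ fun i _ => (i2 i).integrableOn),
          integral_finsetSum _ fun i _ => (i2 i).integrableOn, sub_eq_add_neg,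
          ← Finset.sum_neg_distrib]
        congr 1
        refine Finset.sum_congr rfl fun i _ => ?_
        rw [integral_strip_fderiv_space hφc hφs (ha i), neg_neg]
    _ = ∫ z in S, (max (k - f z) 0 ^ 3 / 3 * fderiv ℝ η z (0, 1) +
          ∑ i, a i z * fderiv ℝ φ z (Pi.single i 1, 0)) := by
        rw [integral_add i1.integrableOn (integrable_finsetSum _ fun i _ => (i3 i).integrableOn),
          integral_finsetSum _ fun i _ => (i3 i).integrableOn]
    _ = _ := by
        congr 1
        funext z
        unfold energyDensity
        congr 1
        refine Finset.sum_congr rfl fun i _ => ?_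
        rw [hφd]
        ring

end Energy

end AnisoParabolic

namespace AnisoParabolic

open scoped ENNReal NNReal ContDiff

/-! ### The equation satisfied by mollified supersolutions -/

section MollifiedEquation

instance isAddHaarMeasure_volume_spaceTime (N : ℕ) :
    (volume : Measure ((Fin N → ℝ) × ℝ)).IsAddHaarMeasure := by
  rw [Measure.volume_eq_prod]
  infer_instance

/-- The scalar flux `|s|^{q - 2} s`. -/
noncomputable def flux (q s : ℝ) : ℝ := |s| ^ (q - 2) * s

theorem flux_zero (q : ℝ) : flux q 0 = 0 := by simp [flux]

theorem measurable_flux (q : ℝ) : Measurable (flux q) := by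
  unfold flux
  fun_prop

theorem abs_flux {q : ℝ} (hq : 2 < q) (s : ℝ) : |flux q s| = |s| ^ (q - 1) := by
  rcases eq_or_ne s 0 with rfl | hs
  · rw [flux_zero, abs_zero, Real.zero_rpow (by linarith)]
  · have h : 0 < |s| := abs_pos.2 hs
    rw [flux, abs_mul, abs_of_nonneg (by positivity)]
    conv_lhs => enter [2]; rw [← Real.rpow_one |s|]
    rw [← Real.rpow_add h]
    congr 1
    ring

theorem flux_mul_self {q : ℝ} (hq : 2 < q) (s : ℝ) : flux q s * s = |s| ^ q := by
  rcases eq_or_ne s 0 with rfl | hs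
  · rw [mul_zero, abs_zero, Real.zero_rpow (by linarith)]
  · have h : 0 < |s| := abs_pos.2 hs
    have h2 : |s| ^ (2 : ℝ) = s * s := by
      rw [Real.rpow_two, sq_abs, sq]
    rw [flux, mul_assoc, ← h2, ← Real.rpow_add h]
    congr 1
    ring

/-- The properties of the space-time mollifications of a supersolution `U` with gradient `G`,
bounded from below by `m`, in a set `D`. -/
structure MollifiedSuper {N : ℕ} (p : Fin N → ℝ) (U : (Fin N → ℝ) × ℝ → ℝ)
    (G : Fin N → (Fin N → ℝ) × ℝ → ℝ) (m : ℝ) (D : Set ((Fin N → ℝ) × ℝ)) : Prop where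
  integrable : Integrable U
  memLp_grad : ∀ i, MemLp (G i) (ENNReal.ofReal (p i)) volume
  integrable_grad : ∀ i, Integrable (G i)
  integrable_flux : ∀ i, Integrable fun z => flux (p i) (G i z)
  grad_eq : ∀ (φ : ContDiffBump (0 : (Fin N → ℝ) × ℝ)) (z : (Fin N → ℝ) × ℝ),
    Metric.closedBall z φ.rOut ⊆ D → ∀ i,
      fderiv ℝ (mollify volume φ U) z (Pi.single i 1, 0) = mollify volume φ (G i) z
  super : ∀ (φ : ContDiffBump (0 : (Fin N → ℝ) × ℝ)) (z : (Fin N → ℝ) × ℝ),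
    Metric.closedBall z φ.rOut ⊆ D →
      ∑ i, fderiv ℝ (mollify volume φ fun w => flux (p i) (G i w)) z (Pi.single i 1, 0) ≤
        fderiv ℝ (mollify volume φ U) z (0, 1)
  lower : ∀ (φ : ContDiffBump (0 : (Fin N → ℝ) × ℝ)) (z : (Fin N → ℝ) × ℝ),
    Metric.closedBall z φ.rOut ⊆ D → m ≤ mollify volume φ U z
  lower_ae : ∀ᵐ z ∂(volume.restrict D), m ≤ U z

theorem integrable_mul_comp_sub {E : Type*} [NormedAddCommGroup E] [NormedSpace ℝ E]
    [FiniteDimensional ℝ E] [MeasurableSpace E] [BorelSpace E] {μ : Measure E} [μ.IsAddHaarMeasure]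
    {f ψ : E → ℝ} (hf : LocallyIntegrable f μ) (hψ : Continuous ψ) (hψs : HasCompactSupport ψ)
    (x : E) : Integrable (fun t => f t * ψ (x - t)) μ := by
  have := hψs.convolutionExists_right (ContinuousLinearMap.mul ℝ ℝ) hf hψ x
  simpa [ConvolutionExistsAt] using this

theorem normed_eq_zero_of_le_norm {E : Type*} [NormedAddCommGroup E] [NormedSpace ℝ E]
    [FiniteDimensional ℝ E] [MeasurableSpace E] [BorelSpace E] (μ : Measure E) [μ.IsAddHaarMeasure]
    (φ : ContDiffBump (0 : E)) {x : E} (hx : φ.rOut ≤ ‖x‖) : φ.normed μ x = 0 := by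
  by_contra h
  have : x ∈ Function.support (φ.normed μ) := h
  rw [φ.support_normed_eq, mem_ball_zero_iff] at this
  linarith

theorem fderiv_normed_eq_zero_of_lt_norm {E : Type*} [NormedAddCommGroup E] [NormedSpace ℝ E]
    [FiniteDimensional ℝ E] [MeasurableSpace E] [BorelSpace E] (μ : Measure E) [μ.IsAddHaarMeasure]
    (φ : ContDiffBump (0 : E)) {x : E} (hx : φ.rOut < ‖x‖) : fderiv ℝ (φ.normed μ) x = 0 := by
  by_contra h
  have h1 : x ∈ tsupport (φ.normed μ) := support_fderiv_subset ℝ h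
  rw [φ.tsupport_normed_eq, mem_closedBall_zero_iff] at h1
  linarith

theorem fderiv_comp_const_sub {E : Type*} [NormedAddCommGroup E] [NormedSpace ℝ E]
    {ψ : E → ℝ} (hψ : Differentiable ℝ ψ) (x₀ x v : E) :
    fderiv ℝ (fun w => ψ (x₀ - w)) x v = -fderiv ℝ ψ (x₀ - x) v := by
  have h : HasFDerivAt (fun w => x₀ - w) (-ContinuousLinearMap.id ℝ E) x :=
    (hasFDerivAt_id x).const_sub x₀
  have h2 : HasFDerivAt (fun w => ψ (x₀ - w))
      ((fderiv ℝ ψ (x₀ - x)).comp (-ContinuousLinearMap.id ℝ E)) x :=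
    (hψ (x₀ - x)).hasFDerivAt.comp x h
  rw [h2.fderiv]
  simp

variable {N : ℕ} {p : Fin N → ℝ} {Ω : Set (Fin N → ℝ)} {T : ℝ} {u : (Fin N → ℝ) × ℝ → ℝ}
  {g : Fin N → (Fin N → ℝ) × ℝ → ℝ}

/-- By Fubini's theorem the claim reduces to almost every time slice. There the reflected kernel is
an admissible test function for the weak derivative, because the ball lies in the cylinder, where
the indicators equal one. The sign from the reflection cancels the sign from integration by parts.
-/
theorem fderiv_mollify_indicator {K₀ : Set (Fin N → ℝ)} (hK₀Ω : K₀ ⊆ Ω)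
    {t₁ t₂ : ℝ} (ht₁ : -T < t₁) (ht₂ : t₂ < T) {i : Fin N}
    (hweak : ∀ᵐ t ∂(volume.restrict (Ioo (-T) T)),
      IsWeakPartial Ω i (fun x => u (x, t)) (fun x => g i (x, t)))
    (hu : Integrable ((K₀ ×ˢ Icc t₁ t₂).indicator u))
    (hg : Integrable ((K₀ ×ˢ Icc t₁ t₂).indicator (g i)))
    (φ : ContDiffBump (0 : (Fin N → ℝ) × ℝ)) {z : (Fin N → ℝ) × ℝ}
    (hz : Metric.closedBall z φ.rOut ⊆ K₀ ×ˢ Icc t₁ t₂) :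
    fderiv ℝ (mollify volume φ ((K₀ ×ˢ Icc t₁ t₂).indicator u)) z (Pi.single i 1, 0) =
      mollify volume φ ((K₀ ×ˢ Icc t₁ t₂).indicator (g i)) z := by
  set C := K₀ ×ˢ Icc t₁ t₂ with hC
  obtain ⟨x₀, t₀⟩ := z
  set η : (Fin N → ℝ) × ℝ → ℝ := φ.normed volume with hη
  have hηc : ContDiff ℝ ∞ η := φ.contDiff_normed (n := ⊤)
  have hη1 : ContDiff ℝ 1 η := φ.contDiff_normed (n := 1)
  have hηd : Differentiable ℝ η := hη1.differentiable one_ne_zero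
  have hηs : HasCompactSupport η := φ.hasCompactSupport_normed
  have hηf := hη1.continuous_fderiv one_ne_zero
  rw [fderiv_mollify φ hu.locallyIntegrable, mollify_apply]
  have i1 := integrable_mul_comp_sub (ψ := fun w => fderiv ℝ η w (Pi.single i 1, 0))
    hu.locallyIntegrable (by fun_prop) (hηs.fderiv_apply ℝ _) (x₀, t₀)
  have i2 := integrable_mul_comp_sub (ψ := η) hg.locallyIntegrable hη1.continuous hηs (x₀, t₀)
  change ∫ t, C.indicator u t * fderiv ℝ η ((x₀, t₀) - t) (Pi.single i 1, 0) =
    ∫ t, C.indicator (g i) t * η ((x₀, t₀) - t)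
  have hη0 : ∀ w, φ.rOut ≤ ‖w‖ → η w = 0 := fun w hw => normed_eq_zero_of_le_norm volume φ hw
  have hηf0' : ∀ w, φ.rOut < ‖w‖ → fderiv ℝ η w = 0 := fun w hw =>
    fderiv_normed_eq_zero_of_lt_norm volume φ hw
  clear_value η
  rw [Measure.volume_eq_prod] at i1 i2 ⊢
  rw [integral_prod_symm _ i1, integral_prod_symm _ i2]
  refine integral_congr_ae ?_
  filter_upwards [(ae_restrict_iff' measurableSet_Ioo).1 hweak] with t ht
  -- Slices farther than the outer radius from t₀ miss the support of the kernel and contribute zero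
  -- on both sides.
  by_cases htr : |t₀ - t| ≤ φ.rOut
  · have hmem : ∀ x, ‖x₀ - x‖ ≤ φ.rOut → (x, t) ∈ C := by
      intro x hx
      refine hz ?_
      rw [Metric.mem_closedBall, dist_comm, dist_eq_norm, Prod.norm_def]
      exact max_le hx htr
    have hCx : ∀ x, x ∉ Ω → φ.rOut < ‖x₀ - x‖ := fun x hx => by
      by_contra h
      exact hx (hK₀Ω (hmem x (not_lt.1 h)).1)
    have htT : t ∈ Ioo (-T) T := by
      have := (hmem x₀ (by simpa using φ.rOut_pos.le)).2
      exact ⟨ht₁.trans_le this.1, this.2.trans_lt ht₂⟩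
    set ψ : (Fin N → ℝ) → ℝ := fun x => η ((x₀, t₀) - (x, t)) with hψ
    have hnorm : ∀ x, ‖x₀ - x‖ ≤ ‖((x₀, t₀) - (x, t) : (Fin N → ℝ) × ℝ)‖ := fun x => by
      rw [Prod.norm_def]
      exact le_max_left _ _
    have hψ0 : ∀ x, φ.rOut < ‖x₀ - x‖ → ψ x = 0 := fun x hx =>
      hη0 _ (hx.le.trans (hnorm x))
    have hηf0 : ∀ x, φ.rOut < ‖x₀ - x‖ → fderiv ℝ η ((x₀, t₀) - (x, t)) = 0 := fun x hx =>
      hηf0' _ (hx.trans_le (hnorm x))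
    have hψc : ContDiff ℝ ∞ ψ := by fun_prop
    have hts : tsupport ψ ⊆ Metric.closedBall x₀ φ.rOut := by
      refine closure_minimal (fun x hx => ?_) Metric.isClosed_closedBall
      rw [Metric.mem_closedBall, dist_comm, dist_eq_norm]
      by_contra h
      exact hx (hψ0 x (not_le.1 h))
    have hψs : HasCompactSupport ψ :=
      (isCompact_closedBall x₀ φ.rOut).of_isClosed_subset (isClosed_tsupport ψ) hts
    have hψΩ : tsupport ψ ⊆ Ω := fun x hx => by
      have := hts hx
      rw [Metric.mem_closedBall, dist_comm, dist_eq_norm] at this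
      exact hK₀Ω (hmem x this).1
    have hψf : ∀ x, fderiv ℝ ψ x (Pi.single i 1) =
        -fderiv ℝ η ((x₀, t₀) - (x, t)) (Pi.single i 1, 0) := by
      intro x
      have hd : Differentiable ℝ fun w : (Fin N → ℝ) × ℝ => η ((x₀, t₀) - w) := by fun_prop
      have := fderiv_slice_apply (hd (x, t)) (Pi.single i 1)
      rw [fderiv_comp_const_sub hηd] at this
      exact this
    have hb := (ht htT).byParts ψ hψc hψs hψΩ
    have e1 : ∀ v : (Fin N → ℝ) × ℝ → ℝ, ∀ x, ‖x₀ - x‖ ≤ φ.rOut →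
        C.indicator v (x, t) = v (x, t) := fun v x hx => indicator_of_mem (hmem x hx) _
    have hl : ∫ x in Ω, u (x, t) * fderiv ℝ ψ x (Pi.single i 1) =
        -∫ x, C.indicator u (x, t) * fderiv ℝ η ((x₀, t₀) - (x, t)) (Pi.single i 1, 0) := by
      rw [setIntegral_eq_integral_of_forall_compl_eq_zero, ← integral_neg]
      · congr 1
        funext x
        rw [hψf]
        by_cases hx : ‖x₀ - x‖ ≤ φ.rOut
        · rw [e1 u x hx]
          ring
        · rw [hηf0 x (not_le.1 hx)]
          simp
      · intro x hx
        rw [hψf, hηf0 x (hCx x hx)]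
        simp
    have hr : ∫ x in Ω, g i (x, t) * ψ x =
        ∫ x, C.indicator (g i) (x, t) * η ((x₀, t₀) - (x, t)) := by
      rw [setIntegral_eq_integral_of_forall_compl_eq_zero]
      · congr 1
        funext x
        by_cases hx : ‖x₀ - x‖ ≤ φ.rOut
        · rw [e1 (g i) x hx]
        · have := hψ0 x (not_le.1 hx)
          simp only [hψ] at this ⊢
          rw [this]
          simp
      · intro x hx
        rw [hψ0 x (hCx x hx), mul_zero]
    rw [hl, hr] at hb
    exact neg_inj.1 hb
  · have hn : ∀ x, φ.rOut < ‖((x₀, t₀) - (x, t) : (Fin N → ℝ) × ℝ)‖ := fun x => by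
      rw [Prod.norm_def]
      exact lt_max_of_lt_right (not_le.1 htr)
    have h1 : ∀ x, η ((x₀, t₀) - (x, t)) = 0 := fun x =>
      hη0 _ (hn x).le
    have h2 : ∀ x, fderiv ℝ η ((x₀, t₀) - (x, t)) = 0 := fun x =>
      hηf0' _ (hn x)
    simp only [h1, h2, mul_zero, ContinuousLinearMap.zero_apply]

/-- The weak inequality is linear in u and the flux taken together, so testing with the reflected
kernel centred at z gives exactly the differential inequality between their mollifications at z. The
flux is mollified as a field of its own and is not recomputed from the mollified gradient. -/
theorem sum_fderiv_mollify_flux_le {K₀ : Set (Fin N → ℝ)} (hK₀Ω : K₀ ⊆ Ω)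
    {t₁ t₂ : ℝ} (ht₁ : -T < t₁) (ht₂ : t₂ < T)
    (hsup : ∀ K : Set (Fin N → ℝ), IsCompact K → K ⊆ Ω → ∀ t₁ t₂ : ℝ, -T < t₁ → t₁ < t₂ → t₂ < T →
      ∀ φ : (Fin N → ℝ) × ℝ → ℝ, IsTest K φ → 0 ≤ weakForm p u g K t₁ t₂ φ)
    (hu : Integrable ((K₀ ×ˢ Icc t₁ t₂).indicator u))
    (hg : ∀ i, Integrable fun z => flux (p i) ((K₀ ×ˢ Icc t₁ t₂).indicator (g i) z))
    (φ : ContDiffBump (0 : (Fin N → ℝ) × ℝ)) {z : (Fin N → ℝ) × ℝ}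
    (hz : Metric.closedBall z φ.rOut ⊆ K₀ ×ˢ Icc t₁ t₂) :
    ∑ i, fderiv ℝ (mollify volume φ fun w => flux (p i) ((K₀ ×ˢ Icc t₁ t₂).indicator (g i) w)) z
        (Pi.single i 1, 0) ≤
      fderiv ℝ (mollify volume φ ((K₀ ×ˢ Icc t₁ t₂).indicator u)) z (0, 1) := by
  set C := K₀ ×ˢ Icc t₁ t₂ with hC
  obtain ⟨x₀, t₀⟩ := z
  set η : (Fin N → ℝ) × ℝ → ℝ := φ.normed volume with hη
  have hηc : ContDiff ℝ ∞ η := φ.contDiff_normed (n := ⊤)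
  have hη1 : ContDiff ℝ 1 η := φ.contDiff_normed (n := 1)
  have hηd : Differentiable ℝ η := hη1.differentiable one_ne_zero
  have hηs : HasCompactSupport η := φ.hasCompactSupport_normed
  have hηf := hη1.continuous_fderiv one_ne_zero
  have hr := φ.rOut_pos
  set r := φ.rOut with hrdef
  have hball : Metric.closedBall (x₀, t₀) r = Metric.closedBall x₀ r ×ˢ Icc (t₀ - r) (t₀ + r) := by
    rw [← closedBall_prod_same, Real.closedBall_eq_Icc]
  rw [hball] at hz
  have hx₀ : x₀ ∈ Metric.closedBall x₀ r := Metric.mem_closedBall_self hr.le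
  have hK : Metric.closedBall x₀ r ⊆ K₀ := fun x hx =>
    (hz (mk_mem_prod hx (mem_Icc.2 ⟨by linarith, by linarith⟩) : (x, t₀) ∈ _)).1
  have hl : t₁ ≤ t₀ - r :=
    (hz (mk_mem_prod hx₀ (mem_Icc.2 ⟨by linarith, by linarith⟩) : (x₀, t₀ - r) ∈ _)).2.1
  have hu' : t₀ + r ≤ t₂ :=
    (hz (mk_mem_prod hx₀ (mem_Icc.2 ⟨by linarith, by linarith⟩) : (x₀, t₀ + r) ∈ _)).2.2
  set ψ : (Fin N → ℝ) × ℝ → ℝ := fun w => η ((x₀, t₀) - w) with hψ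
  have htest : IsTest (Metric.closedBall x₀ r) ψ := by
    refine ⟨by fun_prop, fun z => φ.nonneg_normed _, fun x t hx => ?_⟩
    refine normed_eq_zero_of_le_norm volume φ ?_
    rw [Metric.mem_closedBall, dist_comm, dist_eq_norm, not_le] at hx
    refine hx.le.trans ?_
    rw [Prod.norm_def]
    exact le_max_left _ _
  have hw := hsup _ (isCompact_closedBall x₀ r) (hK.trans hK₀Ω) (t₀ - r) (t₀ + r) (by linarith)
    (by linarith) (by linarith) ψ htest
  -- The kernel vanishes at both end times of [t₀ - r, t₀ + r], so the boundary terms of the weak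
  -- form disappear.
  have hbd : ∀ τ, |t₀ - τ| = r → ∀ x, ψ (x, τ) = 0 := by
    intro τ hτ x
    refine normed_eq_zero_of_le_norm volume φ ?_
    rw [← hrdef, ← hτ, Prod.norm_def]
    exact le_max_right _ _
  have hb1 := hbd (t₀ + r) (by rw [sub_add_cancel_left, abs_neg, abs_of_pos hr])
  have hb2 := hbd (t₀ - r) (by rw [sub_sub_cancel, abs_of_pos hr])
  unfold weakForm at hw
  simp only [hb1, hb2, mul_zero, integral_zero, sub_zero, zero_add] at hw
  rw [← hball] at hw
  have hψf : ∀ w v, fderiv ℝ ψ w v = -fderiv ℝ η ((x₀, t₀) - w) v := fun w v =>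
    fderiv_comp_const_sub hηd _ _ _
  have hint : ∀ (v : (Fin N → ℝ) × ℝ) (f : (Fin N → ℝ) × ℝ → ℝ), Integrable f →
      Integrable fun w => f w * fderiv ℝ η ((x₀, t₀) - w) v := fun v f hf =>
    integrable_mul_comp_sub (ψ := fun w => fderiv ℝ η w v) hf.locallyIntegrable
      (by fun_prop) (hηs.fderiv_apply ℝ _) (x₀, t₀)
  have heq : ∫ w in Metric.closedBall (x₀, t₀) r, (-(u w * fderiv ℝ ψ w (0, 1)) +
        ∑ i, |g i w| ^ (p i - 2) * g i w * fderiv ℝ ψ w (Pi.single i 1, 0)) =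
      ∫ w, (C.indicator u w * fderiv ℝ η ((x₀, t₀) - w) (0, 1) -
        ∑ i, flux (p i) (C.indicator (g i) w) *
          fderiv ℝ η ((x₀, t₀) - w) (Pi.single i 1, 0)) := by
    refine Eq.trans ?_ (setIntegral_eq_integral_of_forall_compl_eq_zero
      (s := Metric.closedBall (x₀, t₀) r) ?_)
    · refine setIntegral_congr_fun Metric.isClosed_closedBall.measurableSet fun w hwm => ?_
      have hwC : w ∈ C := hz (by rwa [← hball])
      simp only [indicator_of_mem hwC, hψf, flux, mul_neg, neg_neg, Finset.sum_neg_distrib,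
        sub_eq_add_neg]
    · intro w hwm
      rw [Metric.mem_closedBall, dist_comm, dist_eq_norm, not_le] at hwm
      rw [fderiv_normed_eq_zero_of_lt_norm volume φ hwm]
      simp
  rw [heq, integral_sub (hint _ _ hu) (integrable_finsetSum _ fun i _ => hint _ _ (hg i)),
    integral_finsetSum _ fun i _ => hint _ _ (hg i)] at hw
  rw [fderiv_mollify φ hu.locallyIntegrable]
  simp only [fderiv_mollify φ (hg _).locallyIntegrable]
  linarith

/-- Cutting u and its gradient off outside a compact cylinder makes them integrable on the whole
space, and it does not affect mollification at points whose kernel ball lies in D. -/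
theorem mollifiedSuper_indicator (hp : ∀ i, 2 < p i) (hspace : InSolutionSpace p Ω T u g)
    (hsup : ∀ K : Set (Fin N → ℝ), IsCompact K → K ⊆ Ω → ∀ t₁ t₂ : ℝ, -T < t₁ → t₁ < t₂ → t₂ < T →
      ∀ φ : (Fin N → ℝ) × ℝ → ℝ, IsTest K φ → 0 ≤ weakForm p u g K t₁ t₂ φ)
    {K₀ : Set (Fin N → ℝ)} (hK₀ : IsCompact K₀) (hK₀Ω : K₀ ⊆ Ω)
    {t₁ t₂ : ℝ} (ht₁ : -T < t₁) (ht₂ : t₂ < T) {D : Set ((Fin N → ℝ) × ℝ)}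
    (hDm : MeasurableSet D) (hD : D ⊆ K₀ ×ˢ Icc t₁ t₂) {m : ℝ}
    (hlow : ∀ᵐ z ∂(volume.restrict D), m ≤ u z) :
    MollifiedSuper p ((K₀ ×ˢ Icc t₁ t₂).indicator u)
      (fun i => (K₀ ×ˢ Icc t₁ t₂).indicator (g i)) m D := by
  have hCm : MeasurableSet (K₀ ×ˢ Icc t₁ t₂) := hK₀.measurableSet.prod measurableSet_Icc
  have hCfin : volume (K₀ ×ˢ Icc t₁ t₂) ≠ ⊤ := (hK₀.prod isCompact_Icc).measure_lt_top.ne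
  have hU : Integrable ((K₀ ×ˢ Icc t₁ t₂).indicator u) :=
    (hspace.locInt K₀ hK₀ hK₀Ω t₁ t₂ ht₁ ht₂).integrable_indicator hCm
  have hGr : ∀ i, MemLp (g i) (ENNReal.ofReal (p i)) (volume.restrict (K₀ ×ˢ Icc t₁ t₂)) :=
    fun i => hspace.grad_memLp i K₀ hK₀ hK₀Ω t₁ t₂ ht₁ ht₂
  have hG : ∀ i, MemLp ((K₀ ×ˢ Icc t₁ t₂).indicator (g i)) (ENNReal.ofReal (p i)) volume :=
    fun i => (memLp_indicator_iff_restrict hCm).2 (hGr i)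
  have hGi : ∀ i, Integrable ((K₀ ×ˢ Icc t₁ t₂).indicator (g i)) := by
    intro i
    have : IsFiniteMeasure (volume.restrict (K₀ ×ˢ Icc t₁ t₂)) :=
      isFiniteMeasure_restrict.2 hCfin
    have h1 : IntegrableOn (g i) (K₀ ×ˢ Icc t₁ t₂) :=
      (hGr i).integrable (by rw [ENNReal.one_le_ofReal]; linarith [hp i])
    exact h1.integrable_indicator hCm
  -- On a set of finite measure this follows from |s|^{p - 1} ≤ 1 + |s|^p.
  have hF : ∀ i, Integrable fun z => flux (p i) ((K₀ ×ˢ Icc t₁ t₂).indicator (g i) z) := by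
    intro i
    have h0 : 0 < p i := by linarith [hp i]
    have h1 : Integrable fun z => ‖(K₀ ×ˢ Icc t₁ t₂).indicator (g i) z‖ ^ p i := by
      have := (hG i).integrable_norm_rpow (by simpa using h0) ENNReal.ofReal_ne_top
      rwa [ENNReal.toReal_ofReal h0.le] at this
    have h2 : Integrable ((K₀ ×ˢ Icc t₁ t₂).indicator fun _ => (1 : ℝ)) :=
      (integrable_indicator_iff hCm).2 (integrableOn_const hCfin)
    refine (h2.add h1).mono'
      ((measurable_flux (p i)).comp_aemeasurable (hGi i).1.aemeasurable).aestronglyMeasurable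
      (.of_forall fun z => ?_)
    rw [Real.norm_eq_abs, abs_flux (hp i)]
    simp only [Pi.add_apply]
    by_cases hz : z ∈ K₀ ×ˢ Icc t₁ t₂
    · simp only [indicator_of_mem hz, Real.norm_eq_abs]
      rcases le_total |g i z| 1 with h | h
      · have : |g i z| ^ (p i - 1) ≤ 1 :=
          Real.rpow_le_one (abs_nonneg _) h (by linarith [hp i])
        have : 0 ≤ |g i z| ^ p i := by positivity
        linarith
      · have : |g i z| ^ (p i - 1) ≤ |g i z| ^ p i :=
          Real.rpow_le_rpow_of_exponent_le h (by linarith)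
        linarith
    · simp only [indicator_of_notMem hz, abs_zero, norm_zero]
      rw [Real.zero_rpow (by linarith [hp i]), Real.zero_rpow h0.ne']
      simp
  have hlow' : ∀ᵐ z ∂(volume.restrict D), m ≤ (K₀ ×ˢ Icc t₁ t₂).indicator u z := by
    filter_upwards [hlow, ae_restrict_mem hDm] with z hz hzD
    rwa [indicator_of_mem (hD hzD)]
  refine ⟨hU, hG, hGi, hF, fun φ z hz i => ?_, fun φ z hz => ?_, fun φ z hz => ?_, hlow'⟩
  · exact fderiv_mollify_indicator hK₀Ω ht₁ ht₂ (hspace.weakPartial i) hU (hGi i) φ (hz.trans hD)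
  · exact sum_fderiv_mollify_flux_le hK₀Ω ht₁ ht₂ hsup hU hF φ (hz.trans hD)
  · exact le_mollify φ hU.locallyIntegrable (ae_restrict_of_ae_restrict_of_subset hz hlow')

end MollifiedEquation

end AnisoParabolic

namespace AnisoParabolic

open scoped ENNReal NNReal ContDiff

/-! ### Mollification in Lebesgue spaces and bounded cutoffs -/

section MollifyLp

variable {E : Type*} [NormedAddCommGroup E] [NormedSpace ℝ E] [FiniteDimensional ℝ E]
  [MeasurableSpace E] [BorelSpace E] {μ : Measure E} [μ.IsAddHaarMeasure]

theorem memLp_mollify (φ : ContDiffBump (0 : E)) {q : ℝ} (hq : 1 ≤ q) {f : E → ℝ}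
    (hf : MemLp f (ENNReal.ofReal q) μ) : MemLp (mollify μ φ f) (ENNReal.ofReal q) μ := by
  have h1 : (1 : ℝ≥0∞) ≤ ENNReal.ofReal q := by simpa using hq
  set g := hf.1.mk f with hg
  have hfg : f =ᵐ[μ] g := hf.1.ae_eq_mk
  have hgL : MemLp g (ENNReal.ofReal q) μ := (memLp_congr_ae hfg).1 hf
  rw [mollify_congr φ hfg]
  have hgl := hgL.locallyIntegrable h1
  -- The crude translation bound by twice the norm of g puts the difference of mollification and
  -- function in the space, and g is then added back.
  have hle := eLpNorm_mollify_sub_le (μ := μ) φ hq hf.1.stronglyMeasurable_mk hgl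
    (ε := eLpNorm g (ENNReal.ofReal q) μ + eLpNorm g (ENNReal.ofReal q) μ) fun h _ => by
      have hm := measurePreserving_sub_right μ h
      refine (eLpNorm_sub_le (hgL.comp_measurePreserving hm).1 hgL.1 h1).trans ?_
      exact add_le_add (eLpNorm_comp_measurePreserving hgL.1 hm).le le_rfl
  have hsub : MemLp (fun x => mollify μ φ g x - g x) (ENNReal.ofReal q) μ :=
    ⟨(contDiff_mollify φ hgl).continuous.aestronglyMeasurable.sub hgL.1,
      hle.trans_lt (ENNReal.add_lt_top.2 ⟨hgL.2, hgL.2⟩)⟩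
  have := hsub.add hgL
  refine this.congr_norm (contDiff_mollify φ hgl).continuous.aestronglyMeasurable
    (.of_forall fun x => ?_)
  simp

theorem tendstoL1_mollify {φ : ℕ → ContDiffBump (0 : E)}
    (hφ : Tendsto (fun n => (φ n).rOut) atTop (𝓝 0)) {f : E → ℝ} (hf : Integrable f μ) :
    TendstoL1 μ (fun n => mollify μ (φ n) f) f := by
  have h1 : MemLp f (ENNReal.ofReal 1) μ := by
    rw [ENNReal.ofReal_one]
    exact memLp_one_iff_integrable.2 hf
  refine ⟨fun n => ?_, hf, ?_⟩
  · have := memLp_mollify (φ n) le_rfl h1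
    rw [ENNReal.ofReal_one] at this
    exact memLp_one_iff_integrable.1 this
  · have := tendsto_eLpNorm_mollify_sub hφ le_rfl h1
    rwa [ENNReal.ofReal_one] at this

theorem tendstoL1_mollify_mul {φ : ℕ → ContDiffBump (0 : E)}
    (hφ : Tendsto (fun n => (φ n).rOut) atTop (𝓝 0)) {q r : ℝ} (hqr : q.HolderConjugate r)
    {f g : E → ℝ} (hf : MemLp f (ENNReal.ofReal q) μ) (hg : MemLp g (ENNReal.ofReal r) μ) :
    TendstoL1 μ (fun n x => mollify μ (φ n) f x * mollify μ (φ n) g x) (fun x => f x * g x) := by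
  have := hqr.ennrealOfReal
  exact tendstoL1_mul (fun n => memLp_mollify (φ n) hqr.lt.le hf) hf
    (fun n => memLp_mollify (φ n) hqr.symm.lt.le hg) hg
    (tendsto_eLpNorm_mollify_sub hφ hqr.lt.le hf) (tendsto_eLpNorm_mollify_sub hφ hqr.symm.lt.le hg)

theorem exists_bumpSeq_of_compact {K D : Set E} (hK : IsCompact K) (hD : IsOpen D) (hKD : K ⊆ D) :
    ∃ φ : ℕ → ContDiffBump (0 : E), Tendsto (fun n => (φ n).rOut) atTop (𝓝 0) ∧
      (∀ n, (φ n).rOut ≤ 2 * (φ n).rIn) ∧ ∀ n, ∀ z ∈ K, Metric.closedBall z (φ n).rOut ⊆ D := by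
  obtain ⟨δ, hδ, hsub⟩ := hK.exists_cthickening_subset_open hD hKD
  obtain ⟨n₀, hn₀⟩ := ((tendsto_bumpSeq (E := E)).eventually_lt_const hδ).exists_forall_of_atTop
  refine ⟨fun n => bumpSeq E (n + n₀), tendsto_bumpSeq.comp (tendsto_add_atTop_nat n₀),
    fun n => bumpSeq_rOut_le _, fun n z hz => ?_⟩
  exact (Metric.closedBall_subset_closedBall (hn₀ _ (by omega)).le).trans
    ((Metric.closedBall_subset_cthickening hz δ).trans hsub)

end MollifyLp

theorem TendstoL1.of_bdd {α : Type*} [MeasurableSpace α] {μ : Measure α} {S : Set α}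
    (hS : MeasurableSet S) (hSfin : μ S ≠ ⊤) {c : ℕ → α → ℝ} {c₀ : α → ℝ}
    (hc : ∀ n, AEStronglyMeasurable (c n) μ) {M : ℝ} (hM : ∀ n, ∀ᵐ x ∂μ, |c n x| ≤ M)
    (hlim : ∀ᵐ x ∂μ, Tendsto (fun n => c n x) atTop (𝓝 (c₀ x)))
    (hz : ∀ n, ∀ x, x ∉ S → c n x = 0) (hz₀ : ∀ x, x ∉ S → c₀ x = 0) : TendstoL1 μ c c₀ := by
  have hone : Integrable (S.indicator fun _ => (1 : ℝ)) μ :=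
    (integrable_indicator_iff hS).2 (integrableOn_const hSfin)
  -- The indicator of S serves as a constant L¹ sequence, so the claim becomes a case of
  -- `TendstoL1.bdd_mul`.
  have hL : TendstoL1 μ (fun _ => S.indicator fun _ => (1 : ℝ)) (S.indicator fun _ => (1 : ℝ)) :=
    ⟨fun _ => hone, hone, by simp⟩
  have := hL.bdd_mul hc hM hlim
  have e : ∀ d : α → ℝ, (∀ x, x ∉ S → d x = 0) →
      (fun x => d x * S.indicator (fun _ => (1 : ℝ)) x) = d := by
    intro d hd
    funext x
    by_cases hx : x ∈ S
    · simp [hx]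
    · simp [hx, hd x hx]
  have e2 : (fun n x => c n x * S.indicator (fun _ => (1 : ℝ)) x) = c :=
    funext fun n => e (c n) (hz n)
  rwa [e2, e c₀ hz₀] at this

/-- The flux has absolute value |s|^{q - 1}, and q/(q - 1) is the exponent conjugate to q. This
duality makes the product of flux and gradient integrable. -/
theorem memLp_flux {α : Type*} [MeasurableSpace α] {μ : Measure α} {q : ℝ} (hq : 2 < q)
    {f : α → ℝ} (hf : MemLp f (ENNReal.ofReal q) μ) :
    MemLp (fun x => flux q (f x)) (ENNReal.ofReal (q.conjExponent)) μ := by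
  have h := hf.norm_rpow_div (ENNReal.ofReal (q - 1))
  rw [ENNReal.toReal_ofReal (by linarith), ← ENNReal.ofReal_div_of_pos (by linarith)] at h
  refine h.congr_norm ((measurable_flux q).comp_aemeasurable
    hf.1.aemeasurable).aestronglyMeasurable (.of_forall fun x => ?_)
  rw [Real.norm_eq_abs, Real.norm_eq_abs, Real.norm_eq_abs, abs_flux hq,
    abs_of_nonneg (by positivity)]

/-! ### Passage to the limit in the energy inequality and the embedding -/

section Limit

variable {N : ℕ} {p : Fin N → ℝ} {U : (Fin N → ℝ) × ℝ → ℝ} {G : Fin N → (Fin N → ℝ) × ℝ → ℝ}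
  {m : ℝ} {D : Set ((Fin N → ℝ) × ℝ)}

/-- Everything that is needed about the regularisations `f n` of a supersolution `U` in order to
pass to the limit in the energy inequality with cutoff `η`. -/
theorem MollifiedSuper.exists_approximation (h : MollifiedSuper p U G m D) (hp : ∀ i, 2 < p i)
    (hD : IsOpen D) {η : (Fin N → ℝ) × ℝ → ℝ} (hη : ContDiff ℝ 1 η) (hηs : HasCompactSupport η)
    (hηD : tsupport η ⊆ D) (hη0 : ∀ z, 0 ≤ η z) {k : ℝ} (hk : m ≤ k) :
    ∃ f : ℕ → (Fin N → ℝ) × ℝ → ℝ, ∃ J : ℕ → (Fin N → ℝ) × ℝ → ℝ,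
      (∀ n, ContDiff ℝ 1 (f n)) ∧
      (∀ᵐ z, Tendsto (fun n => f n z) atTop (𝓝 (U z))) ∧
      (∀ n t, ∫ x, max (k - f n (x, t)) 0 ^ 3 / 3 * η (x, t) ≤ ∫ z in univ ×ˢ Iic t, J n z) ∧
      TendstoL1 volume J (energyDensity k η U (fun i z => flux (p i) (G i z)) G) ∧
      ∀ i, TendstoL1 volume
        (fun n z => fderiv ℝ (fun z => max (k - f n z) 0 ^ 3 * η z) z (Pi.single i 1, 0))
        (fun z => max (k - U z) 0 ^ 3 * fderiv ℝ η z (Pi.single i 1, 0) -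
          3 * max (k - U z) 0 ^ 2 * η z * G i z) := by
  obtain ⟨φ, hφ, hφ2, hφD⟩ := exists_bumpSeq_of_compact hηs.isCompact hD hηD
  set f : ℕ → (Fin N → ℝ) × ℝ → ℝ := fun n => mollify volume (φ n) U with hf
  set A : ℕ → Fin N → (Fin N → ℝ) × ℝ → ℝ :=
    fun n i => mollify volume (φ n) fun z => flux (p i) (G i z) with hA
  set Γ : ℕ → Fin N → (Fin N → ℝ) × ℝ → ℝ := fun n i => mollify volume (φ n) (G i) with hΓ
  have hfc : ∀ n, ContDiff ℝ 1 (f n) := fun n =>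
    (contDiff_mollify (φ n) h.integrable.locallyIntegrable).of_le (by norm_cast)
  have hAc : ∀ n i, ContDiff ℝ 1 (A n i) := fun n i =>
    (contDiff_mollify (φ n) (h.integrable_flux i).locallyIntegrable).of_le (by norm_cast)
  have hfcont : ∀ n, Continuous (f n) := fun n => (hfc n).continuous
  have hηc := hη.continuous
  have hηf := hη.continuous_fderiv one_ne_zero
  have hlim : ∀ᵐ z, Tendsto (fun n => f n z) atTop (𝓝 (U z)) :=
    ae_tendsto_mollify hφ hφ2 h.integrable.locallyIntegrable
  have hoff : ∀ z, z ∉ tsupport η → η z = 0 := fun z hz => image_eq_zero_of_notMem_tsupport hz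
  have hoff' : ∀ z, z ∉ tsupport η → fderiv ℝ η z = 0 := fun z hz => by
    by_contra hne
    exact hz (support_fderiv_subset ℝ hne)
  have hΛ : 0 ≤ k - m := by linarith
  -- The lower bound m survives mollification, so all truncations are uniformly bounded on the
  -- support of η. Each power of a truncation is thus a bounded, almost everywhere convergent
  -- multiplier.
  have hv : ∀ n, ∀ z ∈ tsupport η, max (k - f n z) 0 ≤ k - m := fun n z hz => by
    have := h.lower (φ n) z (hφD n z hz)
    exact max_le (by simp only [hf]; linarith) hΛ
  have hSm : MeasurableSet (tsupport η) := (isClosed_tsupport η).measurableSet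
  have hSfin : volume (tsupport η) ≠ ⊤ := hηs.isCompact.measure_lt_top.ne
  obtain ⟨Cη, hCη⟩ := hηs.exists_bound_of_continuous hηc
  have hder : ∀ e, ∃ C, ∀ z, |fderiv ℝ η z e| ≤ C := fun e => by
    obtain ⟨C, hC⟩ := (hηs.fderiv_apply ℝ e).exists_bound_of_continuous
      (by fun_prop : Continuous fun z => fderiv ℝ η z e)
    exact ⟨C, hC⟩
  have bound : ∀ (r : ℕ) (ψ : (Fin N → ℝ) × ℝ → ℝ) (C : ℝ), (∀ z, z ∉ tsupport η → ψ z = 0) →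
      (∀ z, |ψ z| ≤ C) → ∀ n, ∀ z, |max (k - f n z) 0 ^ r * ψ z| ≤ (k - m) ^ r * C := by
    intro r ψ C hψ hC n z
    have hC0 : 0 ≤ C := (abs_nonneg _).trans (hC z)
    by_cases hz : z ∈ tsupport η
    · rw [abs_mul, abs_of_nonneg (by positivity : 0 ≤ max (k - f n z) 0 ^ r)]
      gcongr
      · exact hv n z hz
      · exact hC z
    · rw [hψ z hz, mul_zero, abs_zero]
      positivity
  have limr : ∀ (r : ℕ) (ψ : (Fin N → ℝ) × ℝ → ℝ), ∀ᵐ z,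
      Tendsto (fun n => max (k - f n z) 0 ^ r * ψ z) atTop (𝓝 (max (k - U z) 0 ^ r * ψ z)) := by
    intro r ψ
    filter_upwards [hlim] with z hz
    exact (((hz.const_sub k).max tendsto_const_nhds).pow r).mul_const _
  have hcube : ∀ e, TendstoL1 volume (fun n z => max (k - f n z) 0 ^ 3 * fderiv ℝ η z e)
      (fun z => max (k - U z) 0 ^ 3 * fderiv ℝ η z e) := by
    intro e
    obtain ⟨C, hC⟩ := hder e
    refine TendstoL1.of_bdd hSm hSfin (M := (k - m) ^ 3 * C) (fun n => ?_)
      (fun n => .of_forall ?_) (limr 3 _) (fun n z hz => by simp [hoff' z hz])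
      (fun z hz => by simp [hoff' z hz])
    · have := hfcont n
      exact (by fun_prop : Continuous fun z =>
        max (k - f n z) 0 ^ 3 * fderiv ℝ η z e).aestronglyMeasurable
    · exact bound 3 (fun z => fderiv ℝ η z e) C (fun z hz => by simp [hoff' z hz]) hC n
  have hflux : ∀ i, TendstoL1 volume
      (fun n z => max (k - f n z) 0 ^ 2 * fderiv ℝ η z (Pi.single i 1, 0) * A n i z)
      (fun z => max (k - U z) 0 ^ 2 * fderiv ℝ η z (Pi.single i 1, 0) * flux (p i) (G i z)) := by
    intro i
    obtain ⟨C, hC⟩ := hder (Pi.single i 1, 0)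
    refine (tendstoL1_mollify hφ (h.integrable_flux i)).bdd_mul (M := (k - m) ^ 2 * C)
      (fun n => ?_) (fun n => .of_forall ?_) (limr 2 _)
    · have := hfcont n
      exact (by fun_prop : Continuous fun z =>
        max (k - f n z) 0 ^ 2 * fderiv ℝ η z (Pi.single i 1, 0)).aestronglyMeasurable
    · exact bound 2 (fun z => fderiv ℝ η z _) C (fun z hz => by simp [hoff' z hz]) hC n
  -- The only product of two unbounded factors. The mollified flux converges in the conjugate space
  -- and the mollified gradient in L^{pᵢ}, so their product converges in L¹.
  have hprod : ∀ i, TendstoL1 volume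
      (fun n z => 2 * max (k - f n z) 0 * η z * (A n i z * Γ n i z))
      (fun z => 2 * max (k - U z) 0 * η z * (flux (p i) (G i z) * G i z)) := by
    intro i
    have hconj : (p i).conjExponent.HolderConjugate (p i) :=
      (Real.HolderConjugate.conjExponent (by linarith [hp i])).symm
    refine (tendstoL1_mollify_mul hφ hconj (memLp_flux (hp i) (h.memLp_grad i))
      (h.memLp_grad i)).bdd_mul (M := (k - m) ^ 1 * (2 * Cη)) (fun n => ?_)
      (fun n => .of_forall fun z => ?_) ?_
    · have := hfcont n
      exact (by fun_prop : Continuous fun z =>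
        2 * max (k - f n z) 0 * η z).aestronglyMeasurable
    · have := bound 1 (fun z => 2 * η z) (2 * Cη) (fun z hz => by simp [hoff z hz])
        (fun z => by
          rw [abs_mul, abs_two]
          have := hCη z
          rw [Real.norm_eq_abs] at this
          linarith) n z
      rw [pow_one, ← mul_assoc, mul_comm _ (2 : ℝ)] at this
      exact this
    · filter_upwards [hlim] with z hz
      exact ((((hz.const_sub k).max tendsto_const_nhds)).const_mul 2).mul_const _
  have hgrad : ∀ i, TendstoL1 volume
      (fun n z => 3 * max (k - f n z) 0 ^ 2 * η z * Γ n i z)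
      (fun z => 3 * max (k - U z) 0 ^ 2 * η z * G i z) := by
    intro i
    refine (tendstoL1_mollify hφ (h.integrable_grad i)).bdd_mul (M := (k - m) ^ 2 * (3 * Cη))
      (fun n => ?_) (fun n => .of_forall fun z => ?_) ?_
    · have := hfcont n
      exact (by fun_prop : Continuous fun z =>
        3 * max (k - f n z) 0 ^ 2 * η z).aestronglyMeasurable
    · have := bound 2 (fun z => 3 * η z) (3 * Cη) (fun z hz => by simp [hoff z hz])
        (fun z => by
          rw [abs_mul, abs_of_pos (by norm_num : (0 : ℝ) < 3)]
          have := hCη z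
          rw [Real.norm_eq_abs] at this
          linarith) n z
      rw [← mul_assoc, mul_comm _ (3 : ℝ)] at this
      exact this
    · filter_upwards [hlim] with z hz
      exact ((((hz.const_sub k).max tendsto_const_nhds).pow 2).const_mul 3).mul_const _
  refine ⟨f, fun n => energyDensity k η (f n) (A n) (Γ n), hfc, hlim, fun n t => ?_, ?_,
    fun i => ?_⟩
  · refine (classical_energy hη hηs hη0 (hfc n) (hAc n)
      (fun z hz => h.super (φ n) z (hφD n z hz)) t).trans (le_of_eq ?_)
    congr 1
    funext z
    unfold energyDensity
    congr 1
    refine Finset.sum_congr rfl fun i _ => ?_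
    by_cases hz : z ∈ tsupport η
    · have hg : fderiv ℝ (f n) z (Pi.single i 1, 0) = Γ n i z := h.grad_eq (φ n) z (hφD n z hz) i
      simp only [hg]
    · simp [hoff z hz]
  · unfold energyDensity
    refine TendstoL1.add ?_ (TendstoL1.sum _ fun i _ => (hflux i).sub (hprod i))
    have := (hcube (0, 1)).const_mul (1 / 3)
    refine cast ?_ this
    congr 1
    · funext n z
      ring
    · funext z
      ring
  · refine cast ?_ ((hcube (Pi.single i 1, 0)).sub (hgrad i))
    congr 1
    funext n z
    have hd := fderiv_max_sub_pow_mul k 1 ((hfc n).differentiable one_ne_zero z)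
      (hη.differentiable one_ne_zero z) (Pi.single i 1, 0)
    norm_num at hd
    rw [hd]
    by_cases hz : z ∈ tsupport η
    · have hg : fderiv ℝ (f n) z (Pi.single i 1, 0) = Γ n i z := h.grad_eq (φ n) z (hφD n z hz) i
      rw [hg]
      ring
    · simp [hoff z hz]

/-- The parabolic embedding combined with the energy inequality: the integrand `energyDensity`
controls the `L^{1 + 1/N}` norm of the truncation. -/
theorem MollifiedSuper.parabolic_estimate (h : MollifiedSuper p U G m D) (hp : ∀ i, 2 < p i)
    (hN : 1 < N) (hD : IsOpen D) {η : (Fin N → ℝ) × ℝ → ℝ} (hη : ContDiff ℝ 1 η)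
    (hηs : HasCompactSupport η) (hηD : tsupport η ⊆ D) (hη0 : ∀ z, 0 ≤ η z) {k : ℝ} (hk : m ≤ k)
    {W : Fin N → ℝ} (hW : ∀ i, 0 < W i) {s : ℝ} {B : (Fin N → ℝ) × ℝ → ℝ}
    (hB : IntegrableOn B (univ ×ˢ Iic s)) (hB0 : ∀ z, 0 ≤ B z)
    (hJB : ∀ᵐ z ∂(volume.restrict (univ ×ˢ Iic s)),
      energyDensity k η U (fun i z => flux (p i) (G i z)) G z ≤ B z) :
    IntegrableOn (energyDensity k η U (fun i z => flux (p i) (G i z)) G) (univ ×ˢ Iic s) ∧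
    0 ≤ ∫ z in univ ×ˢ Iic s, energyDensity k η U (fun i z => flux (p i) (G i z)) G z ∧
    ENNReal.ofReal (∏ i, W i) ^ (1 / (N : ℝ)) *
        ∫⁻ z in univ ×ˢ Iic s, ‖max (k - U z) 0 ^ 3 * η z‖ₑ ^ (1 + 1 / (N : ℝ)) ≤
      ENNReal.ofReal (3 * ∫ z in univ ×ˢ Iic s, B z) ^ (1 / (N : ℝ)) *
        ENNReal.ofReal (∫ z in univ ×ˢ Iic s, ∑ i, W i *
          |max (k - U z) 0 ^ 3 * fderiv ℝ η z (Pi.single i 1, 0) -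
            3 * max (k - U z) 0 ^ 2 * η z * G i z|) := by
  obtain ⟨f, J, hfc, hlim, hen, hJ, hder⟩ := h.exists_approximation hp hD hη hηs hηD hη0 hk
  set J₀ := energyDensity k η U (fun i z => flux (p i) (G i z)) G with hJ₀
  set e : ℕ → ℝ := fun n => (eLpNorm (fun x => J n x - J₀ x) 1 volume).toReal with he
  have hpos : ∀ n t, 0 ≤ ∫ x, max (k - f n (x, t)) 0 ^ 3 / 3 * η (x, t) := fun n t =>
    integral_nonneg fun x => mul_nonneg (by positivity) (hη0 _)
  refine ⟨hJ.2.integrableOn, ?_, ?_⟩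
  -- The slice integrals at time s are nonnegative, hence so is the limit of their upper bounds.
  -- This sign later allows the energy density to be dropped when the gradient term is estimated.
  · exact ge_of_tendsto (hJ.tendsto_setIntegral (univ ×ˢ Iic s)) (Eventually.of_forall fun n : ℕ => (hpos n s).trans (hen n s))
  set β := ∫ z in univ ×ˢ Iic s, B z with hβ
  have hβ0 : 0 ≤ β := integral_nonneg fun z => hB0 z
  -- The energy density has no sign, so it is first replaced by its majorant B ≥ 0. Only then can
  -- the strip up to t be enlarged to the strip up to s, which makes the bound uniform in t.
  have hbd : ∀ n, ∀ t ∈ Iic s, ∫ x, max (k - f n (x, t)) 0 ^ 3 / 3 * η (x, t) ≤ β + e n := by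
    intro n t ht
    have hsub : (univ : Set (Fin N → ℝ)) ×ˢ Iic t ⊆ univ ×ˢ Iic s :=
      prod_mono Subset.rfl (Iic_subset_Iic.2 (mem_Iic.1 ht))
    calc _ ≤ ∫ z in univ ×ˢ Iic t, J n z := hen n t
      _ ≤ (∫ z in univ ×ˢ Iic t, J₀ z) + e n := hJ.setIntegral_le n _
      _ ≤ (∫ z in univ ×ˢ Iic t, B z) + e n := by
        have := setIntegral_mono_ae_restrict hJ.2.integrableOn (hB.mono_set hsub)
          (ae_restrict_of_ae_restrict_of_subset hsub hJB)
        linarith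
      _ ≤ β + e n := by
        have := setIntegral_mono_set hB (.of_forall hB0) hsub.eventuallyLE
        linarith
  set w : ℕ → (Fin N → ℝ) × ℝ → ℝ := fun n z => max (k - f n z) 0 ^ 3 * η z with hw
  have hwc : ∀ n, ContDiff ℝ 1 (w n) := fun n => ((contDiff_max_sub_pow k 1).comp (hfc n)).mul hη
  have hws : ∀ n, HasCompactSupport (w n) := fun n => hηs.mul_left
  set Dn : ℕ → ℝ := fun n => ∫ z in univ ×ˢ Iic s, ∑ i, W i *
    |fderiv ℝ (w n) z (Pi.single i 1, 0)| with hDn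
  have hDL : TendstoL1 volume (fun n z => ∑ i, W i * |fderiv ℝ (w n) z (Pi.single i 1, 0)|)
      (fun z => ∑ i, W i * |max (k - U z) 0 ^ 3 * fderiv ℝ η z (Pi.single i 1, 0) -
            3 * max (k - U z) 0 ^ 2 * η z * G i z|) :=
    TendstoL1.sum _ fun i _ => (hder i).abs.const_mul (W i)
  have hemb : ∀ n, ENNReal.ofReal (∏ i, W i) ^ (1 / (N : ℝ)) *
        ∫⁻ z in univ ×ˢ Iic s, ‖w n z‖ₑ ^ (1 + 1 / (N : ℝ)) ≤
      ENNReal.ofReal (3 * (β + e n)) ^ (1 / (N : ℝ)) * ENNReal.ofReal (Dn n) := by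
    intro n
    refine (parabolic_embedding hN hW (hwc n) (hws n) measurableSet_Iic
      (M := ENNReal.ofReal (3 * (β + e n))) fun t ht => ?_).trans (le_of_eq ?_)
    · have hc : Continuous fun x => w n (x, t) := by
        have := (hwc n).continuous
        fun_prop
      have hi : Integrable fun x => w n (x, t) :=
        hc.integrable_of_hasCompactSupport (hasCompactSupport_slice (hws n) t)
      have hw0 : ∀ x, 0 ≤ w n (x, t) := fun x => mul_nonneg (by positivity) (hη0 _)
      have h1 : ∫⁻ x, ‖w n (x, t)‖ₑ = ENNReal.ofReal (∫ x, w n (x, t)) := by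
        rw [ofReal_integral_eq_lintegral_ofReal hi (.of_forall hw0)]
        exact lintegral_congr fun x => Real.enorm_eq_ofReal (hw0 x)
      rw [h1]
      refine ENNReal.ofReal_le_ofReal ?_
      have h2 : ∫ x, w n (x, t) = 3 * ∫ x, max (k - f n (x, t)) 0 ^ 3 / 3 * η (x, t) := by
        rw [← integral_const_mul]
        congr 1
        funext x
        simp only [hw]
        ring
      rw [h2]
      have := hbd n t ht
      linarith
    · congr 1
      rw [hDn, ofReal_integral_eq_lintegral_ofReal (hDL.1 n).integrableOn]
      exact .of_forall fun z => Finset.sum_nonneg fun i _ => mul_nonneg (hW i).le (abs_nonneg _)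
  have hNpos : (0 : ℝ) < 1 / N := by positivity
  have hR : Tendsto (fun n => ENNReal.ofReal (3 * (β + e n)) ^ (1 / (N : ℝ)) *
      ENNReal.ofReal (Dn n)) atTop (𝓝 (ENNReal.ofReal (3 * β) ^ (1 / (N : ℝ)) *
        ENNReal.ofReal (∫ z in univ ×ˢ Iic s, ∑ i, W i *
          |max (k - U z) 0 ^ 3 * fderiv ℝ η z (Pi.single i 1, 0) -
            3 * max (k - U z) 0 ^ 2 * η z * G i z|))) := by
    have h1 : Tendsto (fun n => 3 * (β + e n)) atTop (𝓝 (3 * β)) := by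
      have := (hJ.tendsto_toReal.const_add β).const_mul 3
      rwa [add_zero] at this
    refine ENNReal.Tendsto.mul ((ENNReal.continuous_rpow_const.tendsto _).comp
      (ENNReal.tendsto_ofReal h1)) (Or.inr ENNReal.ofReal_ne_top)
      (ENNReal.tendsto_ofReal (hDL.tendsto_setIntegral _)) (Or.inr ?_)
    exact ENNReal.rpow_ne_top_of_nonneg hNpos.le ENNReal.ofReal_ne_top
  -- Almost everywhere convergence and Fatou's lemma suffice on the left, since only an upper bound
  -- for the limit is wanted.
  have hfatou : ∫⁻ z in univ ×ˢ Iic s, ‖max (k - U z) 0 ^ 3 * η z‖ₑ ^ (1 + 1 / (N : ℝ)) ≤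
      liminf (fun n => ∫⁻ z in univ ×ˢ Iic s, ‖w n z‖ₑ ^ (1 + 1 / (N : ℝ))) atTop := by
    refine le_trans (le_of_eq ?_) (lintegral_liminf_le fun n =>
      (hwc n).continuous.measurable.enorm.pow_const _)
    refine lintegral_congr_ae ?_
    filter_upwards [ae_restrict_of_ae hlim] with z hz
    have h1 : Tendsto (fun n => w n z) atTop (𝓝 (max (k - U z) 0 ^ 3 * η z)) :=
      (((hz.const_sub k).max tendsto_const_nhds).pow 3).mul_const _
    exact (((ENNReal.continuous_rpow_const.tendsto _).comp h1.enorm).liminf_eq).symm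
  calc _ ≤ ENNReal.ofReal (∏ i, W i) ^ (1 / (N : ℝ)) *
        liminf (fun n => ∫⁻ z in univ ×ˢ Iic s, ‖w n z‖ₑ ^ (1 + 1 / (N : ℝ))) atTop := by gcongr
    _ ≤ liminf (fun n => ENNReal.ofReal (∏ i, W i) ^ (1 / (N : ℝ)) *
        ∫⁻ z in univ ×ˢ Iic s, ‖w n z‖ₑ ^ (1 + 1 / (N : ℝ))) atTop := by
      rw [ENNReal.liminf_const_mul_of_ne_top]
      exact ENNReal.rpow_ne_top_of_nonneg hNpos.le ENNReal.ofReal_ne_top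
    _ ≤ liminf (fun n => ENNReal.ofReal (3 * (β + e n)) ^ (1 / (N : ℝ)) *
          ENNReal.ofReal (Dn n)) atTop := liminf_le_liminf (.of_forall hemb)
    _ = _ := hR.liminf_eq

end Limit

end AnisoParabolic

namespace AnisoParabolic

open scoped ENNReal NNReal ContDiff

/-! ### Pointwise absorption and one step of the iteration -/

section OneStep

/-- Young's inequality without sharp constants: the product is at most the q-th power of the larger
of a and c. -/
theorem mul_rpow_sub_one_le {a c q : ℝ} (ha : 0 ≤ a) (hc : 0 ≤ c) (hq : 1 < q) :
    c * a ^ (q - 1) ≤ a ^ q + c ^ q := by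
  have hq1 : q - 1 + 1 = q := by ring
  have hsplit : ∀ x : ℝ, 0 ≤ x → x ^ (q - 1) * x = x ^ q := fun x hx => by
    conv_lhs => enter [2]; rw [← Real.rpow_one x]
    rw [← Real.rpow_add_of_nonneg hx (by linarith) zero_le_one, hq1]
  rcases le_total c a with h | h
  · calc c * a ^ (q - 1) ≤ a * a ^ (q - 1) := by gcongr
      _ = a ^ q := by rw [mul_comm, hsplit a ha]
      _ ≤ _ := by have := Real.rpow_nonneg hc q; linarith
  · calc c * a ^ (q - 1) ≤ c * c ^ (q - 1) := by
          have := Real.rpow_le_rpow ha h (by linarith : 0 ≤ q - 1)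
          gcongr
      _ = c ^ q := by rw [mul_comm, hsplit c hc]
      _ ≤ _ := by have := Real.rpow_nonneg ha q; linarith

/-- Absorption of the cross term in the energy inequality. -/
theorem cross_term_le {q : ℝ} (hq : 2 < q) {M : ℕ} (hM : q ≤ M) {v ζ d g : ℝ} (hv : 0 ≤ v)
    (hζ : 0 ≤ ζ) (hζ1 : ζ ≤ 1) :
    v ^ 2 * (M * ζ ^ (M - 1) * d) * flux q g - 2 * v * ζ ^ M * (flux q g * g) +
      v * ζ ^ M * |g| ^ q ≤ v * (v * M * |d|) ^ q := by
  have hM2 : 2 < (M : ℝ) := hq.trans_le hM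
  have hMN : 2 < M := by exact_mod_cast hM2
  rw [flux_mul_self hq]
  suffices h : v ^ 2 * (M * ζ ^ (M - 1) * d) * flux q g ≤
      v * ζ ^ M * |g| ^ q + v * (v * M * |d|) ^ q by linarith
  rcases hζ.eq_or_lt with h0 | h0
  · rw [← h0, zero_pow (by omega), zero_pow (by omega)]
    simp only [mul_zero, zero_mul, zero_add]
    positivity
  set c := v * M * |d| with hc
  have hc0 : 0 ≤ c := by positivity
  have hy := mul_rpow_sub_one_le (a := |g| * ζ) (c := c) (q := q) (by positivity) hc0 (by linarith)
  -- Young's inequality is applied to |g|ζ and multiplied by ζ^{M - q}, so that the powers of ζ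
  -- match those in the cross term and in the good term. The assumption q ≤ M keeps this factor at
  -- most one, so one integer M serves all exponents.
  have e1 : (|g| * ζ) ^ (q - 1) * ζ ^ ((M : ℝ) - q) = |g| ^ (q - 1) * ζ ^ (M - 1) := by
    rw [Real.mul_rpow (abs_nonneg _) hζ, mul_assoc, ← Real.rpow_add h0, ← Real.rpow_natCast ζ (M - 1)]
    congr 2
    rw [Nat.cast_sub (by omega)]
    push_cast
    ring
  have e2 : (|g| * ζ) ^ q * ζ ^ ((M : ℝ) - q) = |g| ^ q * ζ ^ M := by
    rw [Real.mul_rpow (abs_nonneg _) hζ, mul_assoc, ← Real.rpow_add h0, ← Real.rpow_natCast ζ M]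
    congr 2
    ring
  have hpow0 : 0 ≤ ζ ^ ((M : ℝ) - q) := by positivity
  have hpow1 : ζ ^ ((M : ℝ) - q) ≤ 1 := Real.rpow_le_one hζ hζ1 (by linarith)
  calc v ^ 2 * (M * ζ ^ (M - 1) * d) * flux q g
      ≤ |v ^ 2 * (M * ζ ^ (M - 1) * d) * flux q g| := le_abs_self _
    _ = v * (c * ((|g| * ζ) ^ (q - 1) * ζ ^ ((M : ℝ) - q))) := by
      rw [e1, abs_mul, abs_flux hq, abs_mul, abs_mul, abs_of_nonneg (by positivity : 0 ≤ v ^ 2),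
        abs_of_nonneg (by positivity : 0 ≤ (M : ℝ) * ζ ^ (M - 1)), hc]
      ring
    _ = v * ((c * (|g| * ζ) ^ (q - 1)) * ζ ^ ((M : ℝ) - q)) := by ring
    _ ≤ v * (((|g| * ζ) ^ q + c ^ q) * ζ ^ ((M : ℝ) - q)) := by gcongr
    _ = v * ζ ^ M * |g| ^ q + v * (c ^ q * ζ ^ ((M : ℝ) - q)) := by
      rw [add_mul, e2]
      ring
    _ ≤ v * ζ ^ M * |g| ^ q + v * (c ^ q * 1) := by gcongr
    _ = _ := by rw [mul_one]

/-- The constant in the energy inequality. -/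
noncomputable def energyConst {N : ℕ} (p : Fin N → ℝ) (θ Λ : ℝ) (M : ℕ) : ℝ :=
  Λ ^ 3 * M + ∑ i, Λ * (Λ * M) ^ p i / θ ^ (p i - 2)

/-- The constant in the gradient bound. -/
noncomputable def gradConst {N : ℕ} (p : Fin N → ℝ) (θ Λ : ℝ) (M : ℕ) : ℝ :=
  (∑ _i : Fin N, (Λ ^ 3 * M + 3 * Λ ^ 2)) +
    3 * Λ * (∑ i, θ ^ (p i - 2)) * energyConst p θ Λ M

theorem energyConst_nonneg {N : ℕ} (p : Fin N → ℝ) {θ Λ : ℝ} (hθ : 0 < θ) (hΛ : 0 < Λ) (M : ℕ) :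
    0 ≤ energyConst p θ Λ M := by
  unfold energyConst
  have : 0 ≤ ∑ i, Λ * (Λ * M) ^ p i / θ ^ (p i - 2) :=
    Finset.sum_nonneg fun i _ => by positivity
  positivity

theorem gradConst_nonneg {N : ℕ} (p : Fin N → ℝ) {θ Λ : ℝ} (hθ : 0 < θ) (hΛ : 0 < Λ) (M : ℕ) :
    0 ≤ gradConst p θ Λ M := by
  unfold gradConst
  have h1 : 0 ≤ ∑ i, θ ^ (p i - 2) := Finset.sum_nonneg fun i _ => by positivity
  have h2 : 0 ≤ ∑ _i : Fin N, (Λ ^ 3 * (M : ℝ) + 3 * Λ ^ 2) :=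
    Finset.sum_nonneg fun i _ => by positivity
  have h3 := energyConst_nonneg p hθ hΛ M
  positivity

variable {N : ℕ} {p : Fin N → ℝ} {U : (Fin N → ℝ) × ℝ → ℝ} {G : Fin N → (Fin N → ℝ) × ℝ → ℝ}
  {m : ℝ} {D : Set ((Fin N → ℝ) × ℝ)}

/-- A cutoff function between space-time sets, with its quantitative bounds. -/
structure IsCutoff (W : Fin N → ℝ) (R s κ : ℝ) (D Q Q' : Set ((Fin N → ℝ) × ℝ))
    (ζ : (Fin N → ℝ) × ℝ → ℝ) : Prop where
  contDiff : ContDiff ℝ 1 ζ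
  compact : HasCompactSupport ζ
  tsupport_subset : tsupport ζ ⊆ D
  tsupport_subset' : ∀ z ∈ tsupport ζ, z.2 ≤ s → z ∈ Q
  nonneg : ∀ z, 0 ≤ ζ z
  le_one : ∀ z, ζ z ≤ 1
  eq_one : ∀ z ∈ Q', ζ z = 1
  subset_strip : ∀ z ∈ Q', z.2 ≤ s
  fderiv_space : ∀ z i, |fderiv ℝ ζ z (Pi.single i 1, 0)| ≤ κ / W i
  fderiv_time : ∀ z, |fderiv ℝ ζ z (0, 1)| ≤ κ / R

/-- The diffusion term supplies 2vζ^M|∂ᵢu|^{pᵢ}: one copy absorbs the cross term and the other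
remains on the left. By the relation between Wᵢ and R, (κ/Wᵢ)^{pᵢ} is κ^{pᵢ}/(θ^{pᵢ-2}R), so every
direction scales like the time term. -/
theorem energyDensity_add_le (hp : ∀ i, 2 < p i) {M : ℕ} (hM : ∀ i, p i ≤ M)
    {W : Fin N → ℝ} (hW : ∀ i, 0 < W i) {R θ Λ κ s : ℝ} (hR : 0 < R) (hθ : 0 < θ) (hΛ : 0 < Λ)
    (hκ : 1 ≤ κ) (hM0 : 0 < M) (hWR : ∀ i, W i ^ p i = θ ^ (p i - 2) * R) {Q Q' : Set _}
    {ζ : (Fin N → ℝ) × ℝ → ℝ} (hζ : IsCutoff W R s κ D Q Q' ζ) {k : ℝ} {z : (Fin N → ℝ) × ℝ}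
    (hv : max (k - U z) 0 ≤ Λ) :
    energyDensity k (fun z => ζ z ^ M) U (fun i z => flux (p i) (G i z)) G z +
        ∑ i, max (k - U z) 0 * ζ z ^ M * |G i z| ^ p i ≤ energyConst p θ Λ M * κ ^ M / R := by
  set v := max (k - U z) 0 with hvdef
  have hv0 : 0 ≤ v := le_max_right _ _
  have hζ0 := hζ.nonneg z
  have hζ1 := hζ.le_one z
  have hκ0 : 0 < κ := by linarith
  have hd : ∀ e, fderiv ℝ (fun z => ζ z ^ M) z e = M * ζ z ^ (M - 1) * fderiv ℝ ζ z e := by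
    intro e
    rw [((hζ.contDiff.differentiable one_ne_zero z).hasFDerivAt.pow M).fderiv]
    simp
  have hκM : κ ≤ κ ^ M := le_self_pow₀ hκ hM0.ne'
  have hone : ζ z ^ (M - 1) ≤ 1 := pow_le_one₀ hζ0 hζ1
  unfold energyDensity
  simp only [hd, ← hvdef]
  have htime : v ^ 3 / 3 * (M * ζ z ^ (M - 1) * fderiv ℝ ζ z (0, 1)) ≤ Λ ^ 3 * M * κ ^ M / R := by
    have h1 := (le_abs_self _).trans (hζ.fderiv_time z)
    calc v ^ 3 / 3 * (M * ζ z ^ (M - 1) * fderiv ℝ ζ z (0, 1))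
        ≤ v ^ 3 / 3 * (M * ζ z ^ (M - 1) * (κ / R)) := by gcongr
      _ ≤ Λ ^ 3 / 1 * (M * 1 * (κ ^ M / R)) := by
        gcongr
        norm_num
      _ = _ := by ring
  have hspace : ∀ i, v ^ 2 * (M * ζ z ^ (M - 1) * fderiv ℝ ζ z (Pi.single i 1, 0)) *
        flux (p i) (G i z) - 2 * v * ζ z ^ M * (flux (p i) (G i z) * G i z) +
        v * ζ z ^ M * |G i z| ^ p i ≤ Λ * (Λ * M) ^ p i / θ ^ (p i - 2) * κ ^ M / R := by
    intro i
    have hp0 : 0 ≤ p i := by linarith [hp i]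
    refine (cross_term_le (hp i) (hM i) hv0 hζ0 hζ1).trans ?_
    have hκp : κ ^ p i ≤ κ ^ M := by
      rw [← Real.rpow_natCast]
      exact Real.rpow_le_rpow_of_exponent_le hκ (hM i)
    calc v * (v * M * |fderiv ℝ ζ z (Pi.single i 1, 0)|) ^ p i
        ≤ Λ * (Λ * M * (κ / W i)) ^ p i := by
          have := hζ.fderiv_space z i
          gcongr
      _ = Λ * (Λ * M) ^ p i / θ ^ (p i - 2) * κ ^ p i / R := by
          rw [Real.mul_rpow (by positivity) (div_nonneg hκ0.le (hW i).le),
            Real.div_rpow hκ0.le (hW i).le, hWR i]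
          field_simp
      _ ≤ _ := by gcongr
  have hsum := Finset.sum_le_sum fun i (_ : i ∈ Finset.univ) => hspace i
  rw [Finset.sum_add_distrib] at hsum
  have e : energyConst p θ Λ M * κ ^ M / R = Λ ^ 3 * M * κ ^ M / R +
      ∑ i, Λ * (Λ * M) ^ p i / θ ^ (p i - 2) * κ ^ M / R := by
    unfold energyConst
    rw [add_mul, add_div, Finset.sum_mul, Finset.sum_div]
  rw [e]
  linarith

/-- Since x ≤ 1 + x^{pᵢ} for x = Wᵢ|∂ᵢu|, the term v²Wᵢ|∂ᵢu| is bounded by a constant plus R times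
the good term of the energy inequality; one factor v is kept and the other is bounded by Λ. -/
theorem weighted_gradient_le (hp : ∀ i, 2 < p i) {M : ℕ}
    {W : Fin N → ℝ} (hW : ∀ i, 0 < W i) {R θ Λ κ s : ℝ} (hR : 0 < R) (hθ : 0 < θ) (hΛ : 0 < Λ)
    (hκ : 1 ≤ κ) (hM0 : 0 < M) (hWR : ∀ i, W i ^ p i = θ ^ (p i - 2) * R) {Q Q' : Set _}
    {ζ : (Fin N → ℝ) × ℝ → ℝ} (hζ : IsCutoff W R s κ D Q Q' ζ) {k : ℝ} {z : (Fin N → ℝ) × ℝ}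
    (hv : max (k - U z) 0 ≤ Λ) :
    ∑ i, W i * |max (k - U z) 0 ^ 3 * fderiv ℝ (fun z => ζ z ^ M) z (Pi.single i 1, 0) -
            3 * max (k - U z) 0 ^ 2 * ζ z ^ M * G i z| ≤
      (∑ _i : Fin N, (Λ ^ 3 * M + 3 * Λ ^ 2)) * κ ^ M + 3 * Λ * (∑ i, θ ^ (p i - 2)) * R *
        ∑ i, max (k - U z) 0 * ζ z ^ M * |G i z| ^ p i := by
  set v := max (k - U z) 0 with hvdef
  have hv0 : 0 ≤ v := le_max_right _ _
  have hζ0 := hζ.nonneg z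
  have hζ1 := hζ.le_one z
  have hκ0 : 0 < κ := by linarith
  have hd : ∀ e, fderiv ℝ (fun z => ζ z ^ M) z e = M * ζ z ^ (M - 1) * fderiv ℝ ζ z e := by
    intro e
    rw [((hζ.contDiff.differentiable one_ne_zero z).hasFDerivAt.pow M).fderiv]
    simp
  have hκM : κ ≤ κ ^ M := le_self_pow₀ hκ hM0.ne'
  have hκ1 : 1 ≤ κ ^ M := one_le_pow₀ hκ
  have hone : ζ z ^ (M - 1) ≤ 1 := pow_le_one₀ hζ0 hζ1
  have hone' : ζ z ^ M ≤ 1 := pow_le_one₀ hζ0 hζ1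
  have hterm : ∀ i, W i * |v ^ 3 * fderiv ℝ (fun z => ζ z ^ M) z (Pi.single i 1, 0) -
            3 * v ^ 2 * ζ z ^ M * G i z| ≤ (Λ ^ 3 * M + 3 * Λ ^ 2) * κ ^ M +
        3 * Λ * (∑ i, θ ^ (p i - 2)) * R * (v * ζ z ^ M * |G i z| ^ p i) := by
    intro i
    have hWi := hW i
    rw [hd]
    have h1 : W i * |v ^ 3 * (M * ζ z ^ (M - 1) * fderiv ℝ ζ z (Pi.single i 1, 0))| ≤
        Λ ^ 3 * M * κ ^ M := by
      rw [abs_mul, abs_mul, abs_of_nonneg (by positivity : 0 ≤ v ^ 3),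
        abs_of_nonneg (by positivity : 0 ≤ (M : ℝ) * ζ z ^ (M - 1))]
      have := hζ.fderiv_space z i
      calc _ ≤ W i * (Λ ^ 3 * (M * 1 * (κ / W i))) := by gcongr
        _ = Λ ^ 3 * M * κ := by field_simp
        _ ≤ _ := by gcongr
    have h2 : W i * |G i z| ≤ 1 + θ ^ (p i - 2) * R * |G i z| ^ p i := by
      rw [← hWR i, ← Real.mul_rpow hWi.le (abs_nonneg _)]
      set x := W i * |G i z|
      have hx : 0 ≤ x := by positivity
      rcases le_total x 1 with h | h
      · have := Real.rpow_nonneg hx (p i)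
        linarith
      · have := Real.self_le_rpow_of_one_le h (by linarith [hp i] : 1 ≤ p i)
        linarith
    have h3 : θ ^ (p i - 2) ≤ ∑ i, θ ^ (p i - 2) :=
      Finset.single_le_sum (f := fun i => θ ^ (p i - 2)) (fun j _ => by positivity)
        (Finset.mem_univ i)
    have h4 : W i * |3 * v ^ 2 * ζ z ^ M * G i z| ≤ 3 * Λ ^ 2 * κ ^ M +
        3 * Λ * (∑ i, θ ^ (p i - 2)) * R * (v * ζ z ^ M * |G i z| ^ p i) := by
      rw [abs_mul, abs_of_nonneg (by positivity : 0 ≤ 3 * v ^ 2 * ζ z ^ M)]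
      calc W i * (3 * v ^ 2 * ζ z ^ M * |G i z|) = 3 * v * (v * ζ z ^ M) * (W i * |G i z|) := by ring
        _ ≤ 3 * Λ * (v * ζ z ^ M) * (1 + θ ^ (p i - 2) * R * |G i z| ^ p i) := by gcongr
        _ = 3 * Λ * (v * ζ z ^ M) + 3 * Λ * θ ^ (p i - 2) * R * (v * ζ z ^ M * |G i z| ^ p i) := by
          ring
        _ ≤ 3 * Λ * (Λ * 1) * κ ^ M +
            3 * Λ * (∑ i, θ ^ (p i - 2)) * R * (v * ζ z ^ M * |G i z| ^ p i) := by
          refine add_le_add ?_ (by gcongr)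
          calc 3 * Λ * (v * ζ z ^ M) ≤ 3 * Λ * (Λ * 1) := by gcongr
            _ ≤ 3 * Λ * (Λ * 1) * κ ^ M := le_mul_of_one_le_right (by positivity) hκ1
        _ = _ := by ring
    have h5 := mul_le_mul_of_nonneg_left
      (abs_sub (v ^ 3 * (M * ζ z ^ (M - 1) * fderiv ℝ ζ z (Pi.single i 1, 0)))
        (3 * v ^ 2 * ζ z ^ M * G i z)) hWi.le
    rw [mul_add] at h5
    linarith
  refine (Finset.sum_le_sum fun i _ => hterm i).trans (le_of_eq ?_)
  rw [Finset.sum_add_distrib, ← Finset.sum_mul, ← Finset.mul_sum]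

/-- One step of the De Giorgi iteration. -/
theorem MollifiedSuper.one_step (h : MollifiedSuper p U G m D) (hp : ∀ i, 2 < p i) (hN : 1 < N)
    (hD : IsOpen D) {M : ℕ} (hM : ∀ i, p i ≤ M) {W : Fin N → ℝ} (hW : ∀ i, 0 < W i)
    {R θ Λ κ s : ℝ} (hR : 0 < R) (hθ : 0 < θ) (hΛ : 0 < Λ) (hκ : 1 ≤ κ)
    (hWR : ∀ i, W i ^ p i = θ ^ (p i - 2) * R) {Q Q' : Set ((Fin N → ℝ) × ℝ)}
    (hQ : volume Q ≠ ⊤) {ζ : (Fin N → ℝ) × ℝ → ℝ} (hζ : IsCutoff W R s κ D Q Q' ζ) {k d : ℝ}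
    (hmk : m ≤ k) (hkΛ : k - m ≤ Λ) (hd : 0 ≤ d) :
    (R * ∏ i, W i) ^ (1 / (N : ℝ)) * (d ^ 3) ^ (1 + 1 / (N : ℝ)) *
        (volume ({z | U z < k - d} ∩ Q')).toReal ≤
      (3 * energyConst p θ Λ M) ^ (1 / (N : ℝ)) * gradConst p θ Λ M * κ ^ (2 * M) *
        (volume ({z | U z < k} ∩ Q)).toReal ^ (1 + 1 / (N : ℝ)) := by
  have hM0 : 0 < M := by
    have : (2 : ℝ) < M := (hp ⟨0, by omega⟩).trans_le (hM _)
    have : (0 : ℝ) < M := by linarith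
    exact_mod_cast this
  have hκ0 : 0 < κ := by linarith
  have hN0 : (0 : ℝ) < N := by exact_mod_cast (by omega : 0 < N)
  set A := {z | U z < k} ∩ Q with hA
  set α := (volume A).toReal with hα
  have hAfin : volume A ≠ ⊤ := measure_ne_top_of_subset inter_subset_right hQ
  -- Neither U nor Q is assumed Borel measurable, so indicators are taken on a measurable hull of
  -- the same measure.
  set A₁ := toMeasurable volume A with hA₁
  have hA₁m : MeasurableSet A₁ := measurableSet_toMeasurable _ _
  have hA₁fin : volume A₁ ≠ ⊤ := by rwa [hA₁, measure_toMeasurable]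
  set S : Set ((Fin N → ℝ) × ℝ) := univ ×ˢ Iic s with hS
  have hSm : MeasurableSet S := MeasurableSet.univ.prod measurableSet_Iic
  have hC1 := energyConst_nonneg p hθ hΛ M
  have hC2 := gradConst_nonneg p hθ hΛ M
  set b := energyConst p θ Λ M * κ ^ M / R with hb
  have hb0 : 0 ≤ b := by positivity
  set η : (Fin N → ℝ) × ℝ → ℝ := fun z => ζ z ^ M with hη
  set v : (Fin N → ℝ) × ℝ → ℝ := fun z => max (k - U z) 0 with hv
  set F : (Fin N → ℝ) × ℝ → ℝ := fun z => ∑ i, v z * η z * |G i z| ^ p i with hF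
  set J := energyDensity k η U (fun i z => flux (p i) (G i z)) G with hJ
  set grad : (Fin N → ℝ) × ℝ → ℝ := fun z => ∑ i, W i *
    |v z ^ 3 * fderiv ℝ η z (Pi.single i 1, 0) - 3 * v z ^ 2 * η z * G i z| with hgrad
  have hind : ∀ c : ℝ, IntegrableOn (A₁.indicator fun _ => c) S := fun c =>
    ((integrable_indicator_iff hA₁m).2 (integrableOn_const hA₁fin)).integrableOn
  have hindint : ∀ c : ℝ, 0 ≤ c → ∫ z in S, A₁.indicator (fun _ => c) z ≤ c * α := by
    intro c hc
    have hi : Integrable (A₁.indicator fun _ => c) :=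
      (integrable_indicator_iff hA₁m).2 (integrableOn_const hA₁fin)
    refine (setIntegral_le_integral hi (.of_forall fun z => indicator_nonneg (fun _ _ => hc) z)).trans
      (le_of_eq ?_)
    rw [integral_indicator_const _ hA₁m, smul_eq_mul, mul_comm, Measure.real, hA₁,
      measure_toMeasurable]
  have hηc : ContDiff ℝ 1 η := hζ.contDiff.pow M
  have hηt : tsupport η ⊆ tsupport ζ := by
    refine closure_mono fun z hz => ?_
    intro h0
    exact hz (by simp [hη, h0, hM0.ne'])
  have hηs : HasCompactSupport η := hζ.compact.of_isClosed_subset (isClosed_tsupport η) hηt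
  have hη0 : ∀ z, 0 ≤ η z := fun z => pow_nonneg (hζ.nonneg z) M
  have hη1 : ∀ z, η z ≤ 1 := fun z => pow_le_one₀ (hζ.nonneg z) (hζ.le_one z)
  have hv0 : ∀ z, 0 ≤ v z := fun z => le_max_right _ _
  have hoff : ∀ z, z ∉ tsupport η → η z = 0 := fun z hz => image_eq_zero_of_notMem_tsupport hz
  have hoff' : ∀ z, z ∉ tsupport η → fderiv ℝ η z = 0 := fun z hz => by
    by_contra hne
    exact hz (support_fderiv_subset ℝ hne)
  have hlow : ∀ᵐ z, z ∈ tsupport η → v z ≤ Λ := by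
    filter_upwards [(ae_restrict_iff' hD.measurableSet).1 h.lower_ae] with z hz hzs
    have := hz (hζ.tsupport_subset (hηt hzs))
    exact max_le (by linarith) hΛ.le
  -- All densities vanish where v = 0 or off the support of η. What remains before time s lies in A,
  -- where the pointwise bounds with v ≤ Λ apply.
  have hcases : ∀ᵐ z ∂(volume.restrict S), (J z = 0 ∧ F z = 0 ∧ grad z = 0) ∨
      (z ∈ A₁ ∧ v z ≤ Λ) := by
    filter_upwards [ae_restrict_of_ae hlow, ae_restrict_mem hSm] with z hz hzS
    by_cases hzt : z ∈ tsupport η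
    · by_cases hUk : U z < k
      · exact Or.inr ⟨subset_toMeasurable _ _ ⟨hUk, hζ.tsupport_subset' z (hηt hzt) hzS.2⟩, hz hzt⟩
      · left
        have hvz : v z = 0 := max_eq_right (by linarith)
        have hvz' : max (k - U z) 0 = 0 := hvz
        refine ⟨?_, ?_, ?_⟩
        · simp [hJ, energyDensity, hvz']
        · simp [hF, hvz]
        · simp [hgrad, hvz]
    · left
      refine ⟨?_, ?_, ?_⟩
      · simp [hJ, energyDensity, hoff z hzt, hoff' z hzt]
      · simp [hF, hoff z hzt]
      · simp [hgrad, hoff z hzt, hoff' z hzt]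
  have hJF : ∀ᵐ z ∂(volume.restrict S), J z + F z ≤ A₁.indicator (fun _ => b) z := by
    filter_upwards [hcases] with z hz
    rcases hz with ⟨h1, h2, -⟩ | ⟨h1, h2⟩
    · rw [h1, h2, add_zero]
      exact indicator_nonneg (fun _ _ => hb0) z
    · rw [indicator_of_mem h1]
      exact energyDensity_add_le hp hM hW hR hθ hΛ hκ hM0 hWR hζ h2
  have hF0 : ∀ z, 0 ≤ F z := fun z => Finset.sum_nonneg fun i _ =>
    mul_nonneg (mul_nonneg (hv0 z) (hη0 z)) (by positivity)
  have hFi : Integrable F := by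
    refine integrable_finsetSum _ fun i _ => ?_
    have hp0 : 0 < p i := by linarith [hp i]
    have h1 : Integrable fun z => |G i z| ^ p i := by
      have := (h.memLp_grad i).integrable_norm_rpow (by simpa using hp0) ENNReal.ofReal_ne_top
      rwa [ENNReal.toReal_ofReal hp0.le] at this
    refine h1.bdd_mul (c := Λ) ?_ ?_
    · exact (((aemeasurable_const.sub h.integrable.1.aemeasurable).max
        aemeasurable_const).mul hηc.continuous.aemeasurable).aestronglyMeasurable
    · filter_upwards [hlow] with z hz
      rw [Real.norm_eq_abs, abs_of_nonneg (mul_nonneg (hv0 z) (hη0 z))]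
      by_cases hzt : z ∈ tsupport η
      · calc v z * η z ≤ Λ * 1 := mul_le_mul (hz hzt) (hη1 z) (hη0 z) hΛ.le
          _ = Λ := mul_one _
      · rw [hoff z hzt, mul_zero]
        exact hΛ.le
  obtain ⟨hJi, hJpos, hmain⟩ := h.parabolic_estimate hp hN hD hηc hηs (hηt.trans hζ.tsupport_subset)
    hη0 hmk hW (s := s) (B := A₁.indicator fun _ => b) (hind b)
    (fun z => indicator_nonneg (fun _ _ => hb0) z)
    (hJF.mono fun z hz => by have := hF0 z; linarith)
  -- The bound J + F ≤ b on A₁ is integrated, and J is discarded because its integral is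
  -- nonnegative.
  have hFint : ∫ z in S, F z ≤ b * α := by
    have h1 : ∫ z in S, (J z + F z) ≤ ∫ z in S, A₁.indicator (fun _ => b) z :=
      integral_mono_ae (hJi.add hFi.integrableOn) (hind b) hJF
    rw [integral_add hJi hFi.integrableOn] at h1
    have h2 := hindint b hb0
    linarith
  set c₁ := (∑ _i : Fin N, (Λ ^ 3 * (M : ℝ) + 3 * Λ ^ 2)) with hc₁
  set Θ := ∑ i, θ ^ (p i - 2) with hΘ
  have hc₁0 : 0 ≤ c₁ := Finset.sum_nonneg fun i _ => by positivity
  have hΘ0 : 0 ≤ Θ := Finset.sum_nonneg fun i _ => by positivity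
  have hgradint : ∫ z in S, grad z ≤ gradConst p θ Λ M * κ ^ M * α := by
    have h1 : ∫ z in S, grad z ≤
        ∫ z in S, (A₁.indicator (fun _ => c₁ * κ ^ M) z + 3 * Λ * Θ * R * F z) := by
      refine integral_mono_of_nonneg (.of_forall fun z => Finset.sum_nonneg fun i _ =>
        mul_nonneg (hW i).le (abs_nonneg _)) ((hind _).add (hFi.integrableOn.const_mul _)) ?_
      filter_upwards [hcases] with z hz
      rcases hz with ⟨-, h2, h3⟩ | ⟨h1, h2⟩
      · rw [h2, h3, mul_zero, add_zero]
        exact indicator_nonneg (fun _ _ => by positivity) z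
      · rw [indicator_of_mem h1]
        exact weighted_gradient_le hp hW hR hθ hΛ hκ hM0 hWR hζ h2
    rw [integral_add (hind _) (hFi.integrableOn.const_mul _), integral_const_mul] at h1
    have h2 := hindint (c₁ * κ ^ M) (by positivity)
    have h3 : 3 * Λ * Θ * R * ∫ z in S, F z ≤ 3 * Λ * Θ * R * (b * α) := by gcongr
    have h4 : gradConst p θ Λ M * κ ^ M * α = c₁ * κ ^ M * α + 3 * Λ * Θ * R * (b * α) := by
      have e : R * b = energyConst p θ Λ M * κ ^ M := by
        rw [hb]
        field_simp
      change (c₁ + 3 * Λ * Θ * energyConst p θ Λ M) * κ ^ M * α = _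
      linear_combination (-(3 * Λ * Θ * α)) * e
    linarith
  have hBint := hindint b hb0
  have hα0 : 0 ≤ α := ENNReal.toReal_nonneg
  have hd3 : 0 ≤ d ^ 3 := by positivity
  have hq : (0 : ℝ) < 1 + 1 / N := by positivity
  set A' := {z | U z < k - d} ∩ Q' with hA'
  -- Chebyshev's inequality: on A' the cutoff is one and v ≥ d.
  have hlower : ENNReal.ofReal ((d ^ 3) ^ (1 + 1 / (N : ℝ))) * volume A' ≤
      ∫⁻ z in S, ‖v z ^ 3 * η z‖ₑ ^ (1 + 1 / (N : ℝ)) := by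
    have hmeas : AEMeasurable (fun z => ‖v z ^ 3 * η z‖ₑ ^ (1 + 1 / (N : ℝ)))
        (volume.restrict S) := by
      have h1 : AEMeasurable v := (aemeasurable_const.sub h.integrable.1.aemeasurable).max
        aemeasurable_const
      exact (((h1.pow_const 3).mul hηc.continuous.aemeasurable).enorm.pow_const _).restrict
    refine le_trans ?_ (mul_meas_ge_le_lintegral₀ hmeas
      (ENNReal.ofReal ((d ^ 3) ^ (1 + 1 / (N : ℝ)))))
    refine mul_le_mul' le_rfl ?_
    have hA'S : A' ⊆ S := fun z hz => ⟨mem_univ _, hζ.subset_strip z hz.2⟩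
    rw [← Measure.restrict_eq_self volume hA'S]
    refine measure_mono fun z hz => ?_
    have hηz : η z = 1 := by simp [hη, hζ.eq_one z hz.2]
    have hdv : d ≤ v z := by
      have : U z < k - d := hz.1
      exact le_max_of_le_left (by linarith)
    rw [mem_setOf_eq, hηz, mul_one, Real.enorm_eq_ofReal (pow_nonneg (hv0 z) 3),
      ENNReal.ofReal_rpow_of_nonneg (pow_nonneg (hv0 z) 3) hq.le]
    refine ENNReal.ofReal_le_ofReal ?_
    gcongr
  have hP : 0 < ∏ i, W i := Finset.prod_pos fun i _ => hW i
  have hfin : ENNReal.ofReal ((∏ i, W i) ^ (1 / (N : ℝ)) * (d ^ 3) ^ (1 + 1 / (N : ℝ))) * volume A' ≤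
      ENNReal.ofReal ((3 * (b * α)) ^ (1 / (N : ℝ)) * (gradConst p θ Λ M * κ ^ M * α)) := by
    rw [ENNReal.ofReal_mul (by positivity), mul_assoc, ENNReal.ofReal_mul (by positivity),
      ← ENNReal.ofReal_rpow_of_nonneg hP.le (by positivity),
      ← ENNReal.ofReal_rpow_of_nonneg (by positivity : 0 ≤ 3 * (b * α)) (by positivity)]
    calc _ ≤ ENNReal.ofReal (∏ i, W i) ^ (1 / (N : ℝ)) *
          ∫⁻ z in S, ‖v z ^ 3 * η z‖ₑ ^ (1 + 1 / (N : ℝ)) := mul_le_mul' le_rfl hlower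
      _ ≤ _ := hmain
      _ ≤ _ := mul_le_mul' (ENNReal.rpow_le_rpow (ENNReal.ofReal_le_ofReal (by linarith))
        (by positivity)) (ENNReal.ofReal_le_ofReal hgradint)
  have hreal : (∏ i, W i) ^ (1 / (N : ℝ)) * (d ^ 3) ^ (1 + 1 / (N : ℝ)) * (volume A').toReal ≤
      (3 * (b * α)) ^ (1 / (N : ℝ)) * (gradConst p θ Λ M * κ ^ M * α) := by
    have := ENNReal.toReal_mono ENNReal.ofReal_ne_top hfin
    rwa [ENNReal.toReal_mul, ENNReal.toReal_ofReal (by positivity),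
      ENNReal.toReal_ofReal (by positivity)] at this
  -- Multiplying the estimate by R^{1/N} cancels the 1/R in b and completes ∏ Wᵢ to the volume R ∏
  -- Wᵢ.
  have hRb : R * (3 * (b * α)) = 3 * energyConst p θ Λ M * κ ^ M * α := by
    rw [hb]
    field_simp
  have hκM : (κ ^ M) ^ (1 / (N : ℝ)) ≤ κ ^ M := by
    have h1 : 1 ≤ κ ^ M := one_le_pow₀ hκ
    conv_rhs => rw [← Real.rpow_one (κ ^ M)]
    refine Real.rpow_le_rpow_of_exponent_le h1 ?_
    rw [div_le_one hN0]
    exact_mod_cast hN.le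
  calc (R * ∏ i, W i) ^ (1 / (N : ℝ)) * (d ^ 3) ^ (1 + 1 / (N : ℝ)) * (volume A').toReal
      = R ^ (1 / (N : ℝ)) * ((∏ i, W i) ^ (1 / (N : ℝ)) * (d ^ 3) ^ (1 + 1 / (N : ℝ)) *
          (volume A').toReal) := by
        rw [Real.mul_rpow hR.le hP.le]
        ring
    _ ≤ R ^ (1 / (N : ℝ)) *
        ((3 * (b * α)) ^ (1 / (N : ℝ)) * (gradConst p θ Λ M * κ ^ M * α)) := by gcongr
    _ = (3 * energyConst p θ Λ M * κ ^ M * α) ^ (1 / (N : ℝ)) *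
        (gradConst p θ Λ M * κ ^ M * α) := by
        rw [← hRb, Real.mul_rpow hR.le (by positivity)]
        ring
    _ = (3 * energyConst p θ Λ M) ^ (1 / (N : ℝ)) * gradConst p θ Λ M * κ ^ M * α *
        α ^ (1 / (N : ℝ)) * (κ ^ M) ^ (1 / (N : ℝ)) := by
        rw [Real.mul_rpow (by positivity) hα0, Real.mul_rpow (by positivity) (by positivity)]
        ring
    _ ≤ (3 * energyConst p θ Λ M) ^ (1 / (N : ℝ)) * gradConst p θ Λ M * κ ^ M * α *
        α ^ (1 / (N : ℝ)) * κ ^ M := by gcongr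
    _ = _ := by
        rw [Real.rpow_add_of_nonneg hα0 zero_le_one (by positivity), Real.rpow_one]
        ring

end OneStep

end AnisoParabolic

namespace AnisoParabolic

open scoped ENNReal NNReal ContDiff

/-! ### Cutoff functions between boxes -/

section Cutoff

/-- The derivative is continuous, hence bounded on [0, 1], and the function is locally constant
outside this interval. -/
theorem exists_smoothTransition_lipschitz :
    ∃ C : ℝ, 1 ≤ C ∧ ∀ x y, |Real.smoothTransition x - Real.smoothTransition y| ≤ C * |x - y| := by
  have hc : ContDiff ℝ 1 Real.smoothTransition := Real.smoothTransition.contDiff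
  have hdc : Continuous (deriv Real.smoothTransition) := hc.continuous_deriv_one
  obtain ⟨C, hC⟩ := (isCompact_Icc (a := (0 : ℝ)) (b := 1)).exists_bound_of_continuousOn
    hdc.continuousOn
  have hbd : ∀ x, ‖deriv Real.smoothTransition x‖ ≤ max C 1 := by
    intro x
    by_cases hx : x ∈ Icc (0 : ℝ) 1
    · exact (hC x hx).trans (le_max_left _ _)
    · have h0 : deriv Real.smoothTransition x = 0 := by
        rw [mem_Icc, not_and_or, not_le, not_le] at hx
        rcases hx with h | h
        · have : Real.smoothTransition =ᶠ[𝓝 x] fun _ => 0 := by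
            filter_upwards [Iio_mem_nhds h] with t ht
            exact Real.smoothTransition.zero_of_nonpos (mem_Iio.1 ht).le
          rw [this.deriv_eq, deriv_const]
        · have : Real.smoothTransition =ᶠ[𝓝 x] fun _ => 1 := by
            filter_upwards [Ioi_mem_nhds h] with t ht
            exact Real.smoothTransition.one_of_one_le (mem_Ioi.1 ht).le
          rw [this.deriv_eq, deriv_const]
      rw [h0, norm_zero]
      positivity
  refine ⟨max C 1, le_max_right _ _, fun x y => ?_⟩
  have := Convex.norm_image_sub_le_of_norm_deriv_le (s := univ) (f := Real.smoothTransition)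
    (C := max C 1) (fun x _ => hc.differentiable one_ne_zero x) (fun x _ => hbd x) convex_univ
    (mem_univ y) (mem_univ x)
  simpa [Real.norm_eq_abs] using this

/-- A smooth bump on the line, equal to `1` on `[-r, r]` and supported in `[-(r + δ), r + δ]`. -/
noncomputable def lineBump (r δ x : ℝ) : ℝ :=
  Real.smoothTransition ((r + δ - x) / δ) * Real.smoothTransition ((r + δ + x) / δ)

theorem contDiff_lineBump (r δ : ℝ) : ContDiff ℝ 1 (lineBump r δ) := by
  have hc : ContDiff ℝ 1 Real.smoothTransition := Real.smoothTransition.contDiff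
  unfold lineBump
  exact (hc.comp (by fun_prop)).mul (hc.comp (by fun_prop))

theorem lineBump_nonneg (r δ x : ℝ) : 0 ≤ lineBump r δ x :=
  mul_nonneg (Real.smoothTransition.nonneg _) (Real.smoothTransition.nonneg _)

theorem lineBump_le_one (r δ x : ℝ) : lineBump r δ x ≤ 1 :=
  mul_le_one₀ (Real.smoothTransition.le_one _) (Real.smoothTransition.nonneg _)
    (Real.smoothTransition.le_one _)

theorem lineBump_eq_one {r δ x : ℝ} (hδ : 0 < δ) (hx : |x| ≤ r) : lineBump r δ x = 1 := by
  have := abs_le.1 hx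
  unfold lineBump
  rw [Real.smoothTransition.one_of_one_le, Real.smoothTransition.one_of_one_le, mul_one]
  · rw [le_div_iff₀ hδ]
    linarith
  · rw [le_div_iff₀ hδ]
    linarith

theorem abs_le_of_lineBump_ne_zero {r δ x : ℝ} (hδ : 0 < δ) (hx : lineBump r δ x ≠ 0) :
    |x| ≤ r + δ := by
  by_contra h
  apply hx
  unfold lineBump
  rw [abs_le, not_and_or, not_le, not_le] at h
  rcases h with h | h
  · rw [Real.smoothTransition.zero_of_nonpos (x := (r + δ + x) / δ), mul_zero]
    exact div_nonpos_of_nonpos_of_nonneg (by linarith) hδ.le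
  · rw [Real.smoothTransition.zero_of_nonpos (x := (r + δ - x) / δ), zero_mul]
    exact div_nonpos_of_nonpos_of_nonneg (by linarith) hδ.le

theorem lineBump_lipschitz {C : ℝ}
    (hC : ∀ x y, |Real.smoothTransition x - Real.smoothTransition y| ≤ C * |x - y|)
    {r δ : ℝ} (hδ : 0 < δ) (x y : ℝ) :
    |lineBump r δ x - lineBump r δ y| ≤ 2 * C / δ * |x - y| := by
  unfold lineBump
  set a := Real.smoothTransition ((r + δ - x) / δ)
  set b := Real.smoothTransition ((r + δ + x) / δ)
  set c := Real.smoothTransition ((r + δ - y) / δ)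
  set d := Real.smoothTransition ((r + δ + y) / δ)
  have h1 : |a - c| ≤ C * (|x - y| / δ) := by
    refine (hC _ _).trans (le_of_eq ?_)
    rw [← sub_div, abs_div, abs_of_pos hδ, abs_sub_comm x y]
    congr 3
    ring
  have h2 : |b - d| ≤ C * (|x - y| / δ) := by
    refine (hC _ _).trans (le_of_eq ?_)
    rw [← sub_div, abs_div, abs_of_pos hδ]
    congr 3
    ring
  have hb : |b| ≤ 1 := by
    rw [abs_of_nonneg (Real.smoothTransition.nonneg _)]
    exact Real.smoothTransition.le_one _
  have hc : |c| ≤ 1 := by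
    rw [abs_of_nonneg (Real.smoothTransition.nonneg _)]
    exact Real.smoothTransition.le_one _
  calc |a * b - c * d| = |(a - c) * b + c * (b - d)| := by ring_nf
    _ ≤ |a - c| * |b| + |c| * |b - d| := by
      rw [← abs_mul, ← abs_mul]
      exact abs_add_le _ _
    _ ≤ |a - c| * 1 + 1 * |b - d| := by gcongr
    _ ≤ C * (|x - y| / δ) + C * (|x - y| / δ) := by linarith
    _ = _ := by ring

variable {N : ℕ}

/-- The symmetric open box `∏ {|xᵢ - yᵢ| < r Wᵢ} × (s - r R, s + r R)`. -/
def openBox (y : Fin N → ℝ) (s : ℝ) (W : Fin N → ℝ) (R r : ℝ) : Set ((Fin N → ℝ) × ℝ) :=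
  {z | (∀ i, |z.1 i - y i| < r * W i) ∧ |z.2 - s| < r * R}

/-- The backward half of `openBox`. -/
def backBox (y : Fin N → ℝ) (s : ℝ) (W : Fin N → ℝ) (R r : ℝ) : Set ((Fin N → ℝ) × ℝ) :=
  {z | (∀ i, |z.1 i - y i| < r * W i) ∧ s - r * R < z.2 ∧ z.2 ≤ s}

theorem isOpen_openBox (y : Fin N → ℝ) (s : ℝ) (W : Fin N → ℝ) (R r : ℝ) :
    IsOpen (openBox y s W R r) := by
  have : openBox y s W R r =
      (⋂ i, {z : (Fin N → ℝ) × ℝ | |z.1 i - y i| < r * W i}) ∩ {z | |z.2 - s| < r * R} := by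
    ext z
    simp [openBox]
  rw [this]
  exact (isOpen_iInter_of_finite fun i => isOpen_lt (by fun_prop) continuous_const).inter
    (isOpen_lt (by fun_prop) continuous_const)

theorem isCompact_closedBox (y : Fin N → ℝ) (s : ℝ) (W : Fin N → ℝ) (R r : ℝ) :
    IsCompact {z : (Fin N → ℝ) × ℝ | (∀ i, |z.1 i - y i| ≤ r * W i) ∧ |z.2 - s| ≤ r * R} := by
  have : {z : (Fin N → ℝ) × ℝ | (∀ i, |z.1 i - y i| ≤ r * W i) ∧ |z.2 - s| ≤ r * R} =
      (univ.pi fun i => Icc (y i - r * W i) (y i + r * W i)) ×ˢ Icc (s - r * R) (s + r * R) := by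
    ext z
    simp only [mem_setOf_eq, mem_prod, mem_univ_pi, mem_Icc, abs_le]
    refine and_congr (forall_congr' fun i => ?_) ?_ <;>
    exact ⟨fun h => ⟨by linarith [h.1], by linarith [h.2]⟩,
      fun h => ⟨by linarith [h.1], by linarith [h.2]⟩⟩
  rw [this]
  exact (isCompact_univ_pi fun i => isCompact_Icc).prod isCompact_Icc

theorem abs_fderiv_le_of_line {E : Type*} [NormedAddCommGroup E] [NormedSpace ℝ E] {f : E → ℝ}
    {z v : E} (hf : DifferentiableAt ℝ f z) {C : ℝ} (hC0 : 0 ≤ C)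
    (hC : ∀ τ : ℝ, |f (z + τ • v) - f z| ≤ C * |τ|) : |fderiv ℝ f z v| ≤ C := by
  have h : HasDerivAt (fun τ : ℝ => f (z + τ • v)) (fderiv ℝ f z v) 0 :=
    hf.hasFDerivAt.hasLineDerivAt v
  have := h.le_of_lip' (C := C) hC0 (.of_forall fun τ => by
    have := hC τ
    simpa [Real.norm_eq_abs] using this)
  simpa [Real.norm_eq_abs] using this

/-- Cutoff functions between concentric boxes. -/
theorem exists_isCutoff : ∃ K : ℝ, 1 ≤ K ∧ ∀ {N : ℕ} (y : Fin N → ℝ) (s : ℝ) (W : Fin N → ℝ)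
    (R r δ : ℝ), (∀ i, 0 < W i) → 0 < R → 0 < r → 0 < δ → ∃ ζ,
      IsCutoff W R s (K / δ) (openBox y s W R (r + δ)) (backBox y s W R (r + δ))
        (backBox y s W R r) ζ := by
  obtain ⟨C, hC1, hC⟩ := exists_smoothTransition_lipschitz
  -- The bumps use half of the gap δ, so that their closed support lies strictly inside the open
  -- box; their Lipschitz constant is then 2C/(δ/2) = 4C/δ.
  refine ⟨4 * C, by linarith, ?_⟩
  intro N y s W R r δ hW hR hr hδ
  have hδ2 : 0 < δ / 2 := by linarith
  set χ := lineBump r (δ / 2) with hχ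
  have hχc : ContDiff ℝ 1 χ := contDiff_lineBump _ _
  have hχ0 : ∀ x, 0 ≤ χ x := lineBump_nonneg _ _
  have hχ1 : ∀ x, χ x ≤ 1 := lineBump_le_one _ _
  have hχl : ∀ x y, |χ x - χ y| ≤ 4 * C / δ * |x - y| := fun x y => by
    refine (lineBump_lipschitz hC hδ2 x y).trans (le_of_eq ?_)
    field_simp
    ring
  set X : (Fin N → ℝ) × ℝ → ℝ := fun z => ∏ i, χ ((z.1 i - y i) / W i) with hX
  set ζ : (Fin N → ℝ) × ℝ → ℝ := fun z => X z * χ ((z.2 - s) / R) with hζ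
  have hX0 : ∀ z, 0 ≤ X z := fun z => Finset.prod_nonneg fun i _ => hχ0 _
  have hX1 : ∀ z, X z ≤ 1 := fun z => Finset.prod_le_one (fun i _ => hχ0 _) fun i _ => hχ1 _
  have hζc : ContDiff ℝ 1 ζ := by
    refine ContDiff.mul (contDiff_prod fun i _ => hχc.comp (by fun_prop)) (hχc.comp (by fun_prop))
  have hsupp : tsupport ζ ⊆ {z : (Fin N → ℝ) × ℝ | (∀ i, |z.1 i - y i| ≤ (r + δ / 2) * W i) ∧
      |z.2 - s| ≤ (r + δ / 2) * R} := by
    refine closure_minimal (fun z hz => ?_) (isCompact_closedBox y s W R (r + δ / 2)).isClosed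
    have hz' : ζ z ≠ 0 := hz
    have h1 := left_ne_zero_of_mul hz'
    have h2 := right_ne_zero_of_mul hz'
    refine ⟨fun i => ?_, ?_⟩
    · have := abs_le_of_lineBump_ne_zero hδ2 (Finset.prod_ne_zero_iff.1 h1 i (Finset.mem_univ i))
      rwa [abs_div, abs_of_pos (hW i), div_le_iff₀ (hW i)] at this
    · have := abs_le_of_lineBump_ne_zero hδ2 h2
      rwa [abs_div, abs_of_pos hR, div_le_iff₀ hR] at this
  have hlt : ∀ c : ℝ, 0 < c → (r + δ / 2) * c < (r + δ) * c := fun c hc => by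
    have : r + δ / 2 < r + δ := by linarith
    gcongr
  have hbox : tsupport ζ ⊆ openBox y s W R (r + δ) := fun z hz =>
    ⟨fun i => ((hsupp hz).1 i).trans_lt (hlt _ (hW i)), (hsupp hz).2.trans_lt (hlt _ hR)⟩
  refine ⟨ζ, hζc, ?_, hbox, fun z hz hzs => ?_, fun z => ?_, fun z => ?_, fun z hz => ?_,
    fun z hz => hz.2.2, fun z i => ?_, fun z => ?_⟩
  · exact (isCompact_closedBox y s W R (r + δ / 2)).of_isClosed_subset (isClosed_tsupport ζ) hsupp
  -- The cutoff is symmetric in time around s; only its part up to time s matters, and there the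
  -- symmetric box becomes the backward one.
  · have := hbox hz
    exact ⟨this.1, by linarith [(abs_lt.1 this.2).1], hzs⟩
  · exact mul_nonneg (hX0 z) (hχ0 _)
  · exact mul_le_one₀ (hX1 z) (hχ0 _) (hχ1 _)
  · have e1 : X z = 1 := Finset.prod_eq_one fun i _ => by
      refine lineBump_eq_one hδ2 ?_
      rw [abs_div, abs_of_pos (hW i), div_le_iff₀ (hW i)]
      exact (hz.1 i).le
    have e2 : χ ((z.2 - s) / R) = 1 := by
      refine lineBump_eq_one hδ2 ?_
      rw [abs_div, abs_of_pos hR, div_le_iff₀ hR, abs_le]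
      have : 0 < r * R := by positivity
      exact ⟨by linarith [hz.2.1], by linarith [hz.2.2]⟩
    simp only [hζ, e1, e2, mul_one]
  · have hWi := hW i
    refine abs_fderiv_le_of_line (hζc.differentiable one_ne_zero z) (by positivity) fun τ => ?_
    have e1 : ∀ w : (Fin N → ℝ) × ℝ, X w = χ ((w.1 i - y i) / W i) *
        ∏ j ∈ Finset.univ.erase i, χ ((w.1 j - y j) / W j) := fun w =>
      (Finset.mul_prod_erase _ _ (Finset.mem_univ i)).symm
    set P := ∏ j ∈ Finset.univ.erase i, χ ((z.1 j - y j) / W j) with hP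
    have hP0 : 0 ≤ P := Finset.prod_nonneg fun j _ => hχ0 _
    have hP1 : P ≤ 1 := Finset.prod_le_one (fun j _ => hχ0 _) fun j _ => hχ1 _
    have e2 : ∏ j ∈ Finset.univ.erase i,
        χ (((z + τ • ((Pi.single i 1 : Fin N → ℝ), (0 : ℝ))).1 j - y j) / W j) = P := by
      refine Finset.prod_congr rfl fun j hj => ?_
      have : j ≠ i := Finset.ne_of_mem_erase hj
      simp [this]
    simp only [hζ, e1, e2, ← hP]
    have e3 : (z + τ • ((Pi.single i 1 : Fin N → ℝ), (0 : ℝ))).2 = z.2 := by simp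
    have e4 : (z + τ • ((Pi.single i 1 : Fin N → ℝ), (0 : ℝ))).1 i = z.1 i + τ := by simp
    rw [e3, e4, mul_assoc, mul_assoc, ← sub_mul, abs_mul]
    have h1 := hχl ((z.1 i + τ - y i) / W i) ((z.1 i - y i) / W i)
    have e5 : (z.1 i + τ - y i) / W i - (z.1 i - y i) / W i = τ / W i := by ring
    rw [e5, abs_div, abs_of_pos hWi] at h1
    have h2 : |P * χ ((z.2 - s) / R)| ≤ 1 := by
      rw [abs_of_nonneg (mul_nonneg hP0 (hχ0 _))]
      exact mul_le_one₀ hP1 (hχ0 _) (hχ1 _)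
    calc _ ≤ 4 * C / δ * (|τ| / W i) * 1 := by gcongr
      _ = _ := by ring
  · refine abs_fderiv_le_of_line (hζc.differentiable one_ne_zero z) (by positivity) fun τ => ?_
    have e1 : X (z + τ • ((0 : Fin N → ℝ), (1 : ℝ))) = X z := by simp [hX]
    have e2 : (z + τ • ((0 : Fin N → ℝ), (1 : ℝ))).2 = z.2 + τ := by simp
    simp only [hζ]
    rw [e1, e2, ← mul_sub, abs_mul, abs_of_nonneg (hX0 z)]
    have h1 := hχl ((z.2 + τ - s) / R) ((z.2 - s) / R)
    have e5 : (z.2 + τ - s) / R - (z.2 - s) / R = τ / R := by ring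
    rw [e5, abs_div, abs_of_pos hR] at h1
    calc _ ≤ 1 * (4 * C / δ * (|τ| / R)) := by
          have := hX1 z
          gcongr
      _ = _ := by ring

end Cutoff

/-! ### Fast geometric convergence and the De Giorgi iteration -/

section Iteration

/-- Fast geometric convergence. -/
theorem exists_fast_convergence {C b α : ℝ} (hC : 0 < C) (hb : 1 < b) (hα : 0 < α) :
    ∃ ε : ℝ, 0 < ε ∧ ∀ Y : ℕ → ℝ, (∀ n, 0 ≤ Y n) → Y 0 ≤ ε →
      (∀ n, Y (n + 1) ≤ C * b ^ n * Y n ^ (1 + α)) → Tendsto Y atTop (𝓝 0) := by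
  have hb0 : 0 < b := by linarith
  -- The decay rate r satisfies r^α b = 1, which cancels the growing factor b^n, and ε is fixed by
  -- Cε^α = r. The bound εr^n then reproduces itself under the recursion.
  set r : ℝ := b ^ (-1 / α) with hr
  have hr0 : 0 < r := by positivity
  have hr1 : r < 1 := Real.rpow_lt_one_of_one_lt_of_neg hb (div_neg_of_neg_of_pos (by norm_num) hα)
  have hrb : r ^ α * b = 1 := by
    rw [hr, ← Real.rpow_mul hb0.le, div_mul_cancel₀ _ hα.ne', Real.rpow_neg_one,
      inv_mul_cancel₀ hb0.ne']
  set ε : ℝ := (r / C) ^ (1 / α) with hε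
  have hε0 : 0 < ε := by positivity
  have hεC : C * ε ^ α = r := by
    rw [hε, ← Real.rpow_mul (by positivity), one_div_mul_cancel hα.ne', Real.rpow_one]
    field_simp
  refine ⟨ε, hε0, fun Y hY0 hYε hrec => ?_⟩
  have hbound : ∀ n, Y n ≤ ε * r ^ n := by
    intro n
    induction n with
    | zero => simpa using hYε
    | succ n ih =>
      have hpow : b ^ n * (r ^ n) ^ α = 1 := by
        rw [← Real.rpow_natCast r n, ← Real.rpow_mul hr0.le, mul_comm (n : ℝ) α,
          Real.rpow_mul hr0.le, Real.rpow_natCast, ← mul_pow, mul_comm, hrb, one_pow]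
      calc Y (n + 1) ≤ C * b ^ n * Y n ^ (1 + α) := hrec n
        _ ≤ C * b ^ n * (ε * r ^ n) ^ (1 + α) := by
          have := Real.rpow_le_rpow (hY0 n) ih (by linarith : 0 ≤ 1 + α)
          gcongr
        _ = (C * ε ^ α) * (b ^ n * (r ^ n) ^ α) * (ε * r ^ n) := by
          rw [Real.rpow_add (by positivity), Real.rpow_one, Real.mul_rpow hε0.le (by positivity)]
          ring
        _ = ε * r ^ (n + 1) := by
          rw [hεC, hpow]
          ring
  refine squeeze_zero hY0 hbound ?_
  have := (tendsto_pow_atTop_nhds_zero_of_lt_one hr0.le hr1).const_mul ε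
  rwa [mul_zero] at this

theorem volume_backBox {N : ℕ} (y : Fin N → ℝ) (s : ℝ) {W : Fin N → ℝ} (hW : ∀ i, 0 < W i)
    (R : ℝ) : volume (backBox y s W R 1) = ENNReal.ofReal (2 ^ N * (R * ∏ i, W i)) := by
  have : backBox y s W R 1 =
      (univ.pi fun i => Ioo (y i - W i) (y i + W i)) ×ˢ Ioc (s - R) s := by
    ext z
    simp only [backBox, mem_setOf_eq, mem_prod, mem_univ_pi, mem_Ioo, mem_Ioc, abs_lt, one_mul]
    refine and_congr (forall_congr' fun i => ?_) Iff.rfl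
    exact ⟨fun h => ⟨by linarith [h.1], by linarith [h.2]⟩,
      fun h => ⟨by linarith [h.1], by linarith [h.2]⟩⟩
  rw [this, Measure.volume_eq_prod, Measure.prod_prod, Real.volume_pi_Ioo, Real.volume_Ioc,
    ← ENNReal.ofReal_prod_of_nonneg, ← ENNReal.ofReal_mul]
  · congr 1
    have e : ∀ i, y i + W i - (y i - W i) = 2 * W i := fun i => by ring
    simp only [e]
    rw [Finset.prod_mul_distrib, Finset.prod_const, Finset.card_univ, Fintype.card_fin]
    ring
  · exact Finset.prod_nonneg fun i _ => by linarith [hW i]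
  · intro i _
    linarith [hW i]

theorem backBox_mono {N : ℕ} {y : Fin N → ℝ} {s : ℝ} {W : Fin N → ℝ} (hW : ∀ i, 0 < W i) {R : ℝ}
    (hR : 0 < R) {r r' : ℝ} (h : r ≤ r') : backBox y s W R r ⊆ backBox y s W R r' := by
  intro z hz
  refine ⟨fun i => (hz.1 i).trans_le (mul_le_mul_of_nonneg_right h (hW i).le), ?_, hz.2.2⟩
  have := mul_le_mul_of_nonneg_right h hR.le
  linarith [hz.2.1]

theorem openBox_mono {N : ℕ} {y : Fin N → ℝ} {s : ℝ} {W : Fin N → ℝ} (hW : ∀ i, 0 < W i) {R : ℝ}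
    (hR : 0 < R) {r r' : ℝ} (h : r ≤ r') : openBox y s W R r ⊆ openBox y s W R r' := fun _ hz =>
  ⟨fun i => (hz.1 i).trans_le (mul_le_mul_of_nonneg_right h (hW i).le),
    hz.2.trans_le (mul_le_mul_of_nonneg_right h hR.le)⟩

/-- The De Giorgi iteration for mollified supersolutions. -/
theorem exists_deGiorgi_bound {N : ℕ} {p : Fin N → ℝ} (hN : 1 < N) (hp : ∀ i, 2 < p i) {M : ℕ}
    (hM : ∀ i, p i ≤ M) {θ Λ a q : ℝ} (hθ : 0 < θ) (hΛ : 0 < Λ) (ha0 : 0 < a) (ha1 : a < 1)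
    (hq0 : 0 < q) (hq1 : q < 1) :
    ∃ ν : ℝ, 0 < ν ∧ ν < 1 ∧ ∀ (U : (Fin N → ℝ) × ℝ → ℝ) (G : Fin N → (Fin N → ℝ) × ℝ → ℝ)
      (m : ℝ) (y : Fin N → ℝ) (s : ℝ) (W : Fin N → ℝ) (R : ℝ), (∀ i, 0 < W i) → 0 < R →
      (∀ i, W i ^ p i = θ ^ (p i - 2) * R) → MollifiedSuper p U G m (openBox y s W R 1) →
      volume ({z | U z < m + Λ} ∩ backBox y s W R 1) ≤
        ENNReal.ofReal ν * volume (backBox y s W R 1) →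
      volume ({z | U z < m + a * Λ} ∩ backBox y s W R q) = 0 := by
  have hNpos : (0 : ℝ) < N := by exact_mod_cast (by omega : 0 < N)
  obtain ⟨K, hK1, hcut⟩ := exists_isCutoff
  set C₀ : ℝ := (3 * energyConst p θ Λ M) ^ (1 / (N : ℝ)) * gradConst p θ Λ M with hC₀
  have hE := energyConst_nonneg p hθ hΛ M
  have hG := gradConst_nonneg p hθ hΛ M
  have hC₀0 : 0 ≤ C₀ := by positivity
  set K₁ : ℝ := 2 * K / (1 - q) with hK₁
  have h1q : 0 < 1 - q := by linarith
  have h1a : 0 < 1 - a := by linarith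
  have hK₁0 : 0 < K₁ := by positivity
  set e : ℝ := 1 + 1 / (N : ℝ) with he
  have he0 : 0 < e := by positivity
  have he2 : e ≤ 2 := by
    have : 1 / (N : ℝ) ≤ 1 := by
      rw [div_le_one hNpos]
      exact_mod_cast hN.le
    linarith
  set c : ℝ := (((1 - a) * Λ / 2) ^ 3) ^ e with hc
  have hc0 : 0 < c := by positivity
  -- At step j the factor κ^{2M} grows like 2^{2Mj}, and the division by d^{3(1 + 1/N)} costs at
  -- most 2^{6j} up to a constant because 1 + 1/N ≤ 2. This gives the base 2^{2M + 6}. The added one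
  -- only makes the constant positive.
  obtain ⟨ε, hε0, hconv⟩ := exists_fast_convergence
    (C := (C₀ * K₁ ^ (2 * M) + 1) / c) (b := 2 ^ (2 * M + 6)) (α := 1 / (N : ℝ)) (by positivity)
    (one_lt_pow₀ one_lt_two (by omega)) (by positivity)
  -- The backward box has volume 2^N V with V = R ∏ Wᵢ, while the iterated quantity is normalised by
  -- V; hence the division by 2^N.
  refine ⟨min (1 / 2) (ε / 2 ^ N), by positivity, (min_le_left _ _).trans_lt (by norm_num), ?_⟩
  intro U G m y s W R hW hR hWR h hsmall
  have hP : 0 < ∏ i, W i := Finset.prod_pos fun i _ => hW i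
  set V : ℝ := R * ∏ i, W i with hV
  have hV0 : 0 < V := by positivity
  set t : ℕ → ℝ := fun j => (1 / 2 : ℝ) ^ j with ht
  have ht0 : ∀ j, 0 < t j := fun j => by positivity
  have ht1 : ∀ j, t j ≤ 1 := fun j => pow_le_one₀ (by norm_num) (by norm_num)
  have htsucc : ∀ j, t (j + 1) = t j / 2 := fun j => by
    simp only [ht, pow_succ]
    ring
  -- The radii decrease from 1 to q and the levels from m + Λ to m + aΛ, with gaps halved at each
  -- step.
  set r : ℕ → ℝ := fun j => q + (1 - q) * t j with hr
  set k : ℕ → ℝ := fun j => m + a * Λ + (1 - a) * Λ * t j with hk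
  set A : ℕ → Set ((Fin N → ℝ) × ℝ) := fun j => {z | U z < k j} ∩ backBox y s W R (r j) with hA
  have hr1 : ∀ j, r j ≤ 1 := fun j => by
    have := mul_le_mul_of_nonneg_left (ht1 j) h1q.le
    simp only [hr]
    linarith
  have hvol1 := volume_backBox y s hW R
  have hQfin : ∀ j, volume (backBox y s W R (r j)) ≠ ⊤ := fun j =>
    measure_ne_top_of_subset (backBox_mono hW hR (hr1 j)) (by
      rw [hvol1]
      exact ENNReal.ofReal_ne_top)
  have hAfin : ∀ j, volume (A j) ≠ ⊤ := fun j =>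
    measure_ne_top_of_subset inter_subset_right (hQfin j)
  set Y : ℕ → ℝ := fun j => (volume (A j)).toReal / V with hY
  have hY0 : ∀ j, 0 ≤ Y j := fun j => div_nonneg ENNReal.toReal_nonneg hV0.le
  have hstart : Y 0 ≤ ε := by
    have hA0 : A 0 = {z | U z < m + Λ} ∩ backBox y s W R 1 := by
      have hk0 : k 0 = m + Λ := by
        simp only [hk, ht, pow_zero]
        ring
      have hr0 : r 0 = 1 := by
        simp only [hr, ht, pow_zero]
        ring
      simp only [hA, hk0, hr0]
    rw [← hA0, hvol1, ← ENNReal.ofReal_mul (by positivity)] at hsmall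
    have h1 := ENNReal.toReal_mono ENNReal.ofReal_ne_top hsmall
    rw [ENNReal.toReal_ofReal (by positivity)] at h1
    simp only [hY]
    rw [div_le_iff₀ hV0]
    refine h1.trans ?_
    calc min (1 / 2) (ε / 2 ^ N) * (2 ^ N * (R * ∏ i, W i)) ≤ ε / 2 ^ N * (2 ^ N * V) := by
          gcongr
          exact min_le_right _ _
      _ = ε * V := by field_simp
  have hstep : ∀ j, Y (j + 1) ≤ (C₀ * K₁ ^ (2 * M) + 1) / c * (2 ^ (2 * M + 6)) ^ j *
      Y j ^ (1 + 1 / (N : ℝ)) := by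
    intro j
    set δ : ℝ := (1 - q) * t (j + 1) with hδ
    have hδ0 : 0 < δ := mul_pos h1q (ht0 _)
    have hrδ : r (j + 1) + δ = r j := by
      simp only [hr, hδ, htsucc]
      ring
    obtain ⟨ζ, hζ⟩ := hcut y s W R (r (j + 1)) δ hW hR
      (by simp only [hr]; have := mul_pos h1q (ht0 (j + 1)); linarith) hδ0
    rw [hrδ] at hζ
    set d : ℝ := (1 - a) * Λ * t (j + 1) with hd
    have hd0 : 0 < d := by have := ht0 (j + 1); positivity
    have hkd : k j - d = k (j + 1) := by
      simp only [hk, hd, htsucc]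
      ring
    have hδ1 : δ ≤ 1 := by
      calc δ ≤ 1 * 1 := mul_le_mul (by linarith) (ht1 _) (ht0 _).le zero_le_one
        _ = 1 := one_mul 1
    have hκ1 : 1 ≤ K / δ := by
      rw [le_div_iff₀ hδ0]
      linarith
    have hζ' : IsCutoff W R s (K / δ) (openBox y s W R 1) (backBox y s W R (r j))
        (backBox y s W R (r (j + 1))) ζ :=
      { hζ with tsupport_subset := hζ.tsupport_subset.trans (openBox_mono hW hR (hr1 j)) }
    have hkm : k j - m ≤ Λ := by
      have := mul_le_mul_of_nonneg_left (ht1 j) (mul_pos h1a hΛ).le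
      simp only [hk]
      linarith
    have hmk : m ≤ k j := by
      have h1 := mul_pos (mul_pos h1a hΛ) (ht0 j)
      have h2 := mul_pos ha0 hΛ
      simp only [hk]
      linarith
    have hone := h.one_step hp hN (isOpen_openBox y s W R 1) hM hW hR hθ hΛ hκ1 hWR (hQfin j) hζ'
      hmk hkm hd0.le
    rw [hkd] at hone
    have hα : ∀ i, (volume (A i)).toReal = V * Y i := fun i => by
      simp only [hY]
      field_simp
    have hone' : V ^ (1 / (N : ℝ)) * (d ^ 3) ^ e * (V * Y (j + 1)) ≤
        C₀ * (K / δ) ^ (2 * M) * (V * Y j) ^ e := by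
      rw [← hα, ← hα]
      exact hone
    have hVe : (V * Y j) ^ e = V * V ^ (1 / (N : ℝ)) * Y j ^ e := by
      rw [Real.mul_rpow hV0.le (hY0 j), he, Real.rpow_add hV0, Real.rpow_one]
    rw [hVe] at hone'
    have hVp : 0 < V * V ^ (1 / (N : ℝ)) := by positivity
    have hdiv : (d ^ 3) ^ e * Y (j + 1) ≤ C₀ * (K / δ) ^ (2 * M) * Y j ^ e := by
      refine le_of_mul_le_mul_left ?_ hVp
      linarith
    have htj : t j * 2 ^ j = 1 := by
      simp only [ht]
      rw [← mul_pow]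
      norm_num
    have hKδ : K / δ = K₁ * 2 ^ j := by
      rw [hδ, htsucc, hK₁]
      have := ht0 j
      field_simp
      linarith [htj]
    have hdlow : c * t j ^ 6 ≤ (d ^ 3) ^ e := by
      have e1 : d ^ 3 = ((1 - a) * Λ / 2) ^ 3 * t j ^ 3 := by
        rw [hd, htsucc]
        ring
      rw [e1, Real.mul_rpow (by positivity) (by have := ht0 j; positivity)]
      have h3 : (t j ^ 3) ^ (2 : ℝ) ≤ (t j ^ 3) ^ e :=
        Real.rpow_le_rpow_of_exponent_ge (by have := ht0 j; positivity)
          (pow_le_one₀ (ht0 j).le (ht1 j)) he2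
      have h4 : (t j ^ 3) ^ (2 : ℝ) = t j ^ 6 := by
        rw [Real.rpow_two]
        ring
      rw [h4] at h3
      gcongr
    have h5 : c * t j ^ 6 * Y (j + 1) ≤ C₀ * (K₁ * 2 ^ j) ^ (2 * M) * Y j ^ e := by
      rw [← hKδ]
      refine le_trans ?_ hdiv
      have := hY0 (j + 1)
      gcongr
    have h6 : Y (j + 1) = (c * t j ^ 6 * Y (j + 1)) * (2 ^ j) ^ 6 / c := by
      have : t j ^ 6 * (2 ^ j) ^ 6 = 1 := by rw [← mul_pow, htj, one_pow]
      field_simp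
      linear_combination (-Y (j + 1)) * this
    have hYe : 0 ≤ Y j ^ e := Real.rpow_nonneg (hY0 j) e
    rw [h6]
    calc (c * t j ^ 6 * Y (j + 1)) * (2 ^ j) ^ 6 / c
        ≤ (C₀ * (K₁ * 2 ^ j) ^ (2 * M) * Y j ^ e) * (2 ^ j) ^ 6 / c := by gcongr
      _ = (C₀ * K₁ ^ (2 * M)) / c * (2 ^ (2 * M + 6)) ^ j * Y j ^ e := by
        rw [mul_pow, ← pow_mul, ← pow_mul, ← pow_mul]
        ring
      _ ≤ (C₀ * K₁ ^ (2 * M) + 1) / c * (2 ^ (2 * M + 6)) ^ j * Y j ^ e := by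
        gcongr
        linarith
  have hlim := hconv Y hY0 hstart hstep
  -- The limiting level set lies in every A j, so its measure is bounded by a sequence tending to
  -- zero.
  set Z := {z | U z < m + a * Λ} ∩ backBox y s W R q with hZ
  have hsub : ∀ j, Z ⊆ A j := fun j => by
    refine inter_subset_inter (fun z hz => ?_) (backBox_mono hW hR ?_)
    · have h1 := mul_pos (mul_pos h1a hΛ) (ht0 j)
      have h2 : U z < m + a * Λ := hz
      simp only [mem_setOf_eq, hk]
      linarith
    · have := mul_pos h1q (ht0 j)
      simp only [hr]
      linarith
  have hle : ∀ j, (volume Z).toReal / V ≤ Y j := fun j => by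
    simp only [hY]
    gcongr
    · exact hAfin j
    · exact hsub j
  have h0 : (volume Z).toReal / V ≤ 0 := ge_of_tendsto' hlim hle
  have h1 : (volume Z).toReal = 0 := by
    refine le_antisymm ?_ ENNReal.toReal_nonneg
    rw [div_le_iff₀ hV0, zero_mul] at h0
    exact h0
  rcases (ENNReal.toReal_eq_zero_iff _).1 h1 with h2 | h2
  · exact h2
  · exact absurd h2 (measure_ne_top_of_subset (hsub 0) (hAfin 0))

end Iteration

end AnisoParabolic

/-! ### From boxes to intrinsic cylinders, and from super- to sub-solutions -/

namespace AnisoParabolic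

theorem self_mem_cube {N : ℕ} {p : Fin N → ℝ} {ρ θ : ℝ} (hρ : 0 < ρ) (hθ : 0 < θ)
    (y : Fin N → ℝ) : y ∈ cube p ρ θ y := by
  intro i
  rw [sub_self, abs_zero]
  positivity

theorem isOpen_cube {N : ℕ} (p : Fin N → ℝ) (ρ θ : ℝ) (y : Fin N → ℝ) : IsOpen (cube p ρ θ y) := by
  have : cube p ρ θ y =
      ⋂ i, {x | |x i - y i| < θ ^ ((p i - 2) / p i) * ρ ^ (pBar p / p i)} := by
    ext x
    simp [cube]
  rw [this]
  exact isOpen_iInter_of_finite fun i => isOpen_lt (by fun_prop) continuous_const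

theorem pBar_pos {N : ℕ} {p : Fin N → ℝ} (hN : 0 < N) (hp : ∀ i, 0 < p i) : 0 < pBar p := by
  have : Nonempty (Fin N) := ⟨⟨0, hN⟩⟩
  have h1 : 0 < ∑ i, 1 / p i :=
    Finset.sum_pos (fun i _ => by have := hp i; positivity) Finset.univ_nonempty
  have h2 : (0 : ℝ) < N := by exact_mod_cast hN
  unfold pBar
  positivity

/-- The closure of the cylinder contains both end times, which must therefore lie strictly inside
(-T, T). -/
theorem exists_compact_of_compactlyIn {N : ℕ} {p : Fin N → ℝ} {Ω : Set (Fin N → ℝ)} {T ρ θ : ℝ}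
    {y : Fin N → ℝ} {s : ℝ} (hρ : 0 < ρ) (hθ : 0 < θ)
    (h : CompactlyIn (fullCylinder p ρ θ y s) (spaceTime Ω T)) :
    IsCompact (closure (cube p ρ θ y)) ∧ closure (cube p ρ θ y) ⊆ Ω ∧
      -T < s - ρ ^ pBar p ∧ s + ρ ^ pBar p < T := by
  have hR : 0 < ρ ^ pBar p := by positivity
  have hcl : closure (fullCylinder p ρ θ y s) =
      closure (cube p ρ θ y) ×ˢ Icc (s - ρ ^ pBar p) (s + ρ ^ pBar p) := by
    rw [fullCylinder, closure_prod_eq, closure_Ioc (by linarith)]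
  obtain ⟨hc, hsub⟩ := h
  rw [hcl] at hc hsub
  have hy : y ∈ closure (cube p ρ θ y) := subset_closure (self_mem_cube hρ hθ y)
  have hs : s ∈ Icc (s - ρ ^ pBar p) (s + ρ ^ pBar p) := ⟨by linarith, by linarith⟩
  refine ⟨?_, fun x hx => (hsub (mk_mem_prod hx hs)).1, ?_, ?_⟩
  · have := hc.image continuous_fst
    rwa [fst_image_prod _ ⟨s, hs⟩] at this
  · exact (hsub (mk_mem_prod hy (left_mem_Icc.2 (by linarith)))).2.1
  · exact (hsub (mk_mem_prod hy (right_mem_Icc.2 (by linarith)))).2.2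

theorem superSolution_deGiorgi {N : ℕ} {p : Fin N → ℝ} (hN : 1 < N) (hp : ∀ i, 2 < p i)
    {θ Λ a : ℝ} (hθ : 0 < θ) (hΛ : 0 < Λ) (ha : a ∈ Ioo (0 : ℝ) 1) :
    ∃ ν ∈ Ioo (0 : ℝ) 1, ∀ (Ω : Set (Fin N → ℝ)) (T : ℝ) (u : (Fin N → ℝ) × ℝ → ℝ)
      (y : Fin N → ℝ) (s ρ m : ℝ), IsSuperSolution p Ω T u → 0 < ρ →
      CompactlyIn (fullCylinder p (2 * ρ) θ y s) (spaceTime Ω T) →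
      (∀ᵐ z ∂(volume.restrict (fullCylinder p (2 * ρ) θ y s)), m ≤ u z) →
      volume ({z | u z ≤ m + Λ} ∩ backCylinder p (2 * ρ) θ y s) ≤
        ENNReal.ofReal ν * volume (backCylinder p (2 * ρ) θ y s) →
      ∀ᵐ z ∂(volume.restrict (backCylinder p ρ θ y s)), m + a * Λ ≤ u z := by
  have hp0 : ∀ i, 0 < p i := fun i => two_pos.trans (hp i)
  have hpb : 0 < pBar p := pBar_pos (by omega) hp0
  obtain ⟨M, hM⟩ : ∃ M : ℕ, ∀ i, p i ≤ M := by
    obtain ⟨M, hM⟩ := exists_nat_ge (∑ i, p i)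
    exact ⟨M, fun i => (Finset.single_le_sum (fun j _ => (hp0 j).le) (Finset.mem_univ i)).trans hM⟩
  have hM0 : (0 : ℝ) < M := (hp0 ⟨0, by omega⟩).trans_le (hM _)
  have hM1 : (1 : ℝ) ≤ M := by
    have := (hp ⟨0, by omega⟩).trans_le (hM _)
    linarith
  -- Halving ρ shrinks the i-th width by 2^{-p̄/pᵢ} and the time length by 2^{-p̄}. Both factors are
  -- at most q because pᵢ ≤ M and 1 ≤ M, so the cylinder of size ρ lies in the isotropically
  -- rescaled box.
  set q : ℝ := 2 ^ (-(pBar p / M)) with hq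
  have hq0 : 0 < q := by positivity
  have hq1 : q < 1 :=
    Real.rpow_lt_one_of_one_lt_of_neg one_lt_two (neg_lt_zero.2 (div_pos hpb hM0))
  have hqle : ∀ e : ℝ, 0 < e → e ≤ M → ∀ ρ : ℝ, 0 < ρ →
      ρ ^ (pBar p / e) ≤ q * (2 * ρ) ^ (pBar p / e) := by
    intro e he heM ρ hρ
    have h1 : (2 : ℝ) ^ (pBar p / M) ≤ 2 ^ (pBar p / e) :=
      Real.rpow_le_rpow_of_exponent_le one_le_two (div_le_div_of_nonneg_left hpb.le he heM)
    have h2 : 1 ≤ q * 2 ^ (pBar p / e) := by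
      calc (1 : ℝ) = q * 2 ^ (pBar p / M) := by rw [hq, ← Real.rpow_add two_pos]; simp
        _ ≤ _ := by gcongr
    rw [Real.mul_rpow two_pos.le hρ.le, ← mul_assoc]
    exact le_mul_of_one_le_left (by positivity) h2
  obtain ⟨ν, hν0, hν1, hν⟩ := exists_deGiorgi_bound hN hp hM hθ hΛ ha.1 ha.2 hq0 hq1
  refine ⟨ν, ⟨hν0, hν1⟩, ?_⟩
  rintro Ω T u y s ρ m ⟨g, hspace, hsup⟩ hρ hcomp hlow hsmall
  have h2ρ : 0 < 2 * ρ := by positivity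
  obtain ⟨hK, hKΩ, ht₁, ht₂⟩ := exists_compact_of_compactlyIn h2ρ hθ hcomp
  set W : Fin N → ℝ := fun i => θ ^ ((p i - 2) / p i) * (2 * ρ) ^ (pBar p / p i) with hW
  set R : ℝ := (2 * ρ) ^ pBar p with hR
  have hW0 : ∀ i, 0 < W i := fun i => by positivity
  have hR0 : 0 < R := by positivity
  -- This identity is the purpose of the exponents in the intrinsic cylinder.
  have hWR : ∀ i, W i ^ p i = θ ^ (p i - 2) * R := by
    intro i
    have := (hp0 i).ne'
    rw [hW, Real.mul_rpow (by positivity) (by positivity), ← Real.rpow_mul hθ.le,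
      ← Real.rpow_mul h2ρ.le, div_mul_cancel₀ _ this, div_mul_cancel₀ _ this]
  have hback : backCylinder p (2 * ρ) θ y s = backBox y s W R 1 := by
    ext z
    simp [backCylinder, cube, backBox, hW, hR]
  have hopen : openBox y s W R 1 ⊆ fullCylinder p (2 * ρ) θ y s := by
    rintro z ⟨h1, h2⟩
    rw [one_mul, abs_lt] at h2
    refine ⟨fun i => ?_, by linarith [h2.1], by linarith [h2.2]⟩
    simpa using h1 i
  have hbox : fullCylinder p (2 * ρ) θ y s ⊆ closure (cube p (2 * ρ) θ y) ×ˢ Icc (s - R) (s + R) :=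
    prod_mono subset_closure Ioc_subset_Icc_self
  set C := closure (cube p (2 * ρ) θ y) ×ˢ Icc (s - R) (s + R) with hC
  have hmol := mollifiedSuper_indicator hp hspace hsup hK hKΩ ht₁ ht₂
    (isOpen_openBox y s W R 1).measurableSet (hopen.trans hbox)
    (ae_restrict_of_ae_restrict_of_subset hopen hlow)
  have hbackC : backBox y s W R 1 ⊆ C := by
    rw [← hback]
    exact (prod_mono subset_rfl (Ioc_subset_Ioc_right (by linarith))).trans hbox
  rw [hback] at hsmall
  have hzero := hν _ _ m y s W R hW0 hR0 hWR hmol ((measure_mono ?_).trans hsmall)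
  · have hsub : backCylinder p ρ θ y s ⊆ backBox y s W R q := by
      rintro z ⟨h1, h2, h3⟩
      refine ⟨fun i => (h1 i).trans_le ?_, ?_, h3⟩
      · have := hqle (p i) (hp0 i) (hM i) ρ hρ
        calc _ ≤ θ ^ ((p i - 2) / p i) * (q * (2 * ρ) ^ (pBar p / p i)) := by gcongr
          _ = q * W i := by rw [hW]; ring
      · have := hqle 1 one_pos hM1 ρ hρ
        rw [div_one] at this
        linarith
    have hmeas : MeasurableSet (backCylinder p ρ θ y s) :=
      (isOpen_cube p ρ θ y).measurableSet.prod measurableSet_Ioc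
    rw [ae_restrict_iff' hmeas, ae_iff]
    refine measure_mono_null (fun z hz => ?_) hzero
    simp only [mem_setOf_eq, Classical.not_imp, not_le] at hz
    refine ⟨?_, hsub hz.1⟩
    rw [mem_setOf_eq, indicator_of_mem (hbackC (backBox_mono hW0 hR0 hq1.le (hsub hz.1)))]
    exact hz.2
  · rintro z ⟨h1, h2⟩
    rw [mem_setOf_eq, indicator_of_mem (hbackC h2)] at h1
    exact ⟨h1.le, h2⟩

theorem IsWeakPartial.neg {N : ℕ} {Ω : Set (Fin N → ℝ)} {i : Fin N} {v w : (Fin N → ℝ) → ℝ}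
    (h : IsWeakPartial Ω i v w) : IsWeakPartial Ω i (fun x => -v x) (fun x => -w x) where
  locInt := h.locInt.neg
  locInt_deriv := h.locInt_deriv.neg
  byParts φ h1 h2 h3 := by
    simp only [neg_mul, integral_neg, h.byParts φ h1 h2 h3]

theorem InSolutionSpace.neg {N : ℕ} {p : Fin N → ℝ} {Ω : Set (Fin N → ℝ)} {T : ℝ}
    {u : (Fin N → ℝ) × ℝ → ℝ} {g : Fin N → (Fin N → ℝ) × ℝ → ℝ} (h : InSolutionSpace p Ω T u g) :
    InSolutionSpace p Ω T (fun z => -u z) (fun i z => -g i z) where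
  slice_memL2 K hK hKΩ t ht := (h.slice_memL2 K hK hKΩ t ht).neg
  continuous_L2 K hK hKΩ t ht := by
    refine (h.continuous_L2 K hK hKΩ t ht).congr fun r => ?_
    rw [← eLpNorm_neg]
    congr 1
    ext x
    simp only [Pi.neg_apply]
    ring
  locInt K hK hKΩ t₁ t₂ h1 h2 := (h.locInt K hK hKΩ t₁ t₂ h1 h2).neg
  weakPartial i := (h.weakPartial i).mono fun t ht => ht.neg
  grad_memLp i K hK hKΩ t₁ t₂ h1 h2 := (h.grad_memLp i K hK hKΩ t₁ t₂ h1 h2).neg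

/-- The flux is odd in the gradient and all other terms are linear in u. -/
theorem weakForm_neg {N : ℕ} (p : Fin N → ℝ) (u : (Fin N → ℝ) × ℝ → ℝ)
    (g : Fin N → (Fin N → ℝ) × ℝ → ℝ) (K : Set (Fin N → ℝ)) (t₁ t₂ : ℝ)
    (φ : (Fin N → ℝ) × ℝ → ℝ) :
    weakForm p (fun z => -u z) (fun i z => -g i z) K t₁ t₂ φ = -weakForm p u g K t₁ t₂ φ := by
  simp only [weakForm, neg_mul, mul_neg, abs_neg, integral_neg, Finset.sum_neg_distrib, ← neg_add]
  ring

theorem IsSubSolution.neg {N : ℕ} {p : Fin N → ℝ} {Ω : Set (Fin N → ℝ)} {T : ℝ}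
    {u : (Fin N → ℝ) × ℝ → ℝ} (h : IsSubSolution p Ω T u) :
    IsSuperSolution p Ω T fun z => -u z := by
  obtain ⟨g, hg, hu⟩ := h
  refine ⟨_, hg.neg, fun K hK hKΩ t₁ t₂ h1 h2 h3 φ hφ => ?_⟩
  rw [weakForm_neg]
  exact neg_nonneg.2 (hu K hK hKΩ t₁ t₂ h1 h2 h3 φ hφ)

end AnisoParabolic

theorem lemma3p2 {N : ℕ} (p : Fin N → ℝ) (hp : AnisoParabolic.Admissible p)
    (θ ω ξ a : ℝ) (hθ : 0 < θ) (hω : 0 < ω) (hξ : ξ ∈ Ioc (0 : ℝ) 1) (ha : a ∈ Ioo (0 : ℝ) 1) :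
    (∃ νm ∈ Ioo (0 : ℝ) 1,
      ∀ (Ω : Set (Fin N → ℝ)) (T : ℝ) (u : (Fin N → ℝ) × ℝ → ℝ)
        (y : Fin N → ℝ) (s ρ μm : ℝ),
        IsOpen Ω → Bornology.IsBounded Ω → 0 < T →
        AnisoParabolic.IsSuperSolution p Ω T u →
        AnisoParabolic.LocBddBelow Ω T u →
        (y, s) ∈ AnisoParabolic.spaceTime Ω T → 0 < ρ →
        AnisoParabolic.CompactlyIn (AnisoParabolic.fullCylinder p (2 * ρ) θ y s)
          (AnisoParabolic.spaceTime Ω T) →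
        (∀ᵐ z ∂(volume.restrict (AnisoParabolic.fullCylinder p (2 * ρ) θ y s)), μm ≤ u z) →
        volume ({z | u z ≤ μm + ξ * ω} ∩ AnisoParabolic.backCylinder p (2 * ρ) θ y s) ≤
          ENNReal.ofReal νm * volume (AnisoParabolic.backCylinder p (2 * ρ) θ y s) →
        ∀ᵐ z ∂(volume.restrict (AnisoParabolic.backCylinder p ρ θ y s)),
          μm + a * ξ * ω ≤ u z) ∧
    (∃ νp ∈ Ioo (0 : ℝ) 1,
      ∀ (Ω : Set (Fin N → ℝ)) (T : ℝ) (u : (Fin N → ℝ) × ℝ → ℝ)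
        (y : Fin N → ℝ) (s ρ μp : ℝ),
        IsOpen Ω → Bornology.IsBounded Ω → 0 < T →
        AnisoParabolic.IsSubSolution p Ω T u →
        AnisoParabolic.LocBddAbove Ω T u →
        (y, s) ∈ AnisoParabolic.spaceTime Ω T → 0 < ρ →
        AnisoParabolic.CompactlyIn (AnisoParabolic.fullCylinder p (2 * ρ) θ y s)
          (AnisoParabolic.spaceTime Ω T) →
        (∀ᵐ z ∂(volume.restrict (AnisoParabolic.fullCylinder p (2 * ρ) θ y s)), u z ≤ μp) →
        volume ({z | μp - ξ * ω ≤ u z} ∩ AnisoParabolic.backCylinder p (2 * ρ) θ y s) ≤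
          ENNReal.ofReal νp * volume (AnisoParabolic.backCylinder p (2 * ρ) θ y s) →
        ∀ᵐ z ∂(volume.restrict (AnisoParabolic.backCylinder p ρ θ y s)),
          u z ≤ μp - a * ξ * ω) := by
  have hΛ : 0 < ξ * ω := mul_pos hξ.1 hω
  obtain ⟨ν, hν, h⟩ :=
    AnisoParabolic.superSolution_deGiorgi hp.one_lt_dim hp.two_lt hθ hΛ ha
  refine ⟨⟨ν, hν, ?_⟩, ⟨ν, hν, ?_⟩⟩
  · intro Ω T u y s ρ m _ _ _ hu _ _ hρ hc hm hsmall
    rw [mul_assoc]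
    exact h Ω T u y s ρ m hu hρ hc hm hsmall
  · intro Ω T u y s ρ m _ _ _ hu _ _ hρ hc hm hsmall
    rw [mul_assoc]
    have hset : {z | -u z ≤ -m + ξ * ω} = {z | m - ξ * ω ≤ u z} := by
      ext z
      simp only [mem_setOf_eq]
      constructor <;> intro hz <;> linarith
    -- The upper bound for u becomes the lower bound -m for -u, so the same ν serves both
    -- statements.
    refine (h Ω T _ y s ρ (-m) hu.neg hρ hc (hm.mono fun z hz => neg_le_neg hz) ?_).mono
      fun z hz => by linarith
    rw [hset]
    exact hsmall
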